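/- **Quantum Miura transformation.** Let $n_1\ge n_2\ge\cdots$ be a partition of $n$, with Young diagram $\mu$ whose rows have lengths $n_l$ and whose columns have lengths $m_k$; index the matrices of $g=sl_n(\mathbb C)$ by the boxes $(l,k)$ of $\mu$ (row $l$, column $k$). Let $t_+=\sum E_{(l,k),(l,k+1)}$ (the nilpotent element of the $sl_2$-embedding given by the partition), let $\delta$ be the diagonal matrix with entry $\frac{\sum_j j m_j}{\sum_j m_j}-k$ at the boxes of column $k$, let $g_m=\{x\in g: [\delta,x]=mx\}$, $m\in\mathbb Z$, and $g_\pm=\bigoplus_{\pm m>0}g_m$. The matrix units $t_\alpha=E_{ab}$, where the column of $a$ is strictly left of that of $b$, are a basis of $g_+$; put $t^\alpha=E_{ba}$ and let $\chi(J^\alpha)=\mathrm{Tr}(t_+t^\alpha)$. Let $$\Omega=U(g)\otimes Cl(g_+\oplus g_+^*),$$ where the Clifford algebra is generated by $c_\alpha,b^\alpha$ with $b^\alpha c_\beta+c_\beta b^\alpha=\delta^\alpha_\beta$ and all other anticommutators zero, and write $J(x)$ for $x\in g$ viewed in $U(g)$, $J^\alpha=J(t^\alpha)$, $f^{\alpha\beta}{}_\gamma=\mathrm{Tr}([t^\alpha,t^\beta]t_\gamma)$.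 Grade $\Omega$ by $\deg J=0$, $\deg c_\alpha=1$, $\deg b^\alpha=-1$, and bigrade it by giving $J(x)$ with $x\in g_{-k}$ bidegree $(k,-k)$, $c_\alpha$ bidegree $(1-k,k)$ and $b^\alpha$ bidegree $(k-1,-k)$ for $t_\alpha\in g_k$. Let $d_i=[Q_i,\cdot\,]$ (graded commutator), $d=d_0+d_1$, with $$Q_0=J^\alpha c_\alpha-\tfrac12 f^{\alpha\beta}{}_\gamma b^\gamma c_\alpha c_\beta,\qquad Q_1=-\chi(J^\alpha)c_\alpha .$$ The quantum finite $W$ algebra is $H^0(\Omega;d)$. For $x\in g$ let $\hat J(x)=J(x)+\sum_{\beta,\gamma}\mathrm{Tr}([x,t^\beta]t_\gamma)\,b^\gamma c_\beta$, and let $\Omega_{red}\subset\Omega$ be the subalgebra generated by all $c_\alpha$ and all $\hat J(x)$ with $x\in g_m$, $m\ge 0$. Write $X^{0,0}$ for the component of $X$ of bidegree $(0,0)$. Then: 1. Every class in $H^0(\Omega;d)$ has exactly one representative in $\Omega_{red}$. The map $x\mapsto\hat J(x)$, $x\in g_0$, extends to an injective algebra homomorphism $j:U(g_0)\to\Omega$,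 by which $U(g_0)$ is regarded as a subalgebra of $\Omega$. 2. Sending the class of a cocycle $W\in\Omega_{red}$ of degree $0$ to $W^{0,0}$ is a well defined, injective homomorphism of algebras $\Phi:H^0(\Omega;d)\to U(g_0)$, and hence an isomorphism of $H^0(\Omega;d)$ onto the algebra $H^0(\Omega;d)^{0,0}$ of these components. In particular, let $x\in g_p$ with $p\ge0$ and $[t_+,x]=0$, let $\phi_0=\hat J(x)$, and let $\phi_l\in\Omega_{red}$ ($0\le l\le p$) be elements of bidegree $(l-p,p-l)$ with $d_0\phi_l=d_1\phi_{l+1}$ for $l<p$. Then $W(\phi)=\sum_{l=0}^p(-1)^l\phi_l$ is a cocycle, and $\Phi$ maps its class to $W(\phi)^{0,0}=(-1)^p\phi_p$. 3. Consequently every $g_0$-module $M$ (for example a Fock realization of $g_0$) is a representation of $H^0(\Omega;d)$, in which the class of a cocycle $W\in\Omega_{red}$ acts on $M$ as $W^{0,0}\in U(g_0)$. -/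

import Mathlib

open scoped TensorProduct

attribute [local instance 100] LieRing.ofAssociativeRing

noncomputable section

namespace FiniteW

/-! The Lie algebra `sl_n`, with `n = μ.card`. The matrices are indexed by the boxes of the Young
diagram `μ`: the box in row `l` and column `k` (both counted from `0`) is the `k`-th weight vector
of the `l`-th irreducible `sl_2`-summand of the fundamental representation. Rows have lengths
`n_1 ≥ n_2 ≥ …`, columns have lengths `m_1 ≥ m_2 ≥ …`. -/

/-- The boxes of the diagram. -/
abbrev Box (μ : YoungDiagram) : Type := {c : ℕ × ℕ // c ∈ μ.cells}

/-- The row of a box, counted from `0`. -/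
def Box.row {μ : YoungDiagram} (a : Box μ) : ℕ := a.1.1

/-- The column of a box, counted from `0`. -/
def Box.col {μ : YoungDiagram} (a : Box μ) : ℕ := a.1.2

/-- `g = sl_n`. -/
abbrev G (μ : YoungDiagram) : LieSubalgebra ℂ (Matrix (Box μ) (Box μ) ℂ) :=
  LieAlgebra.SpecialLinear.sl (Box μ) ℂ

/-- The nilpotent element `t_+`, the sum of the matrix units `E_{(l,k),(l,k+1)}`. -/
def tPlus (μ : YoungDiagram) : Matrix (Box μ) (Box μ) ℂ :=
  Matrix.of fun a b => if a.row = b.row ∧ b.col = a.col + 1 then 1 else 0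

/-- The grading element `δ`, the diagonal matrix with entry `(∑_l l m_l) / (∑_l m_l) - k` at the
boxes of the `k`-th column (counted from `1`). A sum over all boxes of their column number is
`∑_l l m_l`. -/
def delta (μ : YoungDiagram) : Matrix (Box μ) (Box μ) ℂ :=
  Matrix.diagonal fun a =>
    (∑ c : Box μ, ((c.col : ℂ) + 1)) / (Fintype.card (Box μ) : ℂ) - ((a.col : ℂ) + 1)

/-- The eigenspace `g_m` of `ad δ` in `g`. -/
def grade (μ : YoungDiagram) (m : ℤ) : Submodule ℂ (G μ) where
  carrier := {x | delta μ * x.1 - x.1 * delta μ = (m : ℂ) • x.1}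
  add_mem' := by
    intro x y hx hy
    change delta μ * (x.1 + y.1) - (x.1 + y.1) * delta μ = (m : ℂ) • (x.1 + y.1)
    rw [smul_add, ← show _ = _ from hx, ← show _ = _ from hy]
    noncomm_ring
  zero_mem' := by simp
  smul_mem' := by
    intro r x hx
    change delta μ * (r • x.1) - (r • x.1) * delta μ = (m : ℂ) • (r • x.1)
    rw [smul_comm, ← show _ = _ from hx, Matrix.mul_smul, Matrix.smul_mul, smul_sub]

lemma mem_grade {μ : YoungDiagram} {m : ℤ} {x : G μ} :
    x ∈ grade μ m ↔ delta μ * x.1 - x.1 * delta μ = (m : ℂ) • x.1 := Iff.rfl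

/-- The subalgebra `g_0`. -/
def gZero (μ : YoungDiagram) : LieSubalgebra ℂ (G μ) :=
  { grade μ 0 with
    lie_mem' := by
      intro x y hx hy
      change x ∈ grade μ 0 at hx
      change y ∈ grade μ 0 at hy
      change ⁅x, y⁆ ∈ grade μ 0
      simp only [mem_grade, Int.cast_zero, zero_smul, sub_eq_zero,
        LieAlgebra.SpecialLinear.sl_bracket] at hx hy ⊢
      have h1 : delta μ * (x.1 * y.1) = x.1 * y.1 * delta μ := by
        rw [← mul_assoc, hx, mul_assoc, hy, mul_assoc]
      have h2 : delta μ * (y.1 * x.1) = y.1 * x.1 * delta μ := by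
        rw [← mul_assoc, hy, mul_assoc, hx, mul_assoc]
      rw [mul_sub, sub_mul, h1, h2] }

/-- The greek indices `α`: pairs of boxes `(a, b)` with the column of `a` strictly to the left of
the column of `b`. They label the basis `t_α = E_{ab}` of `g_+`. -/
abbrev Pos (μ : YoungDiagram) : Type := {p : Box μ × Box μ // p.1.col < p.2.col}

lemma Pos.ne {μ : YoungDiagram} (α : Pos μ) : α.1.1 ≠ α.1.2 := by
  intro h
  have := α.2
  rw [h] at this
  exact lt_irrefl _ this

/-- The degree of `t_α` with respect to `ad δ`. -/
def Pos.deg {μ : YoungDiagram} (α : Pos μ) : ℤ := (α.1.2.col : ℤ) - (α.1.1.col : ℤ)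

/-- `t_α = E_{ab}`, for `α = (a, b)`. -/
def tLow {μ : YoungDiagram} (α : Pos μ) : G μ :=
  LieAlgebra.SpecialLinear.single α.1.1 α.1.2 α.ne 1

/-- `t^α = E_{ba}`, for `α = (a, b)`: the index raised with the trace form. -/
def tUp {μ : YoungDiagram} (α : Pos μ) : G μ :=
  LieAlgebra.SpecialLinear.single α.1.2 α.1.1 α.ne.symm 1

/-- The nilpotent subalgebra `g_+` spanned by the `t_α`. -/
def gPlus (μ : YoungDiagram) : Submodule ℂ (G μ) := Submodule.span ℂ (Set.range tLow)

/-- The number `χ(J^α)`: the character `χ` of `g_+`, which is `1` on each `E_{(l,k),(l,k+1)}` and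
`0` on all other matrix units, at `t_α`. -/
def chi {μ : YoungDiagram} (α : Pos μ) : ℂ :=
  if α.1.1.row = α.1.2.row ∧ α.1.2.col = α.1.1.col + 1 then 1 else 0

/-- The coefficient of `t^γ` in the expansion of an element `x` of `g` (that is `Tr (x t_γ)`). -/
def upCoeff {μ : YoungDiagram} (x : G μ) (γ : Pos μ) : ℂ := x.1 γ.1.2 γ.1.1

/-! The BRST complex. -/

/-- The Clifford algebra `Cl(g_+ ⊕ g_+^*)`, for the quadratic form `(f, x) ↦ f x`. -/
abbrev Ghost (μ : YoungDiagram) : Type :=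
  CliffordAlgebra (QuadraticForm.dualProd ℂ (gPlus μ))

/-- `Ω = U g ⊗ Cl(g_+ ⊕ g_+^*)`. -/
def Om (μ : YoungDiagram) : Type :=
  UniversalEnvelopingAlgebra ℂ (G μ) ⊗[ℂ] Ghost μ

instance (μ : YoungDiagram) : Ring (Om μ) :=
  inferInstanceAs (Ring (UniversalEnvelopingAlgebra ℂ (G μ) ⊗[ℂ] Ghost μ))

instance (μ : YoungDiagram) : Algebra ℂ (Om μ) :=
  inferInstanceAs (Algebra ℂ (UniversalEnvelopingAlgebra ℂ (G μ) ⊗[ℂ] Ghost μ))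

/-- The inclusion `u ↦ u ⊗ 1`. -/
def inU (μ : YoungDiagram) : UniversalEnvelopingAlgebra ℂ (G μ) →ₐ[ℂ] Om μ :=
  (Algebra.TensorProduct.includeLeft :
    UniversalEnvelopingAlgebra ℂ (G μ) →ₐ[ℂ] UniversalEnvelopingAlgebra ℂ (G μ) ⊗[ℂ] Ghost μ)

/-- The inclusion `v ↦ 1 ⊗ v`. -/
def inGhost (μ : YoungDiagram) : Ghost μ →ₐ[ℂ] Om μ :=
  (Algebra.TensorProduct.includeRight :
    Ghost μ →ₐ[ℂ] UniversalEnvelopingAlgebra ℂ (G μ) ⊗[ℂ] Ghost μ)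

/-- The generators `J` of `U g`: `J^a` is `J (t^a)`, where `t^a` is the basis element `t_a` of `g`
with its index raised by the trace form. -/
def J {μ : YoungDiagram} : G μ →ₗ[ℂ] Om μ :=
  (inU μ).toLinearMap ∘ₗ
    (UniversalEnvelopingAlgebra.ι ℂ : G μ →ₗ⁅ℂ⁆ UniversalEnvelopingAlgebra ℂ (G μ)).toLinearMap

/-- The generators of the Clifford algebra. -/
def ghost {μ : YoungDiagram} : Module.Dual ℂ (gPlus μ) × gPlus μ →ₗ[ℂ] Om μ :=
  (inGhost μ).toLinearMap ∘ₗ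
    CliffordAlgebra.ι (QuadraticForm.dualProd ℂ (gPlus μ))

/-- `t_α` as an element of `g_+`. -/
def basisPlus {μ : YoungDiagram} (α : Pos μ) : gPlus μ :=
  ⟨tLow α, Submodule.subset_span ⟨α, rfl⟩⟩

/-- The element of `g_+^*` dual to `t_α`: the matrix entry at `α`. -/
def basisDual {μ : YoungDiagram} (α : Pos μ) : Module.Dual ℂ (gPlus μ) where
  toFun x := x.1.1 α.1.1 α.1.2
  map_add' x y := by simp
  map_smul' r x := by simp

/-- The ghost `c_α`. -/
def c {μ : YoungDiagram} (α : Pos μ) : Om μ := ghost (0, basisPlus α)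

/-- The antighost `b^α`. -/
def b {μ : YoungDiagram} (α : Pos μ) : Om μ := ghost (basisDual α, 0)

/-- `Q_0 = J^α c_α - (1/2) f^{αβ}_γ b^γ c_α c_β`. -/
def Q0 (μ : YoungDiagram) : Om μ :=
  ∑ α : Pos μ, J (tUp α) * c α -
    (1 / 2 : ℂ) • ∑ α : Pos μ, ∑ β : Pos μ, ∑ γ : Pos μ,
      upCoeff ⁅tUp α, tUp β⁆ γ • (b γ * c α * c β)

/-- `Q_1 = - χ(J^α) c_α`. -/
def Q1 (μ : YoungDiagram) : Om μ := -∑ α : Pos μ, chi α • c α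

/-- The parity automorphism of `Ω`: `X ↦ (-1)^{deg X} X`. -/
def parity (μ : YoungDiagram) : Om μ →ₐ[ℂ] Om μ :=
  (Algebra.TensorProduct.map (AlgHom.id ℂ _) CliffordAlgebra.involute :
    UniversalEnvelopingAlgebra ℂ (G μ) ⊗[ℂ] Ghost μ →ₐ[ℂ]
      UniversalEnvelopingAlgebra ℂ (G μ) ⊗[ℂ] Ghost μ)

/-- The graded commutator `X ↦ [q, X] = q X - (-1)^{deg X} X q` with an odd element `q`. -/
def gradedComm {μ : YoungDiagram} (q : Om μ) : Om μ →ₗ[ℂ] Om μ :=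
  LinearMap.mulLeft ℂ q - LinearMap.mulRight ℂ q ∘ₗ (parity μ).toLinearMap

/-- `d_0 = [Q_0, ·]`. -/
def d0 (μ : YoungDiagram) : Om μ →ₗ[ℂ] Om μ := gradedComm (Q0 μ)

/-- `d_1 = [Q_1, ·]`. -/
def d1 (μ : YoungDiagram) : Om μ →ₗ[ℂ] Om μ := gradedComm (Q1 μ)

/-- The BRST differential `d = [Q, ·]`, with `Q = Q_0 + Q_1`. -/
def d (μ : YoungDiagram) : Om μ →ₗ[ℂ] Om μ := gradedComm (Q0 μ + Q1 μ)

/-! Gradings. -/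

/-- The span of all products of generators whose degrees add up to `i`, where `R X j` says that
`X` is a generator of degree `j`. -/
def piece {A I : Type} [Ring A] [Algebra ℂ A] [AddCommGroup I] (R : A → I → Prop) (i : I) :
    Submodule ℂ A :=
  Submodule.span ℂ {X | ∃ L : List (A × I),
    (∀ p ∈ L, R p.1 p.2) ∧ (L.map Prod.fst).prod = X ∧ (L.map Prod.snd).sum = i}

/-- The ghost number of the generators: `0` for `J^a`, `1` for `c_α`, `-1` for `b^α`. -/
inductive HasDeg {μ : YoungDiagram} : Om μ → ℤ → Prop
  | J (x : G μ) : HasDeg (J x) 0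
  | c (α : Pos μ) : HasDeg (c α) 1
  | b (α : Pos μ) : HasDeg (b α) (-1)

/-- The bidegree of the generators. If `t_a ∈ g_k`, then `J^a = J (t^a)` with `t^a ∈ g_{-k}` has
bidegree `(k, -k)`. If `t_α ∈ g_k`, then `c_α` has bidegree `(1 - k, k)` and `b^α` has bidegree
`(k - 1, -k)`. -/
inductive HasBideg {μ : YoungDiagram} : Om μ → ℤ × ℤ → Prop
  | J (k : ℤ) (x : G μ) (hx : x ∈ grade μ (-k)) : HasBideg (J x) (k, -k)
  | c (α : Pos μ) : HasBideg (c α) (1 - α.deg, α.deg)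
  | b (α : Pos μ) : HasBideg (b α) (α.deg - 1, -α.deg)

/-- The space `Ω^k`. -/
def Odeg (μ : YoungDiagram) (k : ℤ) : Submodule ℂ (Om μ) := piece HasDeg k

/-- The space `Ω^{k,l}`. -/
def Obideg (μ : YoungDiagram) (p : ℤ × ℤ) : Submodule ℂ (Om μ) := piece HasBideg p

section piece

variable {A I : Type} [Ring A] [Algebra ℂ A] [AddCommGroup I] {R : A → I → Prop}

lemma one_mem_piece : (1 : A) ∈ piece R 0 :=
  Submodule.subset_span ⟨[], by simp, by simp, by simp⟩

lemma gen_mem_piece {X : A} {i : I} (h : R X i) : X ∈ piece R i :=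
  Submodule.subset_span ⟨[(X, i)], by simpa using h, by simp, by simp⟩

lemma mul_mem_piece {i j : I} {X Y : A} (hX : X ∈ piece R i) (hY : Y ∈ piece R j) :
    X * Y ∈ piece R (i + j) := by
  have : X * Y ∈ piece R i * piece R j := Submodule.mul_mem_mul hX hY
  refine (?_ : piece R i * piece R j ≤ piece R (i + j)) this
  rw [piece, piece, Submodule.span_mul_span]
  refine Submodule.span_mono ?_
  rintro _ ⟨_, ⟨L, hL, rfl, rfl⟩, _, ⟨M, hM, rfl, rfl⟩, rfl⟩
  refine ⟨L ++ M, ?_, by simp, by simp⟩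
  intro p hp
  rcases List.mem_append.1 hp with h | h
  exacts [hL p h, hM p h]

/-- An inner derivation acts on a graded piece by a scalar if it does so on generators. -/
lemma piece_le_eigenspace (N : A) (φ : I →+ ℂ)
    (h : ∀ X i, R X i → N * X - X * N = φ i • X) (i : I) :
    piece R i ≤ Module.End.eigenspace (LinearMap.mulLeft ℂ N - LinearMap.mulRight ℂ N) (φ i) := by
  refine Submodule.span_le.2 ?_
  rintro _ ⟨L, hL, rfl, rfl⟩
  rw [SetLike.mem_coe, Module.End.mem_eigenspace_iff]
  simp only [LinearMap.sub_apply, LinearMap.mulLeft_apply, LinearMap.mulRight_apply]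
  induction L with
  | nil => simp
  | cons p L ih =>
    have h1 := h p.1 p.2 (hL p (by simp))
    have h2 := ih (fun q hq => hL q (by simp [hq]))
    simp only [List.map_cons, List.prod_cons, List.sum_cons, map_add, add_smul]
    rw [← smul_mul_assoc, ← h1, ← mul_smul_comm, ← h2]
    noncomm_ring

end piece

/-! The bigrading is a direct sum decomposition. -/

section bigrading

variable {μ : YoungDiagram}

lemma J_mul_ghost (x : G μ) (v) : J x * ghost v = ghost v * J x := by
  have h (u : UniversalEnvelopingAlgebra ℂ (G μ)) (w : Ghost μ) :
      (u ⊗ₜ[ℂ] (1 : Ghost μ)) * ((1 : UniversalEnvelopingAlgebra ℂ (G μ)) ⊗ₜ[ℂ] w) =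
      ((1 : UniversalEnvelopingAlgebra ℂ (G μ)) ⊗ₜ[ℂ] w) * (u ⊗ₜ[ℂ] (1 : Ghost μ)) := by
    rw [Algebra.TensorProduct.tmul_mul_tmul, Algebra.TensorProduct.tmul_mul_tmul, one_mul, mul_one,
      one_mul, mul_one]
  exact h _ _

lemma J_lie (x y : G μ) : J ⁅x, y⁆ = J x * J y - J y * J x := by
  simp only [J, LinearMap.comp_apply, LieHom.coe_toLinearMap, LieHom.map_lie,
    LieRing.of_associative_ring_bracket, AlgHom.toLinearMap_apply, map_sub, map_mul]

lemma clifford_aux {M A : Type} [AddCommGroup M] [Module ℂ M] (Q : QuadraticForm ℂ M) [Ring A]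
    [Algebra ℂ A] (f : CliffordAlgebra Q →ₐ[ℂ] A) (v w : M) :
    f (CliffordAlgebra.ι Q v) * f (CliffordAlgebra.ι Q w) +
      f (CliffordAlgebra.ι Q w) * f (CliffordAlgebra.ι Q v) =
      (QuadraticMap.polar Q v w) • (1 : A) := by
  rw [← map_mul f, ← map_mul f, ← map_add f, CliffordAlgebra.ι_mul_ι_add_swap, AlgHom.commutes,
    Algebra.algebraMap_eq_smul_one]

lemma involute_aux {M U : Type} [AddCommGroup M] [Module ℂ M] (Q : QuadraticForm ℂ M) [Ring U]
    [Algebra ℂ U] (v : M) :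
    Algebra.TensorProduct.map (AlgHom.id ℂ U) CliffordAlgebra.involute
      ((1 : U) ⊗ₜ[ℂ] CliffordAlgebra.ι Q v) = -((1 : U) ⊗ₜ[ℂ] CliffordAlgebra.ι Q v) := by
  rw [Algebra.TensorProduct.map_tmul, map_one, CliffordAlgebra.involute_ι, TensorProduct.tmul_neg]

lemma ghost_mul_ghost (v w : Module.Dual ℂ (gPlus μ) × gPlus μ) :
    ghost v * ghost w + ghost w * ghost v = (v.1 w.2 + w.1 v.2) • (1 : Om μ) := by
  have h := clifford_aux (QuadraticForm.dualProd ℂ (gPlus μ)) (inGhost μ) v w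
  have h2 : QuadraticMap.polar (QuadraticForm.dualProd ℂ (gPlus μ)) v w = v.1 w.2 + w.1 v.2 := by
    simp [QuadraticMap.polar]; ring
  rw [h2] at h
  exact h

lemma basisDual_basisPlus (α β : Pos μ) :
    basisDual α (basisPlus β) = if α = β then 1 else 0 := by
  change Matrix.single β.1.1 β.1.2 (1 : ℂ) α.1.1 α.1.2 = _
  rw [Matrix.single_apply]
  refine if_congr ?_ rfl rfl
  refine ⟨fun h => Subtype.ext (Prod.ext h.1.symm h.2.symm), ?_⟩
  rintro rfl
  exact ⟨rfl, rfl⟩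

lemma c_mul_c (α β : Pos μ) : c α * c β = -(c β * c α) := by
  have := ghost_mul_ghost (μ := μ) (0, basisPlus α) (0, basisPlus β)
  exact eq_neg_of_add_eq_zero_left (by simpa [c] using this)

lemma b_mul_b (α β : Pos μ) : b α * b β = -(b β * b α) := by
  have := ghost_mul_ghost (μ := μ) (basisDual α, 0) (basisDual β, 0)
  exact eq_neg_of_add_eq_zero_left (by simpa [b] using this)

lemma b_mul_c (α β : Pos μ) : b α * c β = (if α = β then 1 else 0 : ℂ) • 1 - c β * b α := by
  have := ghost_mul_ghost (μ := μ) (basisDual α, 0) (0, basisPlus β)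
  rw [eq_sub_iff_add_eq]
  simpa [b, c, basisDual_basisPlus] using this

lemma trace_delta : (delta μ).trace = 0 := by
  rcases isEmpty_or_nonempty (Box μ) with h | h
  · simp [Matrix.trace]
  · have : (Fintype.card (Box μ) : ℂ) ≠ 0 := Nat.cast_ne_zero.2 Fintype.card_ne_zero
    simp only [delta, Matrix.trace_diagonal, Finset.sum_sub_distrib, Finset.sum_const,
      Finset.card_univ, nsmul_eq_mul]
    rw [mul_div_cancel₀ _ this, sub_self]

/-- `δ` as an element of `g`. -/
def deltaG (μ : YoungDiagram) : G μ := ⟨delta μ, trace_delta⟩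

/-- An element whose adjoint action is `k + i l` on `Ω^{k,l}`. -/
def numberOp (μ : YoungDiagram) : Om μ :=
  (Complex.I - 1) • J (deltaG μ) +
    ∑ α : Pos μ, (1 + (Complex.I - 1) * (α.deg : ℂ)) • (c α * b α)

/-- The injective map `(k, l) ↦ k + i l`. -/
def bidegToComplex : ℤ × ℤ →+ ℂ where
  toFun p := p.1 + Complex.I * p.2
  map_zero' := by simp
  map_add' p q := by push_cast [Prod.fst_add, Prod.snd_add]; ring

lemma bidegToComplex_injective : Function.Injective bidegToComplex := by
  intro p q h
  have h1 := congrArg Complex.re h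
  have h2 := congrArg Complex.im h
  simp [bidegToComplex] at h1 h2
  exact Prod.ext (by exact_mod_cast h1) (by exact_mod_cast h2)

lemma numberOp_gen (X : Om μ) (p : ℤ × ℤ) (h : HasBideg X p) :
    numberOp μ * X - X * numberOp μ = bidegToComplex p • X := by
  have key : numberOp μ * X - X * numberOp μ =
      (Complex.I - 1) • (J (deltaG μ) * X - X * J (deltaG μ)) +
      ∑ α : Pos μ, (1 + (Complex.I - 1) * (α.deg : ℂ)) • (c α * b α * X - X * (c α * b α)) := by
    simp only [numberOp, add_mul, mul_add, Finset.sum_mul, Finset.mul_sum, smul_mul_assoc,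
      mul_smul_comm, smul_sub, Finset.sum_sub_distrib]
    abel
  rw [key]
  cases h with
  | J k x hx =>
    have h1 : ⁅deltaG μ, x⁆ = ((-k : ℤ) : ℂ) • x := Subtype.ext hx
    have h2 : ∀ α : Pos μ, c α * b α * J x - J x * (c α * b α) = 0 := by
      intro α
      have e1 : J x * c α = c α * J x := J_mul_ghost _ _
      have e2 : J x * b α = b α * J x := J_mul_ghost _ _
      rw [← mul_assoc (J x), e1, mul_assoc (c α) (J x), e2, mul_assoc, sub_self]
    rw [← J_lie, h1, map_smul, smul_smul]
    simp only [h2, smul_zero, Finset.sum_const_zero, add_zero]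
    congr 1
    simp [bidegToComplex]
    ring
  | c β =>
    have h1 : J (deltaG μ) * c β - c β * J (deltaG μ) = 0 := sub_eq_zero.2 (J_mul_ghost _ _)
    have h2 : ∀ α : Pos μ, c α * b α * c β - c β * (c α * b α) =
        (if α = β then (1 : ℂ) else 0) • c α := by
      intro α
      rw [mul_assoc, b_mul_c, mul_sub, ← mul_assoc (c α), ← mul_assoc (c β), c_mul_c β α]
      simp
    simp only [h1, h2, smul_zero, zero_add, ite_smul, one_smul, zero_smul, smul_ite,
      Finset.sum_ite_eq', Finset.mem_univ, if_true]
    congr 1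
    simp [bidegToComplex]
    ring
  | b β =>
    have h1 : J (deltaG μ) * b β - b β * J (deltaG μ) = 0 := sub_eq_zero.2 (J_mul_ghost _ _)
    have h2 : ∀ α : Pos μ, c α * b α * b β - b β * (c α * b α) =
        -((if α = β then (1 : ℂ) else 0) • b α) := by
      intro α
      rw [← mul_assoc (b β), b_mul_c, sub_mul, mul_assoc (c α), mul_assoc (c α), b_mul_b β α]
      simp [eq_comm]
    simp only [h1, h2, smul_zero, zero_add, ite_smul, one_smul, zero_smul, smul_ite, smul_neg,
      Finset.sum_neg_distrib, Finset.sum_ite_eq', Finset.mem_univ, if_true]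
    rw [← neg_smul]
    congr 1
    simp [bidegToComplex]
    ring

lemma Obideg_iSupIndep (μ : YoungDiagram) : iSupIndep (Obideg μ) := by
  have h := (Module.End.eigenspaces_iSupIndep (LinearMap.mulLeft ℂ (numberOp μ) -
    LinearMap.mulRight ℂ (numberOp μ))).comp bidegToComplex_injective
  exact h.mono fun p => piece_le_eigenspace _ bidegToComplex numberOp_gen p

lemma mem_grade_iff {m : ℤ} {x : G μ} :
    x ∈ grade μ m ↔ ∀ a e : Box μ, (e.col : ℤ) - a.col ≠ m → x.1 a e = 0 := by
  rw [mem_grade, ← Matrix.ext_iff]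
  refine forall₂_congr fun a e => ?_
  have : (delta μ * x.1 - x.1 * delta μ) a e = (((e.col : ℤ) - a.col : ℤ) : ℂ) * x.1 a e := by
    simp [delta]
    ring
  rw [this, Matrix.smul_apply, smul_eq_mul, ← sub_eq_zero, ← sub_mul, mul_eq_zero, sub_eq_zero,
    Int.cast_inj]
  tauto

/-- The part of degree `m` of a matrix. -/
def gradeProj (m : ℤ) (x : G μ) : G μ :=
  ⟨Matrix.of fun a e => if (e.col : ℤ) - a.col = m then x.1 a e else 0, by
    change Matrix.trace _ = 0
    have hx : Matrix.trace x.1 = 0 := x.2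
    simp only [Matrix.trace, Matrix.diag_apply, Matrix.of_apply, sub_self] at hx ⊢
    split_ifs
    · exact hx
    · simp⟩

lemma gradeProj_mem (m : ℤ) (x : G μ) : gradeProj m x ∈ grade μ m := by
  rw [mem_grade_iff]
  intro a e h
  simp [gradeProj, h]

lemma sum_gradeProj (x : G μ) :
    ∑ m ∈ Finset.univ.image (fun p : Box μ × Box μ => (p.2.col : ℤ) - p.1.col),
      gradeProj m x = x := by
  refine Subtype.ext (Matrix.ext fun a e => ?_)
  rw [AddSubmonoidClass.coe_finsetSum, Matrix.sum_apply]
  simp only [gradeProj, Matrix.of_apply, Finset.sum_ite_eq]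
  rw [if_pos (Finset.mem_image.2 ⟨(a, e), Finset.mem_univ _, rfl⟩)]

lemma gPlus_expand (x : gPlus μ) : x = ∑ α : Pos μ, basisDual α x • basisPlus α := by
  obtain ⟨x, hx⟩ := x
  induction hx using Submodule.span_induction with
  | mem x h =>
    obtain ⟨β, rfl⟩ := h
    change basisPlus β = ∑ α : Pos μ, basisDual α (basisPlus β) • basisPlus α
    simp [basisDual_basisPlus]
  | zero =>
    change (0 : gPlus μ) = ∑ α : Pos μ, basisDual α 0 • basisPlus α
    simp
  | add x y hx hy h1 h2 =>
    change (⟨x, hx⟩ + ⟨y, hy⟩ : gPlus μ) =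
      ∑ α : Pos μ, basisDual α (⟨x, hx⟩ + ⟨y, hy⟩) • basisPlus α
    simp only [map_add, add_smul, Finset.sum_add_distrib, ← h1, ← h2]
  | smul r x hx h1 =>
    change (r • ⟨x, hx⟩ : gPlus μ) = ∑ α : Pos μ, basisDual α (r • ⟨x, hx⟩) • basisPlus α
    simp only [map_smul, smul_assoc, ← Finset.smul_sum, ← h1]

lemma dual_expand (f : Module.Dual ℂ (gPlus μ)) :
    f = ∑ α : Pos μ, f (basisPlus α) • basisDual α := by
  ext x
  conv_lhs => rw [gPlus_expand x]
  simp [mul_comm]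

/-- A subalgebra of `Ω` that contains the homogeneous generators is everything. -/
lemma subalgebra_eq_top (S : Subalgebra ℂ (Om μ)) (hS : ∀ X p, HasBideg X p → X ∈ S) :
    S = ⊤ := by
  have hJ : ∀ x : G μ, J x ∈ S := by
    intro x
    rw [← sum_gradeProj x, map_sum]
    exact S.sum_mem fun m _ => hS _ _ (HasBideg.J (-m) _ (by simpa using gradeProj_mem m x))
  have hg : ∀ v, (ghost v : Om μ) ∈ S := by
    rintro ⟨f, x⟩
    have e : (f, x) = ∑ α : Pos μ, f (basisPlus α) • (basisDual α, (0 : gPlus μ)) +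
        ∑ α : Pos μ, basisDual α x • ((0 : Module.Dual ℂ (gPlus μ)), basisPlus α) := by
      refine Prod.ext ?_ ?_
      · simpa [Prod.fst_sum] using dual_expand f
      · simpa [Prod.snd_sum] using gPlus_expand x
    rw [e, map_add, map_sum, map_sum]
    refine S.add_mem (S.sum_mem fun α _ => ?_) (S.sum_mem fun α _ => ?_)
    · rw [map_smul]
      exact S.smul_mem (hS _ _ (HasBideg.b α)) _
    · rw [map_smul]
      exact S.smul_mem (hS _ _ (HasBideg.c α)) _
  have hU : ∀ u, inU μ u ∈ S := by
    let f : G μ →ₗ⁅ℂ⁆ S :=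
      { (J (μ := μ)).codRestrict (Subalgebra.toSubmodule S) hJ with
        map_lie' := by
          intro x y
          exact Subtype.ext (J_lie x y) }
    have h : (S.val.comp (UniversalEnvelopingAlgebra.lift ℂ f)) = inU μ := by
      refine UniversalEnvelopingAlgebra.hom_ext (R := ℂ) (L := G μ) ?_
      ext x
      change (UniversalEnvelopingAlgebra.lift ℂ f (UniversalEnvelopingAlgebra.ι ℂ x)).1 = J x
      rw [UniversalEnvelopingAlgebra.lift_ι_apply]
      rfl
    intro u
    rw [← h]
    exact (UniversalEnvelopingAlgebra.lift ℂ f u).2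
  have hC : ∀ u, inGhost μ u ∈ S := by
    intro u
    induction u using CliffordAlgebra.induction with
    | algebraMap r => rw [AlgHom.commutes]; exact S.algebraMap_mem r
    | ι v => exact hg v
    | mul u v hu hv => rw [map_mul]; exact S.mul_mem hu hv
    | add u v hu hv => rw [map_add]; exact S.add_mem hu hv
  refine top_unique fun X _ => ?_
  induction X using TensorProduct.induction_on with
  | zero => exact S.zero_mem
  | add X Y hX hY => exact S.add_mem (hX trivial) (hY trivial)
  | tmul u v =>
    have h1 : (u ⊗ₜ[ℂ] v : UniversalEnvelopingAlgebra ℂ (G μ) ⊗[ℂ] Ghost μ) =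
        (u ⊗ₜ[ℂ] (1 : Ghost μ)) * ((1 : UniversalEnvelopingAlgebra ℂ (G μ)) ⊗ₜ[ℂ] v) := by
      rw [Algebra.TensorProduct.tmul_mul_tmul, one_mul, mul_one]
    rw [h1]
    exact S.mul_mem (hU u) (hC v)

lemma Obideg_iSup (μ : YoungDiagram) : ⨆ p, Obideg μ p = ⊤ := by
  let S : Subalgebra ℂ (Om μ) := (⨆ p, Obideg μ p).toSubalgebra
    (Submodule.mem_iSup_of_mem 0 one_mem_piece) (by
      intro X Y hX hY
      induction hX using Submodule.iSup_induction' with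
      | zero => simp
      | add X X' _ _ h1 h2 => rw [add_mul]; exact Submodule.add_mem _ h1 h2
      | mem p X hX =>
        induction hY using Submodule.iSup_induction' with
        | zero => simp
        | add X X' _ _ h1 h2 => rw [mul_add]; exact Submodule.add_mem _ h1 h2
        | mem q Y hY => exact Submodule.mem_iSup_of_mem (p + q) (mul_mem_piece hX hY))
  have h := subalgebra_eq_top S fun X p h => Submodule.mem_iSup_of_mem p (gen_mem_piece h)
  refine top_unique fun X _ => ?_
  have : X ∈ S := h ▸ Algebra.mem_top
  exact this

instance (μ : YoungDiagram) : DirectSum.Decomposition (Obideg μ) :=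
  (DirectSum.isInternal_submodule_of_iSupIndep_of_iSup_eq_top (Obideg_iSupIndep μ)
    (Obideg_iSup μ)).chooseDecomposition

end bigrading

/-- The component `X^{0,0}` of bidegree `(0, 0)`. -/
def comp00 {μ : YoungDiagram} (X : Om μ) : Om μ :=
  DirectSum.decompose (Obideg μ) X (0, 0)

/-! The quantum finite `W` algebra. -/

section cohomology

variable {μ : YoungDiagram}

lemma parity_J (x : G μ) : parity μ (J x) = J x := by
  have h (u : UniversalEnvelopingAlgebra ℂ (G μ)) :
      Algebra.TensorProduct.map (AlgHom.id ℂ _) CliffordAlgebra.involute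
        (u ⊗ₜ[ℂ] (1 : Ghost μ)) = u ⊗ₜ[ℂ] (1 : Ghost μ) := by
    rw [Algebra.TensorProduct.map_tmul, map_one, AlgHom.id_apply]
  exact h _

lemma parity_ghost (v : Module.Dual ℂ (gPlus μ) × gPlus μ) :
    parity μ (ghost v) = -ghost v := by
  exact involute_aux (QuadraticForm.dualProd ℂ (gPlus μ)) v

lemma parity_gen {X : Om μ} {k : ℤ} (h : HasDeg X k) : parity μ X = ((-1 : ℂ) ^ k) • X := by
  cases h with
  | J x => rw [parity_J, zpow_zero, one_smul]
  | c α => rw [c, parity_ghost, zpow_one, neg_one_smul]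
  | b α =>
    rw [b, parity_ghost, show ((-1 : ℂ) ^ (-1 : ℤ)) = -1 by norm_num, neg_one_smul]

lemma parity_apply_of_mem {k : ℤ} {X : Om μ} (hX : X ∈ Odeg μ k) :
    parity μ X = ((-1 : ℂ) ^ k) • X := by
  induction hX using Submodule.span_induction with
  | zero => simp
  | add X Y _ _ h1 h2 => rw [map_add, h1, h2, smul_add]
  | smul r X _ h => rw [map_smul, h, smul_comm]
  | mem X h =>
    obtain ⟨L, hL, rfl, rfl⟩ := h
    induction L with
    | nil => simp
    | cons p L ih =>
      have h1 : parity μ p.1 = ((-1 : ℂ) ^ p.2) • p.1 := parity_gen (hL p (by simp))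
      have h2 := ih (fun q hq => hL q (by simp [hq]))
      simp only [List.map_cons, List.prod_cons, List.sum_cons, map_mul, h1, h2,
        zpow_add₀ (show (-1 : ℂ) ≠ 0 by norm_num), smul_mul_smul_comm]

/-- On `Ω^k`, the differential is `X ↦ Q X - (-1)^k X Q`. -/
lemma d_apply_of_mem {k : ℤ} {X : Om μ} (hX : X ∈ Odeg μ k) :
    d μ X = (Q0 μ + Q1 μ) * X - ((-1 : ℂ) ^ k) • (X * (Q0 μ + Q1 μ)) := by
  simp [d, gradedComm, parity_apply_of_mem hX]

lemma d_mul (X Y : Om μ) : d μ (X * Y) = d μ X * Y + parity μ X * d μ Y := by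
  simp only [d, gradedComm, LinearMap.sub_apply, LinearMap.mulLeft_apply, LinearMap.comp_apply,
    LinearMap.mulRight_apply, AlgHom.toLinearMap_apply, map_mul]
  noncomm_ring

/-- The algebra of cocycles of degree `0`. -/
def cocycles (μ : YoungDiagram) : Subalgebra ℂ (Om μ) where
  carrier := {X | X ∈ Odeg μ 0 ∧ d μ X = 0}
  mul_mem' := by
    rintro X Y ⟨hX, hX'⟩ ⟨hY, hY'⟩
    exact ⟨by simpa [Odeg] using mul_mem_piece hX hY, by rw [d_mul, hX', hY']; simp⟩
  add_mem' := by
    rintro X Y ⟨hX, hX'⟩ ⟨hY, hY'⟩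
    exact ⟨Submodule.add_mem _ hX hY, by rw [map_add, hX', hY', add_zero]⟩
  algebraMap_mem' r := by
    rw [Algebra.algebraMap_eq_smul_one]
    exact ⟨Submodule.smul_mem _ _ one_mem_piece, by simp [d, gradedComm]⟩

/-- The two-sided ideal of coboundaries `d Y`, `Y ∈ Ω^{-1}`, in the algebra of cocycles of
degree `0`. (As `d ∘ d = 0`, it consists of all `d Y` with `Y ∈ Ω^{-1}`.) -/
def coboundaries (μ : YoungDiagram) : Ideal (cocycles μ) where
  carrier := {X | ∃ Y ∈ Odeg μ (-1), d μ Y = X.1}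
  add_mem' := by
    rintro X X' ⟨Y, hY, h⟩ ⟨Y', hY', h'⟩
    exact ⟨Y + Y', Submodule.add_mem _ hY hY', by rw [map_add, h, h']; rfl⟩
  zero_mem' := ⟨0, Submodule.zero_mem _, by simp⟩
  smul_mem' := by
    rintro Z X ⟨Y, hY, h⟩
    refine ⟨Z.1 * Y, by simpa [Odeg] using mul_mem_piece Z.2.1 hY, ?_⟩
    rw [d_mul, h, parity_apply_of_mem Z.2.1, Z.2.2]
    simp

instance (μ : YoungDiagram) : (coboundaries μ).IsTwoSided where
  mul_mem_of_left := by
    rintro X Z ⟨Y, hY, h⟩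
    refine ⟨Y * Z.1, by simpa [Odeg] using mul_mem_piece hY Z.2.1, ?_⟩
    rw [d_mul, h, Z.2.2]
    simp

/-- The quantum finite `W` algebra `H^0(Ω; d)`. -/
abbrev W (μ : YoungDiagram) : Type := cocycles μ ⧸ coboundaries μ

/-- The class of a cocycle. -/
def cls : cocycles μ →ₐ[ℂ] W μ := Ideal.Quotient.mkₐ ℂ (coboundaries μ)

end cohomology

/-- The elements `Ĵ^a = J^a + f^{aβ}_γ b^γ c_β`, as a linear function of `t^a`. -/
def Jhat {μ : YoungDiagram} : G μ →ₗ[ℂ] Om μ where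
  toFun x := J x + ∑ β : Pos μ, ∑ γ : Pos μ, upCoeff ⁅x, tUp β⁆ γ • (b γ * c β)
  map_add' x y := by
    have (β γ : Pos μ) : upCoeff ⁅x + y, tUp β⁆ γ =
        upCoeff ⁅x, tUp β⁆ γ + upCoeff ⁅y, tUp β⁆ γ := by rw [add_lie]; rfl
    simp only [this, map_add, add_smul, Finset.sum_add_distrib]
    abel
  map_smul' r x := by
    have (β γ : Pos μ) : upCoeff ⁅r • x, tUp β⁆ γ = r * upCoeff ⁅x, tUp β⁆ γ := by
      rw [smul_lie]; rfl
    simp only [this, map_smul, mul_smul, ← Finset.smul_sum, smul_add, RingHom.id_apply]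

/-- The subalgebra `Ω_red` generated by the `c_α` and the `Ĵ^a` with `t_a ∈ g_- ⊕ g_0`, that is
`t^a ∈ g_0 ⊕ g_+`. -/
def Ored (μ : YoungDiagram) : Subalgebra ℂ (Om μ) :=
  Algebra.adjoin ℂ ({X | ∃ k : ℤ, 0 ≤ k ∧ ∃ x ∈ grade μ k, Jhat x = X} ∪ Set.range c)

/-- A tic-tac-toe sequence `φ_0, …, φ_p`: `φ_0 = Ĵ(x)` with `x ∈ g_p` and `[t_+, x] = 0` has
bidegree `(-p, p)`, and `φ_l ∈ Ω_red^{l-p,p-l}` with `d_0 φ_l = d_1 φ_{l+1}`. -/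
structure IsTicTacToe {μ : YoungDiagram} (p : ℕ) (x : G μ) (φ : ℕ → Om μ) : Prop where
  mem_grade : x ∈ grade μ p
  highest : tPlus μ * x.1 - x.1 * tPlus μ = 0
  start : φ 0 = Jhat x
  red : ∀ l ≤ p, φ l ∈ Ored μ
  bideg : ∀ l ≤ p, φ l ∈ Obideg μ ((l : ℤ) - p, (p : ℤ) - l)
  step : ∀ l < p, d0 μ (φ l) = d1 μ (φ (l + 1))

/-- The element `W(φ) = ∑ (-1)^l φ_l`. -/
def ticTacToeSum {μ : YoungDiagram} (p : ℕ) (φ : ℕ → Om μ) : Om μ :=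
  ∑ l ∈ Finset.range (p + 1), (-1 : ℂ) ^ l • φ l

end FiniteW

end

/-! Put `D^α = d b^α = Ĵ(t^α) - χ(J^α)`. The algebra `Ω` has a basis of ordered monomials in the
`Ĵ(x)`, with `x` in a basis of `g_0 ⊕ g_+`, then the `c_α`, and then the pairs `D^α`, `b^α`
(`Letter.omBasis`). In these coordinates `Ω` is `Ω_red` with one Koszul pair after another attached
on the right, and a pair `(D^α, b^α)` has no cohomology beyond the constants. Since `Ω_red` is
stable under `d`, the pairs can be contracted one at a time, and `Ω_red ⊂ Ω` is a quasi-isomorphism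
(`Contraction.spec`, `Letter.stage_quasi_iso`). There is nothing of negative degree in `Ω_red`,
hence there are no coboundaries in its degree `0`, and its part of degree `0` is a faithful copy of
`U(g_0 ⊕ g_+)` (`exists_JP_eq`, `JP_injective`). This gives the unique representatives.

For `x ∈ g_k` the element `Ĵ(x)` has bidegree `(-k, k)`. On `U(g_0 ⊕ g_+)`, taking the component of
bidegree `(0, 0)` is therefore the homomorphism onto `U(g_0)` that kills `g_+` (`comp00_JP`), which
is why `Φ` is multiplicative.

The injectivity of `Φ` is a leading term argument. On `U(g_0 ⊕ g_+)` the operator `[b^β, d ·]` acts,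
up to lower terms, as a derivation that sends `Ĵ(x)` to `Ĵ` of the `g_0 ⊕ g_+` part of `[t^β, x]`.
Let `ψ(x) = Tr(κ x)` with `κ` the diagonal matrix of column numbers; then `ψ([t^β, t_α])` is zero
for `α ≠ β` and positive for `α = β`. Choose a basis of `g_0` in which `ψ` is a coordinate, and give
the basis vector of that coordinate a slightly larger weight than the others. The leading term of
`[b^β, d ·]` then replaces one factor `Ĵ(t_β)` by a nonzero multiple of the heavy letter
(`Letter.bd_mono`). Distinct monomials stay distinct, so the terms of highest weight of a cocycle
contain no `Ĵ(t_β)` (`Letter.not_plus_mem`). They belong to `U(g_0)` and are visible in the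
component of bidegree `(0, 0)`; a nonzero cocycle thus has a nonzero image.

That the ordered monomials span `Ω` follows by sorting. Their independence comes from operators that
delete a chosen letter up to lower terms (`sum_word_eq_zero_of_mem_filt`): for a ghost, the graded
commutator with the conjugate ghost; for a `Ĵ`, a contraction of the coaction `J x ↦ x ⊗ 1 + 1 ⊗ J
x` of matrices on `Ω` with a functional. -/

noncomputable section

namespace FiniteW

/-! Ordered monomials in an algebra that is commutative or anticommutative up to lower terms. -/

section words

variable {K A Z : Type*} [Field K] [Ring A] [Algebra K A]

/-- The weight of a multiset of letters. -/
def wt (w : Z → ℕ) (m : Multiset Z) : ℕ := (m.map w).sum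

/-- The span of the products of letters of total weight at most `n`. -/
def filt (K : Type*) [Field K] [Algebra K A] (g : Z → A) (w : Z → ℕ) (n : ℤ) : Submodule K A :=
  Submodule.span K {X | ∃ L : List Z, (wt w (L : Multiset Z) : ℤ) ≤ n ∧ (L.map g).prod = X}

variable {g : Z → A} {w : Z → ℕ}

lemma wt_cons (z : Z) (m : Multiset Z) : wt w (z ::ₘ m) = w z + wt w m := by simp [wt]

lemma wt_coe_cons (z : Z) (L : List Z) :
    wt w ((z :: L : List Z) : Multiset Z) = w z + wt w (L : Multiset Z) := by simp [wt]

lemma wt_coe_append (L M : List Z) :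
    wt w ((L ++ M : List Z) : Multiset Z) = wt w (L : Multiset Z) + wt w (M : Multiset Z) := by
  simp [wt]

lemma wt_replicate (k : ℕ) (z : Z) :
    wt w ((List.replicate k z : List Z) : Multiset Z) = k * w z := by simp [wt]

lemma prod_mem_filt {L : List Z} {n : ℤ} (h : (wt w (L : Multiset Z) : ℤ) ≤ n) :
    (L.map g).prod ∈ filt K g w n :=
  Submodule.subset_span ⟨L, h, rfl⟩

lemma filt_mono {n m : ℤ} (h : n ≤ m) : filt K g w n ≤ filt K g w m :=
  Submodule.span_mono fun _ ⟨L, h1, h2⟩ => ⟨L, h1.trans h, h2⟩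

lemma filt_neg {n : ℤ} (h : n < 0) : filt K g w n = ⊥ := by
  refine Submodule.span_eq_bot.2 ?_
  rintro _ ⟨L, h1, rfl⟩
  omega

lemma gen_mem_filt {z : Z} {n : ℤ} (h : (w z : ℤ) ≤ n) : g z ∈ filt K g w n := by
  have := prod_mem_filt (K := K) (g := g) (w := w) (L := [z]) (n := n) (by simpa [wt] using h)
  simpa using this

lemma one_mem_filt {n : ℤ} (h : 0 ≤ n) : (1 : A) ∈ filt K g w n := by
  have := prod_mem_filt (K := K) (g := g) (w := w) (L := []) (n := n) (by simpa [wt] using h)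
  simpa using this

lemma mul_mem_filt {n m k : ℤ} {X Y : A} (hX : X ∈ filt K g w n) (hY : Y ∈ filt K g w m)
    (h : n + m ≤ k) : X * Y ∈ filt K g w k := by
  have h1 : X * Y ∈ filt K g w n * filt K g w m := Submodule.mul_mem_mul hX hY
  refine (?_ : filt K g w n * filt K g w m ≤ filt K g w k) h1
  rw [filt, filt, Submodule.span_mul_span]
  refine Submodule.span_le.2 ?_
  rintro _ ⟨_, ⟨L, hL, rfl⟩, _, ⟨M, hM, rfl⟩, rfl⟩
  have h2 : (wt w ((L ++ M : List Z) : Multiset Z) : ℤ) ≤ k := by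
    rw [wt_coe_append]; push_cast; omega
  simpa using prod_mem_filt (K := K) (g := g) h2

/-- The union of the filtration. -/
def filtAlg (K : Type*) [Field K] [Algebra K A] (g : Z → A) (w : Z → ℕ) : Subalgebra K A where
  carrier := {X | ∃ n : ℕ, X ∈ filt K g w n}
  mul_mem' := by
    rintro X Y ⟨n, hn⟩ ⟨m, hm⟩
    exact ⟨n + m, mul_mem_filt hn hm (by push_cast; rfl)⟩
  add_mem' := by
    rintro X Y ⟨n, hn⟩ ⟨m, hm⟩
    exact ⟨n + m, Submodule.add_mem _ (filt_mono (by push_cast; omega) hn)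
      (filt_mono (by push_cast; omega) hm)⟩
  algebraMap_mem' r := ⟨0, by
    rw [Algebra.algebraMap_eq_smul_one]
    exact Submodule.smul_mem _ _ (one_mem_filt (by simp))⟩

lemma mul_gen_prod {z : Z} {L : List Z} : g z * (L.map g).prod = ((z :: L).map g).prod := by simp

/-- Letters commute up to nonzero scalars and terms of lower weight. -/
def AlmostComm (K : Type*) [Field K] [Algebra K A] (g : Z → A) (w : Z → ℕ) : Prop :=
  ∀ z z', ∃ ε : K, ε ≠ 0 ∧ g z * g z' - ε • (g z' * g z) ∈ filt K g w ((w z : ℤ) + w z' - 1)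

/-- Every transposition contributes a nonzero scalar and an error of weight at least one less, which
stays low when it is multiplied by the remaining letters. -/
lemma AlmostComm.perm (hc : AlmostComm K g w) {L L' : List Z} (h : L.Perm L') :
    ∃ ε : K, ε ≠ 0 ∧ (L.map g).prod - ε • (L'.map g).prod ∈
      filt K g w ((wt w (L : Multiset Z) : ℤ) - 1) := by
  induction h with
  | nil => exact ⟨1, one_ne_zero, by simp⟩
  | @cons z L L' _ ih =>
    obtain ⟨ε, h0, h1⟩ := ih
    refine ⟨ε, h0, ?_⟩
    have := mul_mem_filt (gen_mem_filt (K := K) (g := g) (w := w) (z := z) le_rfl) h1 (k :=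
      (wt w ((z :: L : List Z) : Multiset Z) : ℤ) - 1) (by rw [wt_coe_cons]; push_cast; omega)
    simpa [mul_sub] using this
  | swap z z' L =>
    obtain ⟨ε, h0, h1⟩ := hc z' z
    refine ⟨ε, h0, ?_⟩
    have := mul_mem_filt h1 (prod_mem_filt (K := K) (g := g) (w := w) (L := L) le_rfl) (k :=
      (wt w ((z' :: z :: L : List Z) : Multiset Z) : ℤ) - 1)
      (by rw [wt_coe_cons, wt_coe_cons]; push_cast; omega)
    simpa [sub_mul, mul_assoc] using this
  | @trans L1 L2 L3 h12 h23 ih1 ih2 =>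
    obtain ⟨ε, h0, h1⟩ := ih1
    obtain ⟨η, k0, k1⟩ := ih2
    refine ⟨ε * η, mul_ne_zero h0 k0, ?_⟩
    rw [← Multiset.coe_eq_coe.2 h12] at k1
    have := Submodule.add_mem _ h1 (Submodule.smul_mem _ ε k1)
    rw [smul_sub, smul_smul] at this
    simpa using this

/-- A choice of an ordering of every multiset of letters. -/
structure Ordering (Z : Type*) where
  toList : Multiset Z → List Z
  coe_toList : ∀ m, (toList m : Multiset Z) = m

/-- The ordered monomial of a multiset. -/
def word (o : Ordering Z) (g : Z → A) (m : Multiset Z) : A := ((o.toList m).map g).prod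

/-- The multisets in which odd letters occur at most once. -/
def Adm (odd : Z → Prop) (m : Multiset Z) : Prop :=
  ∀ z, odd z → ¬ Multiset.replicate 2 z ≤ m

variable {o : Ordering Z} {odd : Z → Prop}

lemma word_mem_filt {m : Multiset Z} {n : ℤ} (h : (wt w m : ℤ) ≤ n) :
    word o g m ∈ filt K g w n :=
  prod_mem_filt (by rwa [o.coe_toList])

lemma word_zero : word o g 0 = 1 := by
  have := o.coe_toList 0
  rw [Multiset.coe_eq_zero] at this
  simp [word, this]

lemma AlmostComm.word (hc : AlmostComm K g w) {m : Multiset Z} {L : List Z}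
    (h : (L : Multiset Z) = m) :
    ∃ ε : K, ε ≠ 0 ∧ (L.map g).prod - ε • word o g m ∈ filt K g w ((wt w m : ℤ) - 1) := by
  have h1 : L.Perm (o.toList m) := by rw [← Multiset.coe_eq_coe, o.coe_toList, h]
  obtain ⟨ε, h0, h2⟩ := hc.perm h1
  rw [h] at h2
  exact ⟨ε, h0, h2⟩

lemma AlmostComm.word_left (hc : AlmostComm K g w) {m : Multiset Z} {L : List Z}
    (h : (L : Multiset Z) = m) :
    ∃ ε : K, ε ≠ 0 ∧ FiniteW.word o g m - ε • (L.map g).prod ∈ filt K g w ((wt w m : ℤ) - 1) := by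
  have h1 : (o.toList m).Perm L := by rw [← Multiset.coe_eq_coe, o.coe_toList, h]
  obtain ⟨ε, h0, h2⟩ := hc.perm h1
  rw [o.coe_toList] at h2
  exact ⟨ε, h0, h2⟩

/-- Sorting changes a product only by a nonzero scalar and lower terms. If an odd letter is
repeated, two copies can be made adjacent, and then the whole product is of lower weight. -/
lemma filt_le_span_word (hc : AlmostComm K g w)
    (hodd : ∀ z, odd z → g z * g z ∈ filt K g w (2 * (w z : ℤ) - 1)) (n : ℤ) :
    filt K g w n ≤ Submodule.span K (FiniteW.word o g '' {m | Adm odd m ∧ (wt w m : ℤ) ≤ n}) := by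
  classical
  -- Induction on a natural number above the integer bound `k`; for negative `k` the filtration step
  -- is zero.
  have key : ∀ n : ℕ, ∀ k : ℤ, k < n →
      filt K g w k ≤ Submodule.span K (FiniteW.word o g '' {m | Adm odd m ∧ (wt w m : ℤ) ≤ k}) := by
    intro n
    induction n with
    | zero =>
      intro k hk
      rw [filt_neg (by exact_mod_cast hk)]
      exact bot_le
    | succ n ih =>
      intro k hk
      refine Submodule.span_le.2 ?_
      rintro _ ⟨L, hL, rfl⟩
      have hlow : filt K g w ((wt w (L : Multiset Z) : ℤ) - 1) ≤
          Submodule.span K (FiniteW.word o g '' {m | Adm odd m ∧ (wt w m : ℤ) ≤ k}) := by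
        refine (ih _ (by push_cast at hk; omega)).trans (Submodule.span_mono (Set.image_mono ?_))
        rintro m ⟨h1, h2⟩
        exact ⟨h1, by omega⟩
      by_cases hadm : Adm odd (L : Multiset Z)
      · obtain ⟨ε, -, h1⟩ := hc.word (o := o) (L := L) rfl
        have h2 : FiniteW.word o g (L : Multiset Z) ∈
            Submodule.span K (FiniteW.word o g '' {m | Adm odd m ∧ (wt w m : ℤ) ≤ k}) :=
          Submodule.subset_span ⟨_, ⟨hadm, hL⟩, rfl⟩
        have := Submodule.add_mem _ (hlow h1) (Submodule.smul_mem _ ε h2)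
        simpa using this
      · simp only [Adm, not_forall, not_not] at hadm
        obtain ⟨z, hz, h3⟩ := hadm
        obtain ⟨m, hm⟩ := Multiset.le_iff_exists_add.1 h3
        have h4 : L.Perm (z :: z :: m.toList) := by
          rw [← Multiset.coe_eq_coe, hm, ← Multiset.cons_coe, ← Multiset.cons_coe,
            Multiset.coe_toList]
          simp [Multiset.replicate_succ]
        obtain ⟨ε, -, h5⟩ := hc.perm h4
        have h6 := mul_mem_filt (hodd z hz)
          (prod_mem_filt (K := K) (g := g) (w := w) (L := m.toList) le_rfl) (k :=
            (wt w (L : Multiset Z) : ℤ) - 1) (by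
              rw [Multiset.coe_eq_coe.2 h4, wt_coe_cons, wt_coe_cons]; push_cast; omega)
        have h7 := Submodule.add_mem _ h5 (Submodule.smul_mem _ ε h6)
        have h8 : (L.map g).prod ∈ filt K g w ((wt w (L : Multiset Z) : ℤ) - 1) := by
          simpa [mul_assoc] using h7
        exact hlow h8
  exact key (n + 1).toNat n (by omega)

/-- The leading term of an operator that acts as a derivation up to lower terms and replaces the
letter `z` by `y`. -/
structure IsLowering (K : Type*) [Field K] [Algebra K A] (g : Z → A) (w : Z → ℕ) (odd : Z → Prop)
    (ok : Z → Prop) (E : A →ₗ[K] A) (s : ℤ) (z : Z) (y : A) : Prop where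
  one : E 1 ∈ filt K g w (s - 1)
  mem : y ∈ filt K g w (w z + s)
  comm : ¬ odd z → y * g z - g z * y ∈ filt K g w (2 * w z + s - 1)
  -- The scalar `ε` is the sign of a graded derivation. It must be `1` for a repeated letter that is
  -- not odd, so that `k` equal factors give `k` equal leading terms and no cancellation; `comm`
  -- lets `y` be moved in front of them.
  step : ∀ z', ok z' → ∃ ε : K, (z' = z → ¬ odd z → ε = 1) ∧ ∀ L : List Z, (∀ v ∈ L, ok v) →
    E (g z' * (L.map g).prod) - (open Classical in if z' = z then y * (L.map g).prod else 0) -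
      ε • (g z' * E ((L.map g).prod)) ∈ filt K g w ((wt w (L : Multiset Z) : ℤ) + w z' + s - 1)

variable {ok : Z → Prop} {E : A →ₗ[K] A} {s : ℤ} {z : Z} {y : A}

lemma IsLowering.not_mem (h : IsLowering K g w odd ok E s z y) (L : List Z) (hL : ∀ v ∈ L, ok v)
    (hz : z ∉ L) : E ((L.map g).prod) ∈ filt K g w ((wt w (L : Multiset Z) : ℤ) + s - 1) := by
  induction L with
  | nil => simpa [wt] using h.one
  | cons v L ih =>
    simp only [List.mem_cons, not_or] at hz
    have h1 := ih (fun v hv => hL v (by simp [hv])) hz.2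
    obtain ⟨ε, -, h2⟩ := h.step v (hL v (by simp))
    have h3 := h2 L (fun v hv => hL v (by simp [hv]))
    rw [if_neg (Ne.symm hz.1), sub_zero] at h3
    have h4 := mul_mem_filt (gen_mem_filt (K := K) (g := g) (w := w) (z := v) le_rfl) h1
      (k := (wt w (L : Multiset Z) : ℤ) + w v + s - 1) (by omega)
    have h5 := Submodule.add_mem _ h3 (Submodule.smul_mem _ ε h4)
    rw [sub_add_cancel, mul_gen_prod] at h5
    refine filt_mono (le_of_eq ?_) h5
    rw [wt_coe_cons]; push_cast; ring

/-- The Leibniz rule for `z^k`. An odd letter occurs at most once, so its sign never matters. For `k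
= 0` the truncated `k - 1` is harmless because the coefficient vanishes. -/
lemma IsLowering.replicate (h : IsLowering K g w odd ok E s z y) (hok : ok z)
    (L : List Z) (hL : ∀ v ∈ L, ok v) (hz : z ∉ L) (k : ℕ) (hk : odd z → k ≤ 1) :
    E (((List.replicate k z ++ L).map g).prod) -
        (k : K) • (y * ((List.replicate (k - 1) z ++ L).map g).prod) ∈
      filt K g w ((wt w ((List.replicate k z ++ L : List Z) : Multiset Z) : ℤ) + s - 1) := by
  induction k with
  | zero => simpa using h.not_mem L hL hz
  | succ k ih =>
    have h1 := ih fun h => by have := hk h; omega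
    obtain ⟨ε, hε, h2⟩ := h.step z hok
    have h3 := h2 (List.replicate k z ++ L) (by
      intro v hv
      rcases List.mem_append.1 hv with hv | hv
      · rw [List.eq_of_mem_replicate hv]; exact hok
      · exact hL v hv)
    rw [if_pos rfl] at h3
    have h4 := mul_mem_filt (gen_mem_filt (K := K) (g := g) (w := w) (z := z) le_rfl) h1
      (k := (wt w ((List.replicate k z ++ L : List Z) : Multiset Z) : ℤ) + w z + s - 1) (by omega)
    have h5 := Submodule.add_mem _ h3 (Submodule.smul_mem _ ε h4)
    have hw : (wt w ((List.replicate (k + 1) z ++ L : List Z) : Multiset Z) : ℤ) =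
        (wt w ((List.replicate k z ++ L : List Z) : Multiset Z) : ℤ) + w z := by
      rw [wt_coe_append, wt_coe_append, wt_replicate, wt_replicate]; push_cast; ring
    rw [hw]
    rcases Nat.eq_zero_or_pos k with rfl | hk0
    · simpa [mul_sub, smul_sub] using h5
    · have hno : ¬ odd z := fun h => by have := hk h; omega
      obtain ⟨k, rfl⟩ : ∃ j, k = j + 1 := ⟨k - 1, by omega⟩
      rw [hε rfl hno, one_smul] at h5
      have h6 := mul_mem_filt (h.comm hno)
        (prod_mem_filt (K := K) (g := g) (w := w) (L := List.replicate k z ++ L) le_rfl)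
        (k := (wt w ((List.replicate (k + 1) z ++ L : List Z) : Multiset Z) : ℤ) + w z + s - 1) (by
          rw [wt_coe_append, wt_coe_append, wt_replicate, wt_replicate]; push_cast
          nlinarith)
      have h7 := Submodule.sub_mem _ h5 (Submodule.smul_mem _ ((k + 1 : ℕ) : K) h6)
      convert h7 using 1
      simp only [add_tsub_cancel_right, List.replicate_succ, List.cons_append, List.map_cons,
        List.prod_cons, mul_sub, mul_smul_comm, sub_mul, smul_sub, ← mul_assoc]
      push_cast
      simp only [add_smul, one_smul]
      abel

open Classical in
/-- The leading term of a lowering operator on an ordered monomial. -/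
lemma IsLowering.word (h : IsLowering K g w odd ok E s z y) (hok : ok z) (hc : AlmostComm K g w)
    (hE : ∀ n, ∀ X ∈ filt K g w n, E X ∈ filt K g w (n + s)) [CharZero K]
    {m : Multiset Z} (hm : ∀ v ∈ m, ok v) (hadm : Adm odd m) :
    ∃ (ε : K) (L : List Z), (z ∈ m → ε ≠ 0 ∧ (L : Multiset Z) = m.erase z) ∧ (z ∉ m → ε = 0) ∧
      E (word o g m) - ε • (y * (L.map g).prod) ∈ filt K g w ((wt w m : ℤ) + s - 1) := by
  -- All copies of `z` are brought to the front, at the cost of a nonzero scalar and lower terms.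
  obtain ⟨M, hM⟩ : ∃ M : List Z, (M : Multiset Z) = m.filter (· ≠ z) :=
    ⟨_, Multiset.coe_toList _⟩
  set k := Multiset.count z m with hk
  have hmk : ((List.replicate k z ++ M : List Z) : Multiset Z) = m := by
    rw [← Multiset.coe_add, hM, Multiset.coe_replicate, hk, ← Multiset.filter_eq']
    exact Multiset.filter_add_not _ _
  obtain ⟨ε, hε, h1⟩ := hc.word_left (o := o) hmk
  have hMz : z ∉ M := by
    rw [← Multiset.mem_coe, hM]
    simp
  have hMok : ∀ v ∈ M, ok v := by
    intro v hv
    rw [← Multiset.mem_coe, hM] at hv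
    exact hm v (Multiset.mem_of_mem_filter hv)
  have hk1 : odd z → k ≤ 1 := by
    intro hz
    have := hadm z hz
    rw [Multiset.le_count_iff_replicate_le.symm] at this
    omega
  have h2 := h.replicate hok M hMok hMz k hk1
  rw [hmk] at h2
  have h3 := hE _ _ h1
  refine ⟨ε * k, List.replicate (k - 1) z ++ M, fun hz => ⟨?_, ?_⟩, fun hz => ?_, ?_⟩
  · exact mul_ne_zero hε (Nat.cast_ne_zero.2 (Multiset.count_pos.2 hz).ne')
  · obtain ⟨j, hj⟩ : ∃ j, k = j + 1 := ⟨k - 1, by have := Multiset.count_pos.2 hz; omega⟩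
    rw [← hmk, hj, List.replicate_succ, List.cons_append, ← Multiset.cons_coe,
      Multiset.erase_cons_head, add_tsub_cancel_right]
  · rw [hk, Multiset.count_eq_zero_of_notMem hz]
    simp
  · have h4 := Submodule.add_mem _ h3 (Submodule.smul_mem _ ε (filt_mono (le_of_eq (by ring)) h2))
    convert h4 using 1
    · ring_nf
    · simp only [map_sub, map_smul, smul_sub, smul_smul]
      abel

lemma IsLowering.map_filt (h : IsLowering K g w odd ok E s z y) (hok : ∀ v, ok v) {n : ℤ} {X : A}
    (hX : X ∈ filt K g w n) : E X ∈ filt K g w (n + s) := by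
  have key : ∀ L : List Z, E ((L.map g).prod) ∈ filt K g w ((wt w (L : Multiset Z) : ℤ) + s) := by
    intro L
    induction L with
    | nil => exact filt_mono (n := s - 1) (by simp [wt]) (by simpa using h.one)
    | cons v L ih =>
      obtain ⟨ε, -, h2⟩ := h.step v (hok v)
      have h3 := h2 L (fun v _ => hok v)
      have h4 := mul_mem_filt (gen_mem_filt (K := K) (g := g) (w := w) (z := v) le_rfl) ih
        (k := (wt w (L : Multiset Z) : ℤ) + w v + s) (by omega)
      have h5 := Submodule.add_mem _ (filt_mono (by omega) h3) (Submodule.smul_mem _ ε h4)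
      rw [sub_add_cancel] at h5
      have h6 : (open Classical in if v = z then y * (L.map g).prod else 0) ∈
          filt K g w ((wt w (L : Multiset Z) : ℤ) + w v + s) := by
        split_ifs with hv
        · subst hv
          exact mul_mem_filt h.mem (prod_mem_filt le_rfl) (by omega)
        · exact Submodule.zero_mem _
      have h7 := Submodule.add_mem _ h5 h6
      rw [sub_add_cancel, mul_gen_prod] at h7
      refine filt_mono (le_of_eq ?_) h7
      rw [wt_coe_cons]; push_cast; ring
  induction hX using Submodule.span_induction with
  | mem X hX =>
    obtain ⟨L, hL, rfl⟩ := hX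
    exact filt_mono (by omega) (key L)
  | zero => simp
  | add X Y _ _ h1 h2 => rw [map_add]; exact Submodule.add_mem _ h1 h2
  | smul r X _ h1 => rw [map_smul]; exact Submodule.smul_mem _ _ h1

/-- Independence of leading terms. Up to lower weight, `T z` deletes one `z` from the monomials that
contain it and kills the others. Deleting `z` is injective on multisets containing `z`, so a
relation of weight `n` becomes one of smaller weight. In weight `0` the only monomial is `1`, and
the filtration step `-1` is zero. -/
lemma sum_word_eq_zero_of_mem_filt [CharZero K] [Nontrivial A] (hc : AlmostComm K g w)
    (hw : ∀ z, 0 < w z) (T : Z → A →ₗ[K] A)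
    (hT : ∀ z, IsLowering K g w odd (fun _ => True) (T z) (-(w z : ℤ)) z 1) (n : ℕ) :
    ∀ (t : Finset (Multiset Z)) (a : Multiset Z → K), (∀ m ∈ t, Adm odd m ∧ wt w m = n) →
      ∑ m ∈ t, a m • word o g m ∈ filt K g w ((n : ℤ) - 1) → ∀ m ∈ t, a m = 0 := by
  classical
  induction n using Nat.strong_induction_on with
  | _ n ih =>
    intro t a ht hsum m0 hm0
    by_cases hz : m0 = 0
    · subst hz
      obtain rfl : n = 0 := (ht _ hm0).2.symm
      have h1 : ∀ m ∈ t, m = 0 := by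
        intro m hm
        refine Multiset.eq_zero_of_forall_notMem fun z hz => ?_
        obtain ⟨m', rfl⟩ := Multiset.exists_cons_of_mem hz
        have h2 := (ht _ hm).2
        rw [wt_cons] at h2
        have := hw z
        omega
      have h2 : t = {0} := Finset.eq_singleton_iff_unique_mem.2 ⟨hm0, h1⟩
      rw [h2, Finset.sum_singleton, word_zero, filt_neg (by simp), Submodule.mem_bot] at hsum
      exact (smul_eq_zero.1 hsum).resolve_right one_ne_zero
    · obtain ⟨z, hz⟩ := Multiset.exists_mem_of_ne_zero hz
      have hwz : w z ≤ n := by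
        obtain ⟨m', rfl⟩ := Multiset.exists_cons_of_mem hz
        have h2 := (ht _ hm0).2
        rw [wt_cons] at h2
        omega
      have h1 := (hT z).map_filt (fun _ => trivial) hsum
      have h2 : ∀ m ∈ t, ∃ ε : K, (z ∈ m → ε ≠ 0) ∧
          T z (word o g m) - (if z ∈ m then ε • word o g (m.erase z) else 0) ∈
            filt K g w ((n : ℤ) - w z - 1) := by
        intro m hm
        obtain ⟨ε, L, h3, h4, h5⟩ := (hT z).word (o := o) trivial hc
          (fun n X hX => (hT z).map_filt (fun _ => trivial) hX) (m := m) (fun _ _ => trivial)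
          (ht m hm).1
        rw [(ht m hm).2] at h5
        by_cases hzm : z ∈ m
        · obtain ⟨η, h6, h7⟩ := hc.word (o := o) (h3 hzm).2
          refine ⟨ε * η, fun _ => mul_ne_zero (h3 hzm).1 h6, ?_⟩
          have h8 : (wt w m : ℤ) = w z + wt w (m.erase z) := by
            conv_lhs => rw [← Multiset.cons_erase hzm, wt_cons]
            push_cast; rfl
          rw [(ht m hm).2] at h8
          have h9 := Submodule.add_mem _ h5 (Submodule.smul_mem _ ε
            (filt_mono (m := (n : ℤ) + -(w z : ℤ) - 1) (by omega) h7))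
          rw [if_pos hzm]
          rw [sub_eq_add_neg (n : ℤ)]
          convert h9 using 1
          rw [one_mul, smul_sub, smul_smul]
          abel
        · refine ⟨0, fun h => absurd h hzm, ?_⟩
          rw [if_neg hzm, sub_zero]
          rw [h4 hzm, zero_smul, sub_zero] at h5
          exact h5
      choose! ε hε h3 using h2
      have h4 : ∑ m ∈ t.filter (z ∈ ·), (a m * ε m) • word o g (m.erase z) ∈
          filt K g w ((n : ℤ) - w z - 1) := by
        have h5 := Submodule.sum_mem _ fun m hm => Submodule.smul_mem _ (a m) (h3 m hm)
        have h6 := Submodule.sub_mem _ (filt_mono (by omega) h1) h5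
        convert h6 using 1
        rw [map_sum, ← Finset.sum_sub_distrib, Finset.sum_filter]
        refine Finset.sum_congr rfl fun m _ => ?_
        rw [map_smul, smul_sub, sub_sub_cancel]
        split_ifs <;> simp [smul_smul]
      have hinj : Set.InjOn (fun m : Multiset Z => m.erase z) (t.filter (z ∈ ·)) := by
        intro m hm m' hm' h
        simp only [Finset.coe_filter, Set.mem_ofPred_eq] at hm hm'
        rw [← Multiset.cons_erase hm.2, ← Multiset.cons_erase hm'.2]
        exact congrArg _ h
      have h5 := ih (n - w z) (by have := hw z; omega) ((t.filter (z ∈ ·)).image fun m => m.erase z)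
        (fun m => a (z ::ₘ m) * ε (z ::ₘ m)) (by
          intro m hm
          obtain ⟨m', hm', rfl⟩ := Finset.mem_image.1 hm
          rw [Finset.mem_filter] at hm'
          refine ⟨fun v hv h => (ht _ hm'.1).1 v hv (h.trans (Multiset.erase_le _ _)), ?_⟩
          have h6 := (ht _ hm'.1).2
          rw [← Multiset.cons_erase hm'.2, wt_cons] at h6
          omega) (by
          rw [Finset.sum_image hinj]
          refine filt_mono (le_of_eq ?_) (Eq.subst (motive := (· ∈ _)) ?_ h4)
          · push_cast [Nat.cast_sub hwz]; ring
          · refine Finset.sum_congr rfl fun m hm => ?_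
            rw [Multiset.cons_erase (Finset.mem_filter.1 hm).2])
        (m0.erase z) (Finset.mem_image_of_mem _ (Finset.mem_filter.2 ⟨hm0, hz⟩))
      rw [Multiset.cons_erase hz] at h5
      exact (mul_eq_zero.1 h5).resolve_right (hε m0 hm0 hz)

lemma linearIndependent_word [CharZero K] [Nontrivial A] (hc : AlmostComm K g w)
    (hw : ∀ z, 0 < w z) (T : Z → A →ₗ[K] A)
    (hT : ∀ z, IsLowering K g w odd (fun _ => True) (T z) (-(w z : ℤ)) z 1) :
    LinearIndependent K fun m : {m : Multiset Z // Adm odd m} => word o g m.1 := by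
  classical
  have key : ∀ (n : ℕ) (t : Finset (Multiset Z)) (a : Multiset Z → K),
      (∀ m ∈ t, Adm odd m ∧ wt w m < n) → ∑ m ∈ t, a m • word o g m = 0 → ∀ m ∈ t, a m = 0 := by
    intro n
    induction n with
    | zero =>
      intro t a ht _ m hm
      exact absurd (ht m hm).2 (Nat.not_lt_zero _)
    | succ n ih =>
      intro t a ht hsum
      have h1 := Finset.sum_filter_add_sum_filter_not t (fun m => wt w m = n)
        (fun m => a m • word o g m)
      rw [hsum] at h1
      have h2 : ∑ m ∈ t.filter (fun m => ¬ wt w m = n), a m • word o g m ∈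
          filt K g w ((n : ℤ) - 1) := by
        refine Submodule.sum_mem _ fun m hm => Submodule.smul_mem _ _ (word_mem_filt ?_)
        rw [Finset.mem_filter] at hm
        have := (ht m hm.1).2
        omega
      have h3 := sum_word_eq_zero_of_mem_filt (o := o) hc hw T hT n (t.filter fun m => wt w m = n) a
        (fun m hm => by
          rw [Finset.mem_filter] at hm
          exact ⟨(ht m hm.1).1, hm.2⟩)
        (by rw [eq_neg_of_add_eq_zero_left h1]; exact Submodule.neg_mem _ h2)
      rw [Finset.sum_eq_zero (fun m hm => by rw [h3 m hm, zero_smul]), zero_add] at h1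
      have h4 := ih (t.filter fun m => ¬ wt w m = n) a (fun m hm => by
        rw [Finset.mem_filter] at hm
        have := ht m hm.1
        exact ⟨this.1, by omega⟩) h1
      intro m hm
      by_cases h : wt w m = n
      · exact h3 m (Finset.mem_filter.2 ⟨hm, h⟩)
      · exact h4 m (Finset.mem_filter.2 ⟨hm, h⟩)
  rw [linearIndependent_iff']
  intro t a hsum m hm
  have h := key ((t.sup fun m => wt w m.1) + 1) (t.map ⟨Subtype.val, Subtype.val_injective⟩)
    (fun m => if h : Adm odd m then a ⟨m, h⟩ else 0) (by
      intro m hm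
      obtain ⟨m', hm', rfl⟩ := Finset.mem_map.1 hm
      exact ⟨m'.2, Nat.lt_succ_of_le (Finset.le_sup (f := fun m => wt w m.1) hm')⟩) (by
      rw [Finset.sum_map]
      rw [← hsum]
      exact Finset.sum_congr rfl fun m _ => by simp [m.2]) m.1 (Finset.mem_map_of_mem _ hm)
  simpa [m.2] using h

end words

/-! The splitting `g = g_- ⊕ g_{≥ 0}`. -/

section splitting

variable {μ : YoungDiagram}

lemma upCoeff_add (x y : G μ) (γ : Pos μ) : upCoeff (x + y) γ = upCoeff x γ + upCoeff y γ := rfl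

lemma upCoeff_smul (r : ℂ) (x : G μ) (γ : Pos μ) : upCoeff (r • x) γ = r * upCoeff x γ := rfl

/-- `upCoeff` as a linear functional. -/
def upFun (γ : Pos μ) : G μ →ₗ[ℂ] ℂ where
  toFun x := upCoeff x γ
  map_add' x y := upCoeff_add x y γ
  map_smul' r x := upCoeff_smul r x γ

@[simp] lemma upFun_apply (γ : Pos μ) (x : G μ) : upFun γ x = upCoeff x γ := rfl

/-- The projection onto `g_-`. -/
def prM : G μ →ₗ[ℂ] G μ := ∑ γ : Pos μ, (upFun γ).smulRight (tUp γ)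

lemma prM_apply (x : G μ) : prM x = ∑ γ : Pos μ, upCoeff x γ • tUp γ := by simp [prM]

lemma tUp_apply (γ : Pos μ) (a e : Box μ) :
    (tUp γ).1 a e = if γ.1.2 = a ∧ γ.1.1 = e then 1 else 0 := by
  change Matrix.single γ.1.2 γ.1.1 (1 : ℂ) a e = _
  rw [Matrix.single_apply]

lemma tLow_apply (γ : Pos μ) (a e : Box μ) :
    (tLow γ).1 a e = if γ.1.1 = a ∧ γ.1.2 = e then 1 else 0 := by
  change Matrix.single γ.1.1 γ.1.2 (1 : ℂ) a e = _
  rw [Matrix.single_apply]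

lemma upCoeff_tUp (α γ : Pos μ) : upCoeff (tUp α) γ = if α = γ then 1 else 0 := by
  rw [upCoeff, tUp_apply]
  refine if_congr ?_ rfl rfl
  refine ⟨fun h => Subtype.ext (Prod.ext h.2 h.1), ?_⟩
  rintro rfl
  exact ⟨rfl, rfl⟩

lemma prM_entry (x : G μ) (a e : Box μ) :
    (prM x).1 a e = if e.col < a.col then x.1 a e else 0 := by
  rw [prM_apply, AddSubmonoidClass.coe_finsetSum, Matrix.sum_apply]
  have h (γ : Pos μ) : (upCoeff x γ • tUp γ).1 a e =
      if γ.1.2 = a ∧ γ.1.1 = e then x.1 a e else 0 := by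
    change upCoeff x γ * (tUp γ).1 a e = _
    rw [tUp_apply]
    split_ifs with h
    · rw [← h.1, ← h.2, mul_one]; rfl
    · rw [mul_zero]
  rw [Finset.sum_congr rfl fun γ _ => h γ]
  split_ifs with hc
  · rw [Finset.sum_eq_single (⟨(e, a), hc⟩ : Pos μ)]
    · simp
    · intro γ _ hγ
      rw [if_neg]
      rintro ⟨h1, h2⟩
      exact hγ (Subtype.ext (Prod.ext h2 h1))
    · simp
  · refine Finset.sum_eq_zero fun γ _ => if_neg ?_
    rintro ⟨rfl, rfl⟩
    exact hc γ.2

lemma prM_eq_self {x : G μ} (h : ∀ a e : Box μ, a.col ≤ e.col → x.1 a e = 0) : prM x = x := by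
  refine Subtype.ext (Matrix.ext fun a e => ?_)
  rw [prM_entry]
  split_ifs with hc
  · rfl
  · exact (h a e (not_lt.1 hc)).symm

lemma lie_entry (x y : G μ) (a e : Box μ) :
    (⁅x, y⁆ : G μ).1 a e = ∑ f, x.1 a f * y.1 f e - ∑ f, y.1 a f * x.1 f e := by
  rw [LieAlgebra.SpecialLinear.sl_bracket, Matrix.sub_apply, Matrix.mul_apply, Matrix.mul_apply]

/-- Brackets of elements of `g_-` have degree at most `-2`. -/
lemma lie_tUp_entry (α β : Pos μ) (a e : Box μ) (h : a.col ≤ e.col + 1) :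
    (⁅tUp α, tUp β⁆ : G μ).1 a e = 0 := by
  have key (α β : Pos μ) (f : Box μ) : (tUp α).1 a f * (tUp β).1 f e = 0 := by
    rw [tUp_apply, tUp_apply]
    split_ifs with h1 h2 <;> simp only [mul_zero, mul_one]
    obtain ⟨rfl, rfl⟩ := h1
    obtain ⟨h3, rfl⟩ := h2
    have := α.2
    have h4 := β.2
    rw [h3] at h4
    omega
  rw [lie_entry, Finset.sum_eq_zero fun f _ => key α β f, Finset.sum_eq_zero fun f _ => key β α f,
    sub_zero]

lemma prM_lie_tUp (α β : Pos μ) : prM ⁅tUp α, tUp β⁆ = (⁅tUp α, tUp β⁆ : G μ) :=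
  prM_eq_self fun a e h => lie_tUp_entry α β a e (by omega)

/-- The parabolic subalgebra `g_0 ⊕ g_+`. -/
def gNonneg (μ : YoungDiagram) : LieSubalgebra ℂ (G μ) where
  carrier := {x | ∀ a e : Box μ, e.col < a.col → x.1 a e = 0}
  add_mem' := by
    intro x y hx hy a e h
    change x.1 a e + y.1 a e = 0
    rw [hx a e h, hy a e h, add_zero]
  zero_mem' := by intro a e _; rfl
  smul_mem' := by
    intro r x hx a e h
    change r * x.1 a e = 0
    rw [hx a e h, mul_zero]
  lie_mem' := by
    intro x y hx hy a e h
    have key (x y : G μ) (hx : ∀ a e : Box μ, e.col < a.col → x.1 a e = 0)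
        (hy : ∀ a e : Box μ, e.col < a.col → y.1 a e = 0) (f : Box μ) : x.1 a f * y.1 f e = 0 := by
      by_cases hf : f.col < a.col
      · rw [hx a f hf, zero_mul]
      · rw [hy f e (by omega), mul_zero]
    rw [lie_entry, Finset.sum_eq_zero fun f _ => key x y hx hy f,
      Finset.sum_eq_zero fun f _ => key y x hy hx f, sub_zero]

lemma mem_gNonneg {x : G μ} :
    x ∈ gNonneg μ ↔ ∀ a e : Box μ, e.col < a.col → x.1 a e = 0 := Iff.rfl

lemma mem_gNonneg_iff_prM {x : G μ} : x ∈ gNonneg μ ↔ prM x = 0 := by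
  rw [mem_gNonneg]
  constructor
  · intro h
    refine Subtype.ext (Matrix.ext fun a e => ?_)
    rw [prM_entry]
    split_ifs with hc
    · rw [h a e hc]; rfl
    · rfl
  · intro h a e hc
    have := prM_entry x a e
    rw [h, if_pos hc] at this
    exact this.symm

lemma upCoeff_eq_zero {x : G μ} (hx : x ∈ gNonneg μ) (γ : Pos μ) : upCoeff x γ = 0 :=
  hx _ _ γ.2

lemma prM_prM (x : G μ) : prM (prM x) = prM x :=
  prM_eq_self fun a e h => by rw [prM_entry, if_neg (not_lt.2 h)]

/-- The projection onto `g_0 ⊕ g_+`. -/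
def prP : G μ →ₗ[ℂ] G μ := LinearMap.id - prM

lemma prP_apply (x : G μ) : prP x = x - prM x := rfl

lemma prP_mem (x : G μ) : prP x ∈ gNonneg μ := by
  rw [mem_gNonneg_iff_prM, prP_apply, map_sub, prM_prM, sub_self]

lemma grade_le_gNonneg {k : ℤ} (hk : 0 ≤ k) {x : G μ} (hx : x ∈ grade μ k) : x ∈ gNonneg μ := by
  rw [mem_grade_iff] at hx
  intro a e h
  exact hx a e (by omega)

lemma grade_zero_le {x : G μ} (hx : x ∈ gZero μ) : x ∈ gNonneg μ :=
  grade_le_gNonneg le_rfl hx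

lemma tLow_mem_grade (α : Pos μ) : tLow α ∈ grade μ α.deg := by
  rw [mem_grade_iff]
  intro a e h
  rw [tLow_apply, if_neg]
  rintro ⟨rfl, rfl⟩
  exact h rfl

lemma tLow_mem (α : Pos μ) : tLow α ∈ gNonneg μ :=
  grade_le_gNonneg (by have := α.2; simp only [Pos.deg]; omega) (tLow_mem_grade α)

end splitting

/-! The differentials on generators. -/

section differentials

variable {μ : YoungDiagram}

/-- The element `∑ Tr (y t_γ) b^γ`. -/
def bv : G μ →ₗ[ℂ] Om μ := ∑ γ : Pos μ, (upFun γ).smulRight (b γ)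

lemma bv_apply (y : G μ) : bv y = ∑ γ : Pos μ, upCoeff y γ • b γ := by simp [bv]

lemma bv_tUp (α : Pos μ) : bv (tUp α) = b α := by simp [bv_apply, upCoeff_tUp]

lemma bv_eq_zero {y : G μ} (hy : y ∈ gNonneg μ) : bv y = 0 := by
  simp [bv_apply, upCoeff_eq_zero hy]

lemma b_mul_c_add (α β : Pos μ) :
    b α * c β + c β * b α = (if α = β then (1 : ℂ) else 0) • (1 : Om μ) := by
  rw [b_mul_c, sub_add_cancel]

lemma bv_mul_c_add (y : G μ) (α : Pos μ) : bv y * c α + c α * bv y = upCoeff y α • (1 : Om μ) := by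
  simp only [bv_apply, Finset.sum_mul, Finset.mul_sum, ← Finset.sum_add_distrib, smul_mul_assoc,
    mul_smul_comm, ← smul_add, b_mul_c_add, smul_smul]
  simp

lemma c_mul_bv (y : G μ) (α : Pos μ) : c α * bv y = upCoeff y α • (1 : Om μ) - bv y * c α := by
  rw [eq_sub_iff_add_eq', bv_mul_c_add]

lemma bv_mul_b (y : G μ) (α : Pos μ) : bv y * b α = -(b α * bv y) := by
  simp only [bv_apply, Finset.sum_mul, Finset.mul_sum, smul_mul_assoc, mul_smul_comm,
    ← Finset.sum_neg_distrib, ← smul_neg]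
  exact Finset.sum_congr rfl fun γ _ => by rw [b_mul_b]

lemma bv_mul_bv (y z : G μ) : bv y * bv z = -(bv z * bv y) := by
  rw [bv_apply z, Finset.mul_sum, Finset.sum_mul, ← Finset.sum_neg_distrib]
  exact Finset.sum_congr rfl fun γ _ => by rw [mul_smul_comm, bv_mul_b, smul_mul_assoc, smul_neg]

lemma J_mul_c (x : G μ) (α : Pos μ) : J x * c α = c α * J x := J_mul_ghost _ _

lemma J_mul_b (x : G μ) (α : Pos μ) : J x * b α = b α * J x := J_mul_ghost _ _

lemma J_mul_bv (x y : G μ) : J x * bv y = bv y * J x := by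
  simp [bv_apply, Finset.sum_mul, Finset.mul_sum, J_mul_b]

/-- The quadratic ghost part of `Ĵ`. -/
def quad : G μ →ₗ[ℂ] Om μ :=
  ∑ β : Pos μ, LinearMap.mulRight ℂ (c β) ∘ₗ bv ∘ₗ
    (-(LieAlgebra.ad ℂ (G μ) (tUp β) : G μ →ₗ[ℂ] G μ))

lemma quad_apply (x : G μ) : quad x = ∑ β : Pos μ, bv ⁅x, tUp β⁆ * c β := by
  simp only [quad, LinearMap.sum_apply, LinearMap.comp_apply, LinearMap.neg_apply,
    LieAlgebra.ad_apply, lie_skew, LinearMap.mulRight_apply]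

lemma Jhat_eq (x : G μ) : Jhat x = J x + quad x := by
  rw [quad_apply]
  change J x + _ = _
  congr 1
  refine Finset.sum_congr rfl fun β _ => ?_
  simp [bv_apply, Finset.sum_mul]

lemma parity_c (α : Pos μ) : parity μ (c α) = -c α := parity_ghost _

lemma parity_b (α : Pos μ) : parity μ (b α) = -b α := parity_ghost _

lemma parity_bv (y : G μ) : parity μ (bv y) = -bv y := by
  simp [bv_apply, map_sum, parity_b]

lemma parity_quad (x : G μ) : parity μ (quad x) = quad x := by
  simp [quad_apply, map_sum, parity_bv, parity_c]

lemma parity_Jhat (x : G μ) : parity μ (Jhat x) = Jhat x := by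
  rw [Jhat_eq, map_add, parity_J, parity_quad]

lemma parity_parity (X : Om μ) : parity μ (parity μ X) = X := by
  have h : (parity μ).comp (parity μ) = AlgHom.id ℂ (Om μ) := by
    have : AlgHom.equalizer ((parity μ).comp (parity μ)) (AlgHom.id ℂ (Om μ)) = ⊤ := by
      refine subalgebra_eq_top _ fun X p h => ?_
      rw [AlgHom.mem_equalizer]
      cases h with
      | J k x hx => simp [parity_J]
      | c α => simp [parity_c]
      | b α => simp [parity_b]
    exact AlgHom.ext fun X => by
      have h1 : X ∈ AlgHom.equalizer ((parity μ).comp (parity μ)) (AlgHom.id ℂ (Om μ)) :=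
        this ▸ Algebra.mem_top
      exact h1
  exact congrArg (fun f => f X) h

lemma gradedComm_apply (q X : Om μ) : gradedComm q X = q * X - parity μ X * q := rfl

lemma gradedComm_mul (q X Y : Om μ) :
    gradedComm q (X * Y) = gradedComm q X * Y + parity μ X * gradedComm q Y := by
  simp only [gradedComm_apply, map_mul]
  noncomm_ring

lemma gradedComm_one (q : Om μ) : gradedComm q 1 = 0 := by simp [gradedComm_apply]

lemma parity_gradedComm {q : Om μ} (hq : parity μ q = -q) (X : Om μ) :
    parity μ (gradedComm q X) = -gradedComm q (parity μ X) := by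
  simp only [gradedComm_apply, map_sub, map_mul, hq]
  noncomm_ring

lemma d_eq (X : Om μ) : d μ X = d0 μ X + d1 μ X := by
  simp only [d, d0, d1, gradedComm_apply]
  noncomm_ring

lemma d0_mul (X Y : Om μ) : d0 μ (X * Y) = d0 μ X * Y + parity μ X * d0 μ Y :=
  gradedComm_mul _ _ _

lemma d1_mul (X Y : Om μ) : d1 μ (X * Y) = d1 μ X * Y + parity μ X * d1 μ Y :=
  gradedComm_mul _ _ _

lemma Q0_eq : Q0 μ = ∑ α : Pos μ, J (tUp α) * c α -
    (1 / 2 : ℂ) • ∑ α : Pos μ, ∑ β : Pos μ, bv ⁅tUp α, tUp β⁆ * (c α * c β) := by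
  rw [Q0]
  congr 2
  refine Finset.sum_congr rfl fun α _ => Finset.sum_congr rfl fun β _ => ?_
  simp [bv_apply, Finset.sum_mul, mul_assoc]

lemma parity_Q0 : parity μ (Q0 μ) = -Q0 μ := by
  simp only [Q0_eq, map_sub, map_smul, map_sum, map_mul, parity_J, parity_c, parity_bv, mul_neg,
    neg_mul, Finset.sum_neg_distrib, neg_neg, smul_neg]
  abel

lemma parity_Q1 : parity μ (Q1 μ) = -Q1 μ := by
  simp [Q1, map_sum, parity_c]

lemma parity_d (X : Om μ) : parity μ (d μ X) = -d μ (parity μ X) :=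
  parity_gradedComm (by rw [map_add, parity_Q0, parity_Q1, neg_add]) X

lemma d0_J (x : G μ) : d0 μ (J x) = ∑ α : Pos μ, J ⁅tUp α, x⁆ * c α := by
  rw [d0, gradedComm_apply, parity_J, Q0_eq]
  have h1 : (∑ α : Pos μ, J (tUp α) * c α) * J x - J x * ∑ α : Pos μ, J (tUp α) * c α =
      ∑ α : Pos μ, J ⁅tUp α, x⁆ * c α := by
    rw [Finset.sum_mul, Finset.mul_sum, ← Finset.sum_sub_distrib]
    refine Finset.sum_congr rfl fun α _ => ?_
    rw [J_lie, sub_mul, mul_assoc, ← J_mul_c, mul_assoc, mul_assoc]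
  have h2 (α β : Pos μ) (y : G μ) :
      bv y * (c α * c β) * J x = J x * (bv y * (c α * c β)) := by
    rw [mul_assoc, mul_assoc, ← J_mul_c, ← mul_assoc (c α), ← J_mul_c, mul_assoc, ← mul_assoc (bv y),
      ← J_mul_bv, mul_assoc]
  rw [← h1]
  simp only [sub_mul, mul_sub, smul_mul_assoc, mul_smul_comm, Finset.sum_mul, Finset.mul_sum, h2]
  abel

lemma d0_c (α : Pos μ) : d0 μ (c α) =
    -((1 / 2 : ℂ) • ∑ β : Pos μ, ∑ γ : Pos μ, upCoeff ⁅tUp β, tUp γ⁆ α • (c β * c γ)) := by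
  rw [d0, gradedComm_apply, parity_c, Q0_eq, neg_mul, sub_neg_eq_add]
  have h1 : (∑ β : Pos μ, J (tUp β) * c β) * c α + c α * ∑ β : Pos μ, J (tUp β) * c β = 0 := by
    rw [Finset.sum_mul, Finset.mul_sum, ← Finset.sum_add_distrib]
    refine Finset.sum_eq_zero fun β _ => ?_
    rw [mul_assoc, ← mul_assoc (c α), ← J_mul_c, mul_assoc, c_mul_c α β, mul_neg, add_neg_cancel]
  have h2 (β γ : Pos μ) (y : G μ) :
      bv y * (c β * c γ) * c α + c α * (bv y * (c β * c γ)) = upCoeff y α • (c β * c γ) := by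
    rw [← mul_assoc (c α), c_mul_bv, sub_mul, smul_mul_assoc, one_mul, mul_assoc (bv y) (c α),
      ← mul_assoc (c α), c_mul_c α β, neg_mul, mul_assoc (c β), c_mul_c α γ]
    noncomm_ring
  have h3 : (∑ β : Pos μ, ∑ γ : Pos μ, bv ⁅tUp β, tUp γ⁆ * (c β * c γ)) * c α +
      c α * (∑ β : Pos μ, ∑ γ : Pos μ, bv ⁅tUp β, tUp γ⁆ * (c β * c γ)) =
      ∑ β : Pos μ, ∑ γ : Pos μ, upCoeff ⁅tUp β, tUp γ⁆ α • (c β * c γ) := by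
    simp only [Finset.sum_mul, Finset.mul_sum, ← Finset.sum_add_distrib, h2]
  rw [← h3, sub_mul, mul_sub, smul_mul_assoc, mul_smul_comm, smul_add]
  rw [sub_add_sub_comm, h1, zero_sub]

/-- The anticommutator of `b^α` with `J^β c_β` leaves `J^α`. In the cubic term `b^α` can hit either
ghost; as the structure constants are antisymmetric, both contributions agree, which cancels the
factor `1/2` and produces the ghost part of `Ĵ`. -/
lemma d0_b (α : Pos μ) : d0 μ (b α) = Jhat (tUp α) := by
  rw [d0, gradedComm_apply, parity_b, Q0_eq, neg_mul, sub_neg_eq_add, Jhat_eq]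
  have h1 : (∑ β : Pos μ, J (tUp β) * c β) * b α + b α * ∑ β : Pos μ, J (tUp β) * c β =
      J (tUp α) := by
    rw [Finset.sum_mul, Finset.mul_sum, ← Finset.sum_add_distrib]
    have (β : Pos μ) : J (tUp β) * c β * b α + b α * (J (tUp β) * c β) =
        if α = β then J (tUp β) else 0 := by
      rw [mul_assoc, ← mul_assoc (b α), ← J_mul_b, mul_assoc, ← mul_add, add_comm, b_mul_c_add]
      split_ifs <;> simp
    simp [this]
  have h2 (β γ : Pos μ) (y : G μ) :
      bv y * (c β * c γ) * b α + b α * (bv y * (c β * c γ)) =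
        (if α = γ then bv y * c β else 0) - (if α = β then bv y * c γ else 0) := by
    have e (β : Pos μ) : c β * b α = (if α = β then (1 : ℂ) else 0) • 1 - b α * c β := by
      rw [← b_mul_c_add]; abel
    rw [← mul_assoc (b α), ← neg_neg (b α * bv y), ← bv_mul_b, neg_mul, mul_assoc, mul_assoc,
      mul_assoc, e γ, mul_sub, ← mul_assoc (c β) (b α), e β]
    split_ifs <;> simp only [one_smul, zero_smul] <;> noncomm_ring
  have h3 : (∑ β : Pos μ, ∑ γ : Pos μ, bv ⁅tUp β, tUp γ⁆ * (c β * c γ)) * b α +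
      b α * (∑ β : Pos μ, ∑ γ : Pos μ, bv ⁅tUp β, tUp γ⁆ * (c β * c γ)) =
      -((2 : ℂ) • quad (tUp α)) := by
    simp only [Finset.sum_mul, Finset.mul_sum, ← Finset.sum_add_distrib, h2,
      Finset.sum_sub_distrib, Finset.sum_ite_eq, Finset.mem_univ, if_true]
    rw [Finset.sum_comm (γ := Pos μ) (f := fun β γ => if α = β then bv ⁅tUp β, tUp γ⁆ * c γ else 0)]
    simp only [Finset.sum_ite_eq, Finset.mem_univ, if_true]
    have (β : Pos μ) : bv ⁅tUp β, tUp α⁆ * c β = -(bv ⁅tUp α, tUp β⁆ * c β) := by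
      rw [← lie_skew, map_neg, neg_mul]
    simp only [this, Finset.sum_neg_distrib, ← quad_apply, two_smul]
    abel
  have h4 : (1 / 2 : ℂ) • -((2 : ℂ) • quad (tUp α)) = -quad (tUp α) := by
    rw [smul_neg, smul_smul]; norm_num
  rw [← h1, ← neg_neg (quad (tUp α)), ← h4, ← h3, sub_mul, mul_sub, smul_mul_assoc, mul_smul_comm,
    smul_add]
  abel

lemma d0_bv (y : G μ) : d0 μ (bv y) = Jhat (prM y) := by
  simp [bv_apply, prM_apply, map_sum, d0_b]

lemma d0_quad (x : G μ) : d0 μ (quad x) = ∑ β : Pos μ, Jhat (prM ⁅x, tUp β⁆) * c β +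
    (1 / 2 : ℂ) • ∑ β : Pos μ, ∑ γ : Pos μ, bv ⁅x, ⁅tUp β, tUp γ⁆⁆ * (c β * c γ) := by
  rw [quad_apply, map_sum]
  simp only [d0_mul, parity_bv, d0_bv, Finset.sum_add_distrib]
  refine congrArg _ ?_
  have h2 (β γ : Pos μ) : bv ⁅x, ⁅tUp β, tUp γ⁆⁆ * (c β * c γ) =
      ∑ α : Pos μ, upCoeff ⁅tUp β, tUp γ⁆ α • (bv ⁅x, tUp α⁆ * (c β * c γ)) := by
    conv_lhs => rw [← prM_lie_tUp β γ, prM_apply]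
    rw [lie_sum, map_sum, Finset.sum_mul]
    exact Finset.sum_congr rfl fun α _ => by rw [lie_smul, map_smul, smul_mul_assoc]
  have h3 (α : Pos μ) : -bv ⁅x, tUp α⁆ * d0 μ (c α) = (1 / 2 : ℂ) • ∑ β : Pos μ, ∑ γ : Pos μ,
      upCoeff ⁅tUp β, tUp γ⁆ α • (bv ⁅x, tUp α⁆ * (c β * c γ)) := by
    rw [d0_c, neg_mul_neg, mul_smul_comm, Finset.mul_sum]
    simp only [Finset.mul_sum, mul_smul_comm]
  rw [Finset.sum_congr rfl fun α _ => h3 α, ← Finset.smul_sum]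
  refine congrArg _ ?_
  rw [Finset.sum_comm]
  refine Finset.sum_congr rfl fun β _ => ?_
  rw [Finset.sum_comm]
  exact Finset.sum_congr rfl fun γ _ => (h2 β γ).symm

/-- Written once more with the two ghost indices exchanged, the sum has an antisymmetrized
coefficient, which the Jacobi identity turns into `[x, [t^β, t^γ]]`. This is the cancellation of the
terms cubic in the ghosts in `d0_Jhat`. -/
lemma sum_quad_mul_c (x : G μ) : ∑ α : Pos μ, quad ⁅tUp α, x⁆ * c α =
    (1 / 2 : ℂ) • ∑ β : Pos μ, ∑ γ : Pos μ, bv ⁅x, ⁅tUp β, tUp γ⁆⁆ * (c β * c γ) := by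
  have h5 : ∑ α : Pos μ, quad ⁅tUp α, x⁆ * c α =
      ∑ β : Pos μ, ∑ γ : Pos μ, bv ⁅⁅tUp γ, x⁆, tUp β⁆ * (c β * c γ) := by
    rw [Finset.sum_comm]
    refine Finset.sum_congr rfl fun γ _ => ?_
    rw [quad_apply, Finset.sum_mul]
    exact Finset.sum_congr rfl fun β _ => mul_assoc _ _ _
  have h6 : ∑ α : Pos μ, quad ⁅tUp α, x⁆ * c α =
      -∑ β : Pos μ, ∑ γ : Pos μ, bv ⁅⁅tUp β, x⁆, tUp γ⁆ * (c β * c γ) := by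
    rw [h5, Finset.sum_comm, ← Finset.sum_neg_distrib]
    refine Finset.sum_congr rfl fun β _ => ?_
    rw [← Finset.sum_neg_distrib]
    exact Finset.sum_congr rfl fun γ _ => by rw [c_mul_c γ β, mul_neg]
  have h7 : ∑ α : Pos μ, quad ⁅tUp α, x⁆ * c α + ∑ α : Pos μ, quad ⁅tUp α, x⁆ * c α =
      ∑ β : Pos μ, ∑ γ : Pos μ, bv ⁅x, ⁅tUp β, tUp γ⁆⁆ * (c β * c γ) := by
    conv_lhs => lhs; rw [h5]
    rw [h6, ← sub_eq_add_neg, ← Finset.sum_sub_distrib]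
    refine Finset.sum_congr rfl fun β _ => ?_
    rw [← Finset.sum_sub_distrib]
    refine Finset.sum_congr rfl fun γ _ => ?_
    rw [← sub_mul, ← map_sub]
    refine congrArg (fun y => bv y * (c β * c γ)) ?_
    rw [leibniz_lie x, ← lie_skew ⁅tUp γ, x⁆ (tUp β), ← lie_skew x (tUp γ), lie_neg,
      ← lie_skew (tUp β) x, neg_lie]
    abel
  rw [← h7, ← two_smul ℂ, smul_smul]
  norm_num

/-- The derivative of `J x` brings in all of `[t^α, x]`, and the derivative of the antighosts in the
quadratic part removes exactly its component in `g_-`. This is why `Ω_red` is stable under `d_0`. -/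
lemma d0_Jhat (x : G μ) : d0 μ (Jhat x) = ∑ α : Pos μ, Jhat (prP ⁅tUp α, x⁆) * c α := by
  have h8 : d0 μ (J x) = ∑ α : Pos μ, Jhat ⁅tUp α, x⁆ * c α - ∑ α : Pos μ, quad ⁅tUp α, x⁆ * c α := by
    rw [d0_J, ← Finset.sum_sub_distrib]
    exact Finset.sum_congr rfl fun α _ => by rw [Jhat_eq, add_mul, add_sub_cancel_right]
  have h9 (α : Pos μ) : Jhat (prP ⁅tUp α, x⁆) * c α =
      Jhat ⁅tUp α, x⁆ * c α + Jhat (prM ⁅x, tUp α⁆) * c α := by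
    rw [prP_apply, map_sub, ← lie_skew x (tUp α), map_neg, map_neg, sub_mul, neg_mul,
      sub_eq_add_neg]
  rw [Finset.sum_congr rfl fun α _ => h9 α, Finset.sum_add_distrib, Jhat_eq, map_add, d0_quad, h8,
    sum_quad_mul_c]
  abel

/-- The character `χ`, extended by `0` to `g`. -/
def chiFun : G μ →ₗ[ℂ] ℂ := ∑ α : Pos μ, chi α • upFun α

lemma chiFun_apply (y : G μ) : chiFun y = ∑ α : Pos μ, chi α * upCoeff y α := by simp [chiFun]

/-- The functional sees only entries of degree `-1`, whereas brackets inside `g_-` have degree at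
most `-2`. -/
lemma chiFun_lie_tUp (α β : Pos μ) : chiFun (⁅tUp α, tUp β⁆ : G μ) = 0 := by
  rw [chiFun_apply]
  refine Finset.sum_eq_zero fun γ _ => ?_
  rw [chi]
  split_ifs with h
  · rw [upCoeff, lie_tUp_entry α β _ _ (by omega), mul_zero]
  · rw [zero_mul]

lemma d1_J (x : G μ) : d1 μ (J x) = 0 := by
  rw [d1, gradedComm_apply, parity_J, Q1]
  simp [Finset.sum_mul, Finset.mul_sum, J_mul_c]

lemma d1_c (α : Pos μ) : d1 μ (c α) = 0 := by
  rw [d1, gradedComm_apply, parity_c, Q1]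
  simp [Finset.sum_mul, Finset.mul_sum, c_mul_c α, ← Finset.sum_neg_distrib]

lemma d1_b (α : Pos μ) : d1 μ (b α) = -(chi α • (1 : Om μ)) := by
  rw [d1, gradedComm_apply, parity_b, Q1, neg_mul, neg_mul, mul_neg, neg_neg, sub_eq_add_neg, ← neg_add,
    Finset.sum_mul, Finset.mul_sum, ← Finset.sum_add_distrib]
  congr 1
  have (β : Pos μ) : chi β • c β * b α + b α * chi β • c β = if α = β then chi β • (1 : Om μ) else 0 := by
    rw [smul_mul_assoc, mul_smul_comm, ← smul_add, add_comm, b_mul_c_add]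
    split_ifs <;> simp
  rw [Finset.sum_congr rfl fun β _ => this β]
  simp

lemma d1_bv (y : G μ) : d1 μ (bv y) = -(chiFun y • (1 : Om μ)) := by
  simp [bv_apply, chiFun_apply, map_sum, d1_b, Finset.sum_smul, smul_smul, mul_comm]

lemma d1_Jhat (x : G μ) : d1 μ (Jhat x) = -∑ β : Pos μ, chiFun ⁅x, tUp β⁆ • c β := by
  rw [Jhat_eq, map_add, d1_J, zero_add, quad_apply, map_sum, ← Finset.sum_neg_distrib]
  exact Finset.sum_congr rfl fun β _ => by rw [d1_mul, d1_c, d1_bv]; simp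

/-- The coboundary of the antighost `b^α`. -/
def D (α : Pos μ) : Om μ := Jhat (tUp α) - chi α • 1

lemma d_b (α : Pos μ) : d μ (b α) = D α := by
  rw [d_eq, d0_b, d1_b, D, sub_eq_add_neg]

lemma d_one : d μ 1 = 0 := gradedComm_one _

/-- Read off from the formulas for `d_0` and `d_1`: brackets inside `g_-` have no part in `g_0 ⊕
g_+`, and `χ` vanishes on them. -/
lemma d_D (α : Pos μ) : d μ (D α) = 0 := by
  rw [D, map_sub, map_smul, d_one, smul_zero, sub_zero, d_eq, d0_Jhat, d1_Jhat]
  have h (β : Pos μ) : prP (⁅tUp β, tUp α⁆ : G μ) = 0 := by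
    rw [prP_apply, prM_lie_tUp, sub_self]
  simp only [h, chiFun_lie_tUp, map_zero, zero_mul, zero_smul, Finset.sum_const_zero, neg_zero,
    add_zero]

/-- As `g_0` normalizes `g_-`, the bracket `[t^α, x]` has no component in `g_0 ⊕ g_+`. -/
lemma d0_Jhat_of_mem_gZero {x : G μ} (hx : x ∈ gZero μ) : d0 μ (Jhat x) = 0 := by
  rw [d0_Jhat]
  refine Finset.sum_eq_zero fun α _ => ?_
  rw [prP_apply, prM_eq_self, sub_self, map_zero, zero_mul]
  have hx' : ∀ a e : Box μ, (e.col : ℤ) - a.col ≠ 0 → x.1 a e = 0 := mem_grade_iff.1 hx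
  intro a e h
  rw [lie_entry, Finset.sum_eq_zero, Finset.sum_eq_zero, sub_zero]
  · intro f _
    rw [tUp_apply]
    split_ifs with h1
    · obtain ⟨rfl, rfl⟩ := h1
      rw [hx' _ _ (by have := α.2; omega), zero_mul]
    · rw [mul_zero]
  · intro f _
    rw [tUp_apply]
    split_ifs with h1
    · obtain ⟨rfl, rfl⟩ := h1
      rw [hx' _ _ (by have := α.2; omega), mul_zero]
    · rw [zero_mul]

lemma c_lie_quad (x : G μ) (β : Pos μ) :
    quad x * c β - c β * quad x = -∑ γ : Pos μ, upCoeff ⁅x, tUp γ⁆ β • c γ := by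
  rw [quad_apply, Finset.sum_mul, Finset.mul_sum, ← Finset.sum_sub_distrib,
    ← Finset.sum_neg_distrib]
  refine Finset.sum_congr rfl fun γ _ => ?_
  rw [← mul_assoc (c β), c_mul_bv, sub_mul, mul_assoc, c_mul_c γ β, smul_mul_assoc, one_mul,
    mul_assoc, mul_neg]
  abel

lemma bv_lie_quad (x z : G μ) : quad x * bv z - bv z * quad x = bv ⁅x, prM z⁆ := by
  have (β : Pos μ) : bv ⁅x, tUp β⁆ * c β * bv z - bv z * (bv ⁅x, tUp β⁆ * c β) =
      upCoeff z β • bv ⁅x, tUp β⁆ := by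
    rw [mul_assoc, c_mul_bv, ← mul_assoc (bv z), bv_mul_bv z]
    simp [mul_sub, mul_assoc]
  rw [quad_apply, Finset.sum_mul, Finset.mul_sum, ← Finset.sum_sub_distrib]
  simp only [this, prM_apply, lie_sum, lie_smul, map_sum, map_smul]

lemma bv_lie_prM {x : G μ} (hx : x ∈ gNonneg μ) (z : G μ) : bv ⁅x, prM z⁆ = bv ⁅x, z⁆ := by
  have h : bv ⁅x, prP z⁆ = 0 := bv_eq_zero ((gNonneg μ).lie_mem hx (prP_mem z))
  rw [prP_apply, lie_sub, map_sub, sub_eq_zero] at h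
  exact h.symm

/-- The element `bv y` depends only on `y` modulo `g_0 ⊕ g_+`, and only the parabolic subalgebra
acts on this quotient; hence the hypotheses. The map `quad` is the action on the quotient written in
ghosts, and the Jacobi identity gives the bracket. -/
lemma quad_lie {x y : G μ} (hx : x ∈ gNonneg μ) (hy : y ∈ gNonneg μ) :
    quad ⁅x, y⁆ = quad x * quad y - quad y * quad x := by
  have h1 : quad x * quad y - quad y * quad x = ∑ β : Pos μ, bv ⁅x, ⁅y, tUp β⁆⁆ * c β -
      ∑ γ : Pos μ, bv ⁅y, ⁅x, tUp γ⁆⁆ * c γ := by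
    have h2 (β : Pos μ) : quad x * (bv ⁅y, tUp β⁆ * c β) - bv ⁅y, tUp β⁆ * c β * quad x =
        bv ⁅x, ⁅y, tUp β⁆⁆ * c β -
          ∑ γ : Pos μ, upCoeff ⁅x, tUp γ⁆ β • (bv ⁅y, tUp β⁆ * c γ) := by
      have h3 := bv_lie_quad x ⁅y, tUp β⁆
      rw [bv_lie_prM hx] at h3
      have h4 := c_lie_quad x β
      have h5 : quad x * (bv ⁅y, tUp β⁆ * c β) - bv ⁅y, tUp β⁆ * c β * quad x =
        (quad x * bv ⁅y, tUp β⁆ - bv ⁅y, tUp β⁆ * quad x) * c β +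
          bv ⁅y, tUp β⁆ * (quad x * c β - c β * quad x) := by noncomm_ring
      rw [h5, h3, h4, mul_neg, Finset.mul_sum, sub_eq_add_neg]
      simp only [mul_smul_comm]
    conv_lhs => rw [quad_apply y, Finset.mul_sum, Finset.sum_mul, ← Finset.sum_sub_distrib]
    rw [Finset.sum_congr rfl fun β _ => h2 β, Finset.sum_sub_distrib, Finset.sum_comm]
    congr 1
    refine Finset.sum_congr rfl fun γ _ => ?_
    rw [← bv_lie_prM hy, prM_apply, lie_sum, map_sum, Finset.sum_mul]
    exact Finset.sum_congr rfl fun β _ => by rw [lie_smul, map_smul, smul_mul_assoc]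
  rw [h1, quad_apply, ← Finset.sum_sub_distrib]
  refine Finset.sum_congr rfl fun β _ => ?_
  rw [← sub_mul, ← map_sub, ← lie_lie]

lemma J_mul_quad (x y : G μ) : J x * quad y = quad y * J x := by
  rw [quad_apply, Finset.mul_sum, Finset.sum_mul]
  exact Finset.sum_congr rfl fun β _ => by
    rw [← mul_assoc, J_mul_bv, mul_assoc, J_mul_c, mul_assoc]

lemma Jhat_lie {x y : G μ} (hx : x ∈ gNonneg μ) (hy : y ∈ gNonneg μ) :
    Jhat ⁅x, y⁆ = Jhat x * Jhat y - Jhat y * Jhat x := by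
  simp only [Jhat_eq, J_lie, quad_lie hx hy, mul_add, add_mul, J_mul_quad]
  abel

end differentials

/-! The coaction of matrices on `Ω`. -/

section coaction

lemma nontrivial_tensorProduct {U C : Type} [Ring U] [Algebra ℂ U] [Ring C] [Algebra ℂ C]
    [Nontrivial C] (ε : U →ₐ[ℂ] ℂ) : Nontrivial (U ⊗[ℂ] C) :=
  ((Algebra.TensorProduct.lid ℂ C).toAlgHom.comp
    (Algebra.TensorProduct.map ε (AlgHom.id ℂ C))).toRingHom.domain_nontrivial

/-- The coaction on `U ⊗ C` induced by a coaction on `U`. -/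
def coactionTensor {M U C : Type} [Ring M] [Algebra ℂ M] [Ring U] [Algebra ℂ U] [Ring C]
    [Algebra ℂ C] (Δ : U →ₐ[ℂ] M ⊗[ℂ] U) : U ⊗[ℂ] C →ₐ[ℂ] M ⊗[ℂ] (U ⊗[ℂ] C) :=
  (Algebra.TensorProduct.assoc ℂ ℂ ℂ M U C).toAlgHom.comp
    (Algebra.TensorProduct.map Δ (AlgHom.id ℂ C))

lemma coactionTensor_left {M U C : Type} [Ring M] [Algebra ℂ M] [Ring U] [Algebra ℂ U] [Ring C]
    [Algebra ℂ C] (Δ : U →ₐ[ℂ] M ⊗[ℂ] U) (u : U) (m : M) (h : Δ u = m ⊗ₜ 1 + 1 ⊗ₜ u) :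
    coactionTensor Δ (u ⊗ₜ (1 : C)) = m ⊗ₜ 1 + 1 ⊗ₜ (u ⊗ₜ 1) := by
  simp [coactionTensor, h, TensorProduct.add_tmul, Algebra.TensorProduct.one_def]

lemma coactionTensor_right {M U C : Type} [Ring M] [Algebra ℂ M] [Ring U] [Algebra ℂ U] [Ring C]
    [Algebra ℂ C] (Δ : U →ₐ[ℂ] M ⊗[ℂ] U) (v : C) :
    coactionTensor Δ (1 ⊗ₜ v) = 1 ⊗ₜ (1 ⊗ₜ v) := by
  simp [coactionTensor, Algebra.TensorProduct.one_def]

variable {μ : YoungDiagram}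

instance : Nontrivial (Om μ) :=
  nontrivial_tensorProduct (U := UniversalEnvelopingAlgebra ℂ (G μ)) (C := Ghost μ)
    (UniversalEnvelopingAlgebra.lift ℂ (0 : G μ →ₗ⁅ℂ⁆ ℂ))

/-- The matrices indexed by the boxes. -/
abbrev Mat (μ : YoungDiagram) : Type := Matrix (Box μ) (Box μ) ℂ

/-- The map `x ↦ x ⊗ 1 + 1 ⊗ x`. -/
def primitive (μ : YoungDiagram) : G μ →ₗ⁅ℂ⁆ Mat μ ⊗[ℂ] UniversalEnvelopingAlgebra ℂ (G μ) where
  toFun x := x.1 ⊗ₜ 1 + 1 ⊗ₜ UniversalEnvelopingAlgebra.ι ℂ x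
  map_add' x y := by
    change (x.1 + y.1) ⊗ₜ[ℂ] (1 : UniversalEnvelopingAlgebra ℂ (G μ)) + _ = _
    rw [map_add, TensorProduct.tmul_add, TensorProduct.add_tmul]
    abel
  map_smul' r x := by
    change (r • x.1) ⊗ₜ[ℂ] (1 : UniversalEnvelopingAlgebra ℂ (G μ)) + _ = _
    rw [map_smul, TensorProduct.tmul_smul, ← TensorProduct.smul_tmul', ← smul_add,
      RingHom.id_apply]
  map_lie' := by
    intro x y
    simp only [LieHom.map_lie, LieRing.of_associative_ring_bracket,
      LieAlgebra.SpecialLinear.sl_bracket, mul_add, add_mul, Algebra.TensorProduct.tmul_mul_tmul,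
      one_mul, mul_one, TensorProduct.sub_tmul, TensorProduct.tmul_sub]
    abel

/-- The coaction of matrices on `Ω`. -/
def coaction (μ : YoungDiagram) : Om μ →ₐ[ℂ] Mat μ ⊗[ℂ] Om μ :=
  coactionTensor (C := Ghost μ) (UniversalEnvelopingAlgebra.lift ℂ (primitive μ))

lemma coaction_J (x : G μ) : coaction μ (J x) = x.1 ⊗ₜ 1 + 1 ⊗ₜ J x :=
  coactionTensor_left _ _ x.1 (UniversalEnvelopingAlgebra.lift_ι_apply ℂ (primitive μ) x)

lemma coaction_ghost (v : Module.Dual ℂ (gPlus μ) × gPlus μ) :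
    coaction μ (ghost v) = 1 ⊗ₜ ghost v :=
  coactionTensor_right _ _

/-- The contraction of the coaction with a functional on matrices. -/
def contract (ℓ : Mat μ →ₗ[ℂ] ℂ) : Om μ →ₗ[ℂ] Om μ :=
  (TensorProduct.lid ℂ (Om μ)).toLinearMap ∘ₗ LinearMap.rTensor (Om μ) ℓ ∘ₗ
    (coaction μ).toLinearMap

lemma contract_one (ℓ : Mat μ →ₗ[ℂ] ℂ) : contract ℓ 1 = ℓ 1 • (1 : Om μ) := by
  simp [contract, Algebra.TensorProduct.one_def]

lemma contract_J_mul (ℓ : Mat μ →ₗ[ℂ] ℂ) (x : G μ) (X : Om μ) :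
    contract ℓ (J x * X) = contract (ℓ ∘ₗ LinearMap.mulLeft ℂ x.1) X + J x * contract ℓ X := by
  simp only [contract, LinearMap.comp_apply, AlgHom.toLinearMap_apply, map_mul, coaction_J]
  induction coaction μ X using TensorProduct.induction_on with
  | zero => simp
  | add s t hs ht =>
    rw [mul_add, map_add, map_add, hs, ht, map_add, map_add, map_add, map_add, mul_add]
    abel
  | tmul m Y => simp [add_mul]

lemma contract_ghost_mul (ℓ : Mat μ →ₗ[ℂ] ℂ) (v) (X : Om μ) :
    contract ℓ (ghost v * X) = ghost v * contract ℓ X := by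
  simp only [contract, LinearMap.comp_apply, AlgHom.toLinearMap_apply, map_mul, coaction_ghost]
  induction coaction μ X using TensorProduct.induction_on with
  | zero => simp
  | add s t hs ht => simp only [mul_add, map_add, hs, ht]
  | tmul m Y => simp

/-- The operator on `Ω` that deletes one factor `J x` with weight `ℓ x`, up to lower terms. -/
def lower (ℓ : Mat μ →ₗ[ℂ] ℂ) : Om μ →ₗ[ℂ] Om μ := contract ℓ - ℓ 1 • LinearMap.id

lemma lower_apply (ℓ : Mat μ →ₗ[ℂ] ℂ) (X : Om μ) : lower ℓ X = contract ℓ X - ℓ 1 • X := rfl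

lemma lower_zero : lower (0 : Mat μ →ₗ[ℂ] ℂ) = 0 := by
  ext X
  simp [lower, contract]

lemma lower_one (ℓ : Mat μ →ₗ[ℂ] ℂ) : lower ℓ (1 : Om μ) = 0 := by
  rw [lower_apply, contract_one, sub_self]

/-- A factor `J x` is either absorbed into the functional or kept. Subtracting `ℓ 1` removes the
term in which nothing is deleted. The middle term deletes `J x` together with at least one further
factor `J`, so it is of lower order than the first. -/
lemma lower_J_mul (ℓ : Mat μ →ₗ[ℂ] ℂ) (x : G μ) (X : Om μ) :
    lower ℓ (J x * X) = ℓ x.1 • X + lower (ℓ ∘ₗ LinearMap.mulLeft ℂ x.1) X + J x * lower ℓ X := by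
  simp only [lower_apply, contract_J_mul, LinearMap.comp_apply, LinearMap.mulLeft_apply, mul_one,
    mul_sub, mul_smul_comm]
  abel

lemma lower_ghost_mul (ℓ : Mat μ →ₗ[ℂ] ℂ) (v) (X : Om μ) :
    lower ℓ (ghost v * X) = ghost v * lower ℓ X := by
  simp only [lower_apply, contract_ghost_mul, mul_sub, mul_smul_comm]

lemma lower_c_mul (ℓ : Mat μ →ₗ[ℂ] ℂ) (α : Pos μ) (X : Om μ) :
    lower ℓ (c α * X) = c α * lower ℓ X := lower_ghost_mul _ _ _

lemma lower_b_mul (ℓ : Mat μ →ₗ[ℂ] ℂ) (α : Pos μ) (X : Om μ) :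
    lower ℓ (b α * X) = b α * lower ℓ X := lower_ghost_mul _ _ _

lemma lower_quad_mul (ℓ : Mat μ →ₗ[ℂ] ℂ) (x : G μ) (X : Om μ) :
    lower ℓ (quad x * X) = quad x * lower ℓ X := by
  simp only [quad_apply, bv_apply, Finset.sum_mul, map_sum, smul_mul_assoc, map_smul, mul_assoc,
    lower_b_mul, lower_c_mul]

lemma lower_Jhat_mul (ℓ : Mat μ →ₗ[ℂ] ℂ) (x : G μ) (X : Om μ) :
    lower ℓ (Jhat x * X) =
      ℓ x.1 • X + lower (ℓ ∘ₗ LinearMap.mulLeft ℂ x.1) X + Jhat x * lower ℓ X := by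
  rw [Jhat_eq, add_mul, map_add, lower_J_mul, lower_quad_mul, add_mul]
  abel

end coaction

/-! A basis of `Ω` of ordered monomials. -/

section adapted

variable {μ : YoungDiagram}

/-- The functional `x ↦ Tr (κ x)`, where `κ` is the diagonal matrix of column numbers. -/
def psi : G μ →ₗ[ℂ] ℂ where
  toFun x := ∑ a : Box μ, (a.col : ℂ) * x.1 a a
  map_add' x y := by
    rw [← Finset.sum_add_distrib]
    exact Finset.sum_congr rfl fun a _ => mul_add _ (x.1 a a) (y.1 a a)
  map_smul' r x := by
    rw [RingHom.id_apply, smul_eq_mul, Finset.mul_sum]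
    exact Finset.sum_congr rfl fun a _ => mul_left_comm _ r (x.1 a a)

lemma psi_apply (x : G μ) : psi x = ∑ a : Box μ, (a.col : ℂ) * x.1 a a := rfl

lemma psi_eq_zero {x : G μ} (h : ∀ a, x.1 a a = 0) : psi x = 0 := by
  rw [psi_apply, Finset.sum_eq_zero fun a _ => by rw [h a, mul_zero]]

/-- With `α = (a, b)`, `[E_{ba}, E_{ab}] = E_{bb} - E_{aa}`, and brackets of matrix units that are
not transposed to each other have no diagonal part. For `α = β` the value is nonzero, because `b`
lies strictly to the right of `a`. -/
lemma psi_lie (α β : Pos μ) : psi (⁅tUp α, tLow β⁆ : G μ) =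
    if α = β then (α.1.2.col : ℂ) - α.1.1.col else 0 := by
  have h1 (a f : Box μ) : (tUp α).1 a f * (tLow β).1 f a =
      if α = β then (if α.1.2 = a then if α.1.1 = f then 1 else 0 else 0) else 0 := by
    rw [tUp_apply, tLow_apply]
    by_cases h : α = β
    · subst h
      rw [if_pos rfl]
      split_ifs <;> simp_all
    · rw [if_neg h, mul_eq_zero]
      by_contra! hc
      have e1 := of_not_not (fun hn => hc.1 (if_neg hn))
      have e2 := of_not_not (fun hn => hc.2 (if_neg hn))
      exact h (Subtype.ext (Prod.ext (e1.2.trans e2.1.symm) (e1.1.trans e2.2.symm)))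
  have h2 (a f : Box μ) : (tLow β).1 a f * (tUp α).1 f a =
      if α = β then (if α.1.1 = a then if α.1.2 = f then 1 else 0 else 0) else 0 := by
    rw [mul_comm, h1]
    split_ifs <;> rfl
  rw [psi_apply]
  simp only [lie_entry, h1, h2]
  by_cases h : α = β
  · simp [h, mul_sub]
  · simp [h]

/-- The projection onto `g_0`. -/
def prZ : G μ →ₗ[ℂ] gZero μ where
  toFun x := ⟨gradeProj 0 x, gradeProj_mem 0 x⟩
  map_add' x y := by
    refine Subtype.ext (Subtype.ext (Matrix.ext fun a e => ?_))
    change (if _ then x.1 a e + y.1 a e else 0) = (if _ then x.1 a e else 0) + if _ then y.1 a e else 0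
    split_ifs <;> simp
  map_smul' r x := by
    refine Subtype.ext (Subtype.ext (Matrix.ext fun a e => ?_))
    change (if _ then r * x.1 a e else 0) = r * if _ then x.1 a e else 0
    split_ifs <;> simp

lemma prZ_entry (x : G μ) (a e : Box μ) :
    (prZ x).1.1 a e = if e.col = a.col then x.1 a e else 0 := by
  change (if (e.col : ℤ) - a.col = 0 then x.1 a e else 0) = _
  refine if_congr ?_ rfl rfl
  omega

lemma mem_gZero_entry {x : G μ} (hx : x ∈ gZero μ) (a e : Box μ) (h : e.col ≠ a.col) :
    x.1 a e = 0 := by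
  have hx' : ∀ a e : Box μ, (e.col : ℤ) - a.col ≠ 0 → x.1 a e = 0 := mem_grade_iff.1 hx
  exact hx' a e (by omega)

lemma prZ_of_mem (x : gZero μ) : prZ x.1 = x := by
  refine Subtype.ext (Subtype.ext (Matrix.ext fun a e => ?_))
  rw [prZ_entry]
  split_ifs with h
  · rfl
  · exact (mem_gZero_entry x.2 a e h).symm

lemma prZ_eq_zero {x : G μ} (h : ∀ a e : Box μ, e.col = a.col → x.1 a e = 0) : prZ x = 0 := by
  refine Subtype.ext (Subtype.ext (Matrix.ext fun a e => ?_))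
  rw [prZ_entry]
  split_ifs with hc
  · exact h a e hc
  · rfl

lemma prZ_tLow (α : Pos μ) : prZ (tLow α) = 0 := by
  refine prZ_eq_zero fun a e h => ?_
  rw [tLow_apply, if_neg]
  rintro ⟨rfl, rfl⟩
  have := α.2
  omega

lemma prZ_tUp (α : Pos μ) : prZ (tUp α) = 0 := by
  refine prZ_eq_zero fun a e h => ?_
  rw [tUp_apply, if_neg]
  rintro ⟨rfl, rfl⟩
  have := α.2
  omega

lemma psi_prZ (x : G μ) : psi (prZ x).1 = psi x := by
  rw [psi_apply, psi_apply]
  exact Finset.sum_congr rfl fun a _ => by rw [prZ_entry, if_pos rfl]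

/-- The matrix entry at `γ`. -/
def lowFun (γ : Pos μ) : G μ →ₗ[ℂ] ℂ where
  toFun x := x.1 γ.1.1 γ.1.2
  map_add' _ _ := rfl
  map_smul' _ _ := rfl

lemma lowFun_apply (γ : Pos μ) (x : G μ) : lowFun γ x = x.1 γ.1.1 γ.1.2 := rfl

lemma lowFun_tLow (α γ : Pos μ) : lowFun γ (tLow α) = if α = γ then 1 else 0 := by
  rw [lowFun_apply, tLow_apply]
  refine if_congr ?_ rfl rfl
  refine ⟨fun h => Subtype.ext (Prod.ext h.1 h.2), ?_⟩
  rintro rfl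
  exact ⟨rfl, rfl⟩

lemma lowFun_tUp (α γ : Pos μ) : lowFun γ (tUp α) = 0 := by
  rw [lowFun_apply, tUp_apply, if_neg]
  rintro ⟨h1, h2⟩
  have h3 := α.2
  have h4 := γ.2
  rw [h1, h2] at h3
  omega

lemma upCoeff_tLow (α γ : Pos μ) : upCoeff (tLow α) γ = 0 := upCoeff_eq_zero (tLow_mem α) γ

lemma decompose_g (x : G μ) :
    x = (prZ x).1 + ∑ γ : Pos μ, lowFun γ x • tLow γ + ∑ γ : Pos μ, upCoeff x γ • tUp γ := by
  rw [← prM_apply]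
  refine Subtype.ext (Matrix.ext fun a e => ?_)
  change x.1 a e = (prZ x).1.1 a e + (∑ γ : Pos μ, lowFun γ x • tLow γ : G μ).1 a e + (prM x).1 a e
  rw [prM_entry, prZ_entry, AddSubmonoidClass.coe_finsetSum, Matrix.sum_apply]
  have h (γ : Pos μ) : (lowFun γ x • tLow γ).1 a e =
      if γ.1.1 = a ∧ γ.1.2 = e then x.1 a e else 0 := by
    change lowFun γ x * (tLow γ).1 a e = _
    rw [tLow_apply]
    split_ifs with h
    · rw [← h.1, ← h.2, mul_one]; rfl
    · rw [mul_zero]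
  rw [Finset.sum_congr rfl fun γ _ => h γ]
  have h2 : (∑ γ : Pos μ, if γ.1.1 = a ∧ γ.1.2 = e then x.1 a e else 0) =
      if a.col < e.col then x.1 a e else 0 := by
    split_ifs with hc
    · rw [Finset.sum_eq_single (⟨(a, e), hc⟩ : Pos μ)]
      · simp
      · intro γ _ hγ
        rw [if_neg]
        rintro ⟨h1, h2⟩
        exact hγ (Subtype.ext (Prod.ext h1 h2))
      · simp
    · refine Finset.sum_eq_zero fun γ _ => if_neg ?_
      rintro ⟨rfl, rfl⟩
      exact hc γ.2
  rw [h2]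
  rcases lt_trichotomy a.col e.col with h | h | h
  · simp [h, h.ne', h.not_gt]
  · simp [h]
  · simp [h, h.ne, h.not_gt]

/-- A basis of `g_0` in which `psi` is zero or a coordinate. -/
structure AdaptedBasis (μ : YoungDiagram) where
  rank : ℕ
  basis : Module.Basis (Fin rank) ℂ (gZero μ)
  Special : Fin rank → Prop
  coord : ∀ z, Special z → ∀ x : gZero μ, basis.repr x z = psi x.1
  exists_special : Nonempty (Pos μ) → ∃ z, Special z

/-- If `psi` is nonzero on `g_0`, a vector of value `1` together with a basis of the kernel makes it
a coordinate. If `psi` vanishes on `g_0`, then `psi_lie` leaves no room for positive indices, and no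
vector has to be special. -/
lemma AdaptedBasis.nonempty (μ : YoungDiagram) : Nonempty (AdaptedBasis μ) := by
  let f : gZero μ →ₗ[ℂ] ℂ := psi ∘ₗ (gZero μ).toSubmodule.subtype
  by_cases hf : f = 0
  · refine ⟨⟨_, Module.finBasis ℂ (gZero μ), fun _ => False, fun _ h => h.elim, ?_⟩⟩
    rintro ⟨α⟩
    exfalso
    have h1 := LinearMap.congr_fun hf (prZ ⁅tUp α, tLow α⁆)
    change psi (prZ ⁅tUp α, tLow α⁆).1 = 0 at h1
    rw [psi_prZ, psi_lie, if_pos rfl, sub_eq_zero, Nat.cast_inj] at h1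
    have := α.2
    omega
  · obtain ⟨y, hy⟩ : ∃ y, f y = 1 := by
      obtain ⟨y, hy⟩ : ∃ y, f y ≠ 0 := by
        by_contra! h
        exact hf (LinearMap.ext h)
      exact ⟨(f y)⁻¹ • y, by rw [map_smul, smul_eq_mul, inv_mul_cancel₀ hy]⟩
    let e := Module.Basis.mkFinCons y (Module.finBasis ℂ (LinearMap.ker f)) (by
      intro r x hx h
      have h1 := congrArg f h
      rw [map_add, map_smul, hy, LinearMap.mem_ker.1 hx] at h1
      simpa using h1) (by
      intro z
      refine ⟨-f z, ?_⟩
      rw [LinearMap.mem_ker, map_add, map_smul, hy]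
      simp)
    have he : e.coord 0 = f := by
      refine e.ext fun i => ?_
      rw [Module.Basis.coord_apply, Module.Basis.repr_self]
      induction i using Fin.cases with
      | zero => simp [e, hy]
      | succ i =>
        have : f ((Module.finBasis ℂ (LinearMap.ker f)) i) = 0 :=
          LinearMap.mem_ker.1 (Submodule.coe_mem _)
        simp [e, this]
    refine ⟨⟨_, e, fun z => z = 0, ?_, fun _ => ⟨0, rfl⟩⟩⟩
    rintro z rfl x
    exact LinearMap.congr_fun he x

end adapted

/-- Labels of the generators `Ĵ(x)`, for `x` in a basis of `g_0 ⊕ g_+`, of the ghosts `c_α`, and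
of the elements `D^α` and `b^α`. -/
inductive Letter (μ : YoungDiagram) (r : ℕ) : Type
  | zero (z : Fin r)
  | plus (α : Pos μ)
  | gh (α : Pos μ)
  | minus (α : Pos μ)
  | anti (α : Pos μ)

/-! ### The weight filtration of `Ω` and its basis of ordered monomials. -/

namespace Letter

variable {μ : YoungDiagram} (B : AdaptedBasis μ)

/-- The element of `g` that belongs to a letter. -/
def vec : Letter μ B.rank → G μ
  | zero z => B.basis z
  | plus α => tLow α
  | gh _ => 0
  | minus α => tUp α
  | anti _ => 0

/-- The generator that belongs to a letter. -/
def gen : Letter μ B.rank → Om μ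
  | zero z => Jhat (B.basis z).1
  | plus α => Jhat (tLow α)
  | gh α => c α
  | minus α => D α
  | anti α => b α

open Classical in
/-- The weights of the letters. -/
def weight : Letter μ B.rank → ℕ
  -- A product `b c` weighs `2`, less than any `Ĵ`, so ghost corrections are lower terms.
  -- Commutators of two `Ĵ` weigh at most `4`, less than `3 + 3`. The extra unit of the special
  -- letter makes the replacement of `Ĵ(t_β)` by it the leading term of `[b^β, d ·]`.
  | zero z => if B.Special z then 4 else 3
  | plus _ => 3
  | gh _ => 1
  | minus _ => 3
  | anti _ => 1

/-- The ghosts and antighosts. -/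
inductive Odd : Letter μ B.rank → Prop
  | gh (α : Pos μ) : Odd (gh α)
  | anti (α : Pos μ) : Odd (anti α)

/-- The letters that are not ghosts or antighosts. -/
inductive Even : Letter μ B.rank → Prop
  | zero (z) : Even (zero z)
  | plus (α : Pos μ) : Even (plus α)
  | minus (α : Pos μ) : Even (minus α)

/-- The functional dual to `vec`. -/
def dual : Letter μ B.rank → G μ →ₗ[ℂ] ℂ
  | zero z => B.basis.coord z ∘ₗ prZ
  | plus α => lowFun α
  | gh _ => 0
  | minus α => upFun α
  | anti _ => 0

lemma even_or_odd (z : Letter μ B.rank) : Even B z ∨ Odd B z := by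
  cases z <;> first | exact Or.inl (by constructor) | exact Or.inr (by constructor)

lemma not_odd_of_even {z : Letter μ B.rank} (h : Even B z) : ¬ Odd B z := by
  rintro (_ | _) <;> cases h

lemma weight_pos (z : Letter μ B.rank) : 0 < weight B z := by
  cases z <;> simp only [weight] <;> (try split_ifs) <;> omega

lemma weight_even {z : Letter μ B.rank} (h : Even B z) : 3 ≤ weight B z ∧ weight B z ≤ 4 := by
  cases h <;> simp only [weight] <;> (try split_ifs) <;> omega

lemma weight_odd {z : Letter μ B.rank} (h : Odd B z) : weight B z = 1 := by
  cases h <;> rfl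

open Classical in
lemma dual_vec {z : Letter μ B.rank} (h : Even B z) (z' : Letter μ B.rank) :
    dual B z (vec B z') = if z' = z then 1 else 0 := by
  cases h with
  | zero z =>
    cases z' <;> simp [dual, vec, prZ_of_mem, prZ_tLow, prZ_tUp, Finsupp.single_apply]
  | plus α =>
    cases z' with
    | zero z' =>
      simp only [dual, vec, reduceCtorEq, if_false, lowFun_apply]
      exact mem_gZero_entry (B.basis z').2 _ _ (by have := α.2; omega)
    | _ => simp [dual, vec, lowFun_tLow, lowFun_tUp]
  | minus α =>
    cases z' with
    | zero z' =>
      simp only [dual, vec, reduceCtorEq, if_false, upFun_apply, upCoeff]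
      exact mem_gZero_entry (B.basis z').2 _ _ (by have := α.2; omega)
    | plus | minus => simp [dual, vec, upCoeff_tLow, upCoeff_tUp]
    | gh | anti =>
      rw [if_neg (by simp)]
      exact map_zero (upFun α)

lemma gen_even {z : Letter μ B.rank} (h : Even B z) :
    ∃ r : ℂ, gen B z = Jhat (vec B z) - r • 1 := by
  cases h with
  | zero z => exact ⟨0, by simp [gen, vec]⟩
  | plus α => exact ⟨0, by simp [gen, vec]⟩
  | minus α => exact ⟨chi α, rfl⟩

lemma vec_odd {z : Letter μ B.rank} (h : Odd B z) : vec B z = 0 := by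
  cases h <;> rfl

lemma lower_gen_mul (ℓ : Mat μ →ₗ[ℂ] ℂ) (z : Letter μ B.rank) (X : Om μ) :
    lower ℓ (gen B z * X) = ℓ (vec B z).1 • X +
      lower (ℓ ∘ₗ LinearMap.mulLeft ℂ (vec B z).1) X + gen B z * lower ℓ X := by
  rcases even_or_odd B z with h | h
  · obtain ⟨r, hr⟩ := gen_even B h
    rw [hr, sub_mul, map_sub, lower_Jhat_mul, smul_one_mul, map_smul, sub_mul, smul_one_mul]
    abel
  · have h0 : ℓ ∘ₗ LinearMap.mulLeft ℂ (vec B z).1 = 0 := by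
      ext1 m
      rw [vec_odd B h]
      change ℓ (0 * m) = 0
      rw [zero_mul, map_zero]
    rw [h0, lower_zero, vec_odd B h, LinearMap.zero_apply, add_zero]
    change _ = ℓ 0 • X + _
    rw [map_zero, zero_smul, zero_add]
    cases h with
    | gh α => exact lower_c_mul _ _ _
    | anti α => exact lower_b_mul _ _ _

/-- The filtration of `Ω` by weight. -/
abbrev fil (n : ℤ) : Submodule ℂ (Om μ) := filt ℂ (gen B) (weight B) n

/-- At least one even letter disappears, and such a letter weighs at least `3`. The functional has
to vary in the induction because the middle term of `lower_gen_mul` changes it. -/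
lemma lower_mem {n : ℤ} {X : Om μ} (hX : X ∈ fil B n) (ℓ : Mat μ →ₗ[ℂ] ℂ) :
    lower ℓ X ∈ fil B (n - 3) := by
  have key : ∀ L : List (Letter μ B.rank), ∀ ℓ : Mat μ →ₗ[ℂ] ℂ,
      lower ℓ ((L.map (gen B)).prod) ∈ fil B ((wt (weight B) (L : Multiset _) : ℤ) - 3) := by
    intro L
    induction L with
    | nil => intro ℓ; simp [lower_one]
    | cons z L ih =>
      intro ℓ
      rw [List.map_cons, List.prod_cons, lower_gen_mul, wt_coe_cons]
      push_cast
      have h0 : (0 : ℤ) < weight B z := by exact_mod_cast weight_pos B z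
      refine Submodule.add_mem _ (Submodule.add_mem _ ?_ (filt_mono (by omega) (ih _))) ?_
      · rcases even_or_odd B z with h | h
        · have := weight_even B h
          exact Submodule.smul_mem _ _ (prod_mem_filt (by omega))
        · rw [vec_odd B h]
          change ℓ 0 • _ ∈ _
          rw [map_zero, zero_smul]
          exact Submodule.zero_mem _
      · exact mul_mem_filt (gen_mem_filt le_rfl) (ih ℓ) (by omega)
  induction hX using Submodule.span_induction with
  | mem X hX =>
    obtain ⟨L, hL, rfl⟩ := hX
    exact filt_mono (by omega) (key L ℓ)
  | zero => simp
  | add X Y _ _ h1 h2 => rw [map_add]; exact Submodule.add_mem _ h1 h2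
  | smul r X _ h1 => rw [map_smul]; exact Submodule.smul_mem _ _ h1

lemma c_mem {n : ℤ} (h : 1 ≤ n) (α : Pos μ) : c α ∈ fil B n :=
  gen_mem_filt (g := gen B) (w := weight B) (z := gh α) h

lemma b_mem {n : ℤ} (h : 1 ≤ n) (α : Pos μ) : b α ∈ fil B n :=
  gen_mem_filt (g := gen B) (w := weight B) (z := anti α) h

lemma bv_mem {n : ℤ} (h : 1 ≤ n) (y : G μ) : bv y ∈ fil B n := by
  rw [bv_apply]
  exact Submodule.sum_mem _ fun γ _ => Submodule.smul_mem _ _ (b_mem B h γ)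

lemma quad_mem {n : ℤ} (h : 2 ≤ n) (y : G μ) : quad y ∈ fil B n := by
  rw [quad_apply]
  exact Submodule.sum_mem _ fun γ _ => mul_mem_filt (bv_mem B le_rfl _) (c_mem B le_rfl γ) h

lemma Jhat_tUp_mem {n : ℤ} (h : 3 ≤ n) (α : Pos μ) : Jhat (tUp α) ∈ fil B n := by
  have h1 : Jhat (tUp α) = gen B (minus α) + chi α • 1 := by simp [gen, D]
  rw [h1]
  exact Submodule.add_mem _ (gen_mem_filt (by simpa [weight] using h))
    (Submodule.smul_mem _ _ (one_mem_filt (by omega)))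

lemma Jhat_tLow_mem {n : ℤ} (h : 3 ≤ n) (α : Pos μ) : Jhat (tLow α) ∈ fil B n :=
  gen_mem_filt (g := gen B) (w := weight B) (z := plus α) (by simpa [weight] using h)

lemma Jhat_eq_sum (x : G μ) : Jhat x = ∑ z, B.basis.repr (prZ x) z • gen B (zero z) +
    ∑ γ : Pos μ, lowFun γ x • Jhat (tLow γ) + ∑ γ : Pos μ, upCoeff x γ • Jhat (tUp γ) := by
  have h2 : (prZ x).1 = ∑ z, B.basis.repr (prZ x) z • (B.basis z).1 := by
    have h3 := congrArg (gZero μ).toSubmodule.subtype (B.basis.sum_repr (prZ x))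
    rw [map_sum] at h3
    exact h3.symm
  conv_lhs => rw [decompose_g x, h2]
  simp only [map_add, map_sum, map_smul]
  rfl

lemma Jhat_mem {n : ℤ} (h : 4 ≤ n) (x : G μ) : Jhat x ∈ fil B n := by
  rw [Jhat_eq_sum B]
  refine Submodule.add_mem _ (Submodule.add_mem _ ?_ ?_) ?_
  · exact Submodule.sum_mem _ fun z _ => Submodule.smul_mem _ _
      (gen_mem_filt (by have := (weight_even B (Even.zero z)).2; omega))
  · exact Submodule.sum_mem _ fun γ _ => Submodule.smul_mem _ _ (Jhat_tLow_mem B (by omega) γ)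
  · exact Submodule.sum_mem _ fun γ _ => Submodule.smul_mem _ _ (Jhat_tUp_mem B (by omega) γ)

-- Modulo weight `3` only special coordinates survive, and a special coordinate equals `psi`. There
-- is only one of them, since two basis coordinates cannot coincide.
open Classical in
lemma Jhat_sub_mem {z : Fin B.rank} (hz : B.Special z) (x : G μ) :
    Jhat x - psi x • gen B (zero z) ∈ fil B 3 := by
  have h : psi x • gen B (zero z) = ∑ z', if z' = z then psi x • gen B (zero z') else 0 := by simp
  rw [h, Jhat_eq_sum B, add_sub_right_comm, add_sub_right_comm, ← Finset.sum_sub_distrib]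
  refine Submodule.add_mem _ (Submodule.add_mem _ ?_ ?_) ?_
  · refine Submodule.sum_mem _ fun z' _ => ?_
    by_cases h' : B.Special z'
    · rw [B.coord z' h', psi_prZ]
      split_ifs with h1
      · rw [sub_self]; exact Submodule.zero_mem _
      · have h2 := B.coord z' h' (B.basis z)
        rw [← B.coord z hz (B.basis z)] at h2
        simp [Ne.symm h1] at h2
    · rw [if_neg (by rintro rfl; exact h' hz), sub_zero]
      exact Submodule.smul_mem _ _ (gen_mem_filt (by simp [weight, h']))
  · exact Submodule.sum_mem _ fun γ _ => Submodule.smul_mem _ _ (Jhat_tLow_mem B le_rfl γ)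
  · exact Submodule.sum_mem _ fun γ _ => Submodule.smul_mem _ _ (Jhat_tUp_mem B le_rfl γ)

lemma J_mem {n : ℤ} (h : 4 ≤ n) (x : G μ) : J x ∈ fil B n := by
  rw [← add_sub_cancel_right (J x) (quad x), ← Jhat_eq]
  exact Submodule.sub_mem _ (Jhat_mem B h x) (quad_mem B (by omega) x)

lemma exists_mem_fil (X : Om μ) : ∃ n : ℕ, X ∈ fil B n := by
  have h : filtAlg ℂ (gen B) (weight B) = ⊤ := by
    refine subalgebra_eq_top _ fun X p h => ?_
    cases h with
    | J k x hx => exact ⟨4, J_mem B (by norm_num) x⟩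
    | c α => exact ⟨1, c_mem B (by norm_num) α⟩
    | b α => exact ⟨1, b_mem B (by norm_num) α⟩
  have : X ∈ filtAlg ℂ (gen B) (weight B) := h ▸ Algebra.mem_top
  exact this

/-- This holds on all of `g`, although `Ĵ` respects brackets only on `g_0 ⊕ g_+`: the commutator of
the `J` parts is a single `J`, and products of two quadratic parts weigh `4`. -/
lemma Jhat_commutator_mem (x y : G μ) : Jhat x * Jhat y - Jhat y * Jhat x ∈ fil B 4 := by
  have h : Jhat x * Jhat y - Jhat y * Jhat x =
      J ⁅x, y⁆ + (quad x * quad y - quad y * quad x) := by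
    simp only [Jhat_eq, J_lie, mul_add, add_mul, J_mul_quad]
    abel
  rw [h]
  exact Submodule.add_mem _ (J_mem B le_rfl _) (Submodule.sub_mem _
    (mul_mem_filt (quad_mem B le_rfl _) (quad_mem B le_rfl _) le_rfl)
    (mul_mem_filt (quad_mem B le_rfl _) (quad_mem B le_rfl _) le_rfl))

lemma Jhat_c (x : G μ) (β : Pos μ) :
    Jhat x * c β - c β * Jhat x = -∑ γ : Pos μ, upCoeff ⁅x, tUp γ⁆ β • c γ := by
  rw [← c_lie_quad, Jhat_eq, add_mul, mul_add, J_mul_c]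
  abel

lemma Jhat_b (x : G μ) (β : Pos μ) : Jhat x * b β - b β * Jhat x = bv ⁅x, prM (tUp β)⁆ := by
  rw [← bv_lie_quad, Jhat_eq, add_mul, mul_add, J_mul_b, bv_tUp]
  abel

lemma even_odd_commutator_mem {z z' : Letter μ B.rank} (h : Even B z) (h' : Odd B z') :
    gen B z * gen B z' - gen B z' * gen B z ∈ fil B 1 := by
  obtain ⟨r, hr⟩ := gen_even B h
  have h1 : gen B z * gen B z' - gen B z' * gen B z =
      Jhat (vec B z) * gen B z' - gen B z' * Jhat (vec B z) := by
    rw [hr]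
    simp only [sub_mul, mul_sub, smul_mul_assoc, mul_smul_comm, one_mul, mul_one]
    abel
  rw [h1]
  cases h' with
  | gh α =>
    change Jhat _ * c α - c α * Jhat _ ∈ _
    rw [Jhat_c]
    exact Submodule.neg_mem _ (Submodule.sum_mem _ fun γ _ => Submodule.smul_mem _ _
      (c_mem B le_rfl γ))
  | anti α =>
    change Jhat _ * b α - b α * Jhat _ ∈ _
    rw [Jhat_b]
    exact bv_mem B le_rfl _

lemma almostComm : AlmostComm ℂ (gen B) (weight B) := by
  intro z z'
  rcases even_or_odd B z with h | h <;> rcases even_or_odd B z' with h' | h'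
  · refine ⟨1, one_ne_zero, ?_⟩
    obtain ⟨r, hr⟩ := gen_even B h
    obtain ⟨r', hr'⟩ := gen_even B h'
    have h1 : gen B z * gen B z' - (1 : ℂ) • (gen B z' * gen B z) =
        Jhat (vec B z) * Jhat (vec B z') - Jhat (vec B z') * Jhat (vec B z) := by
      rw [hr, hr', one_smul]
      simp only [sub_mul, mul_sub, smul_mul_assoc, mul_smul_comm, one_mul, mul_one, smul_sub]
      rw [smul_comm r r']
      abel
    rw [h1]
    have := weight_even B h
    have := weight_even B h'
    exact filt_mono (by omega) (Jhat_commutator_mem B _ _)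
  · refine ⟨1, one_ne_zero, ?_⟩
    rw [one_smul]
    have := weight_even B h
    have := weight_odd B h'
    exact filt_mono (by omega) (even_odd_commutator_mem B h h')
  · refine ⟨1, one_ne_zero, ?_⟩
    rw [one_smul, ← neg_sub (gen B z' * gen B z)]
    have := weight_odd B h
    have := weight_even B h'
    refine Submodule.neg_mem _ (filt_mono ?_ (even_odd_commutator_mem B h' h))
    omega
  · refine ⟨-1, by norm_num, ?_⟩
    rw [weight_odd B h, weight_odd B h', neg_smul, one_smul, sub_neg_eq_add]
    cases h with
    | gh α =>
      cases h' with
      | gh β => simp [gen, c_mul_c α β]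
      | anti β =>
        simp only [gen]
        rw [add_comm (c α * b β), b_mul_c_add]
        exact Submodule.smul_mem _ _ (one_mem_filt (by norm_num))
    | anti α =>
      cases h' with
      | gh β =>
        simp only [gen]
        rw [b_mul_c_add]
        exact Submodule.smul_mem _ _ (one_mem_filt (by norm_num))
      | anti β => simp [gen, b_mul_b α β]

lemma c_mul_self (α : Pos μ) : c α * c α = 0 := by
  have h := c_mul_c α α
  rw [eq_neg_iff_add_eq_zero, ← two_smul ℂ] at h
  exact (smul_eq_zero.1 h).resolve_left two_ne_zero

lemma b_mul_self (α : Pos μ) : b α * b α = 0 := by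
  have h := b_mul_b α α
  rw [eq_neg_iff_add_eq_zero, ← two_smul ℂ] at h
  exact (smul_eq_zero.1 h).resolve_left two_ne_zero

lemma odd_mul_self {z : Letter μ B.rank} (h : Odd B z) : gen B z * gen B z = 0 := by
  cases h with
  | gh α => exact c_mul_self α
  | anti α => exact b_mul_self α

lemma parity_gen (z : Letter μ B.rank) : ∃ ε : ℂ, parity μ (gen B z) = ε • gen B z := by
  cases z with
  | zero z => exact ⟨1, by rw [gen, parity_Jhat, one_smul]⟩
  | plus α => exact ⟨1, by rw [gen, parity_Jhat, one_smul]⟩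
  | gh α => exact ⟨-1, by rw [gen, parity_c, neg_one_smul]⟩
  | minus α => exact ⟨1, by rw [gen, D, map_sub, parity_Jhat, map_smul, map_one, one_smul]⟩
  | anti α => exact ⟨-1, by rw [gen, parity_b, neg_one_smul]⟩

lemma parity_even {z : Letter μ B.rank} (h : Even B z) : parity μ (gen B z) = gen B z := by
  obtain ⟨r, hr⟩ := gen_even B h
  rw [hr, map_sub, parity_Jhat, map_smul, map_one]

lemma parity_odd {z : Letter μ B.rank} (h : Odd B z) : parity μ (gen B z) = -gen B z := by
  cases h with
  | gh α => exact parity_c α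
  | anti α => exact parity_b α

/-- The letter conjugate to a ghost or antighost. -/
def conj : Letter μ B.rank → Letter μ B.rank
  | gh α => anti α
  | anti α => gh α
  | z => z

lemma conj_odd {z : Letter μ B.rank} (h : Odd B z) : Odd B (conj B z) := by
  cases h <;> constructor

open Classical in
lemma conj_anticomm {z z' : Letter μ B.rank} (h : Odd B z) (h' : Odd B z') :
    gen B (conj B z) * gen B z' + gen B z' * gen B (conj B z) =
      if z' = z then (1 : Om μ) else 0 := by
  cases h with
  | gh α =>
    cases h' with
    | gh β =>
      simp only [conj, gen, b_mul_c_add, gh.injEq, eq_comm (a := β)]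
      split_ifs <;> simp
    | anti β => simp [conj, gen, b_mul_b α β]
  | anti α =>
    cases h' with
    | gh β => simp [conj, gen, c_mul_c α β]
    | anti β =>
      simp only [conj, gen, add_comm (c α * b β), b_mul_c_add, anti.injEq]
      split_ifs <;> simp

/-- The conjugate of a ghost anticommutes with all ghosts and antighosts except its partner. Its
commutator with an even letter reduces a weight of at least `3` to `1`, which is below the leading
term. -/
lemma isLowering_odd {z : Letter μ B.rank} (h : Odd B z) :
    IsLowering ℂ (gen B) (weight B) (Odd B) (fun _ => True) (gradedComm (gen B (conj B z)))
      (-(weight B z : ℤ)) z 1 := by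
  refine ⟨by simp [gradedComm_one], one_mem_filt (by simp), fun h' => absurd h h', ?_⟩
  intro z' _
  obtain ⟨ε, hε⟩ := parity_gen B z'
  refine ⟨ε, fun _ h' => absurd h h', fun L _ => ?_⟩
  have e (a b c : Om μ) : a + b - c - b = a - c := by abel
  rw [gradedComm_mul, hε, smul_mul_assoc, e, weight_odd B h, gradedComm_apply]
  rcases even_or_odd B z' with h' | h'
  · rw [if_neg (by rintro rfl; exact not_odd_of_even B h' h), sub_zero, parity_even B h']
    have := weight_even B h'
    refine mul_mem_filt (n := 1) ?_ (prod_mem_filt le_rfl) (by omega)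
    rw [← neg_sub]
    exact Submodule.neg_mem _ (even_odd_commutator_mem B h' (conj_odd B h))
  · rw [parity_odd B h', neg_mul, sub_neg_eq_add, conj_anticomm B h h', ite_mul, zero_mul, sub_self]
    exact Submodule.zero_mem _

/-- The error term loses an even letter `z'` and at least `3` more, together at least `6`, whereas
deleting `z` costs at most `4`. -/
lemma isLowering_even {z : Letter μ B.rank} (h : Even B z) {ℓ : Mat μ →ₗ[ℂ] ℂ}
    (hℓ : ∀ x : G μ, ℓ x.1 = dual B z x) :
    IsLowering ℂ (gen B) (weight B) (Odd B) (fun _ => True) (lower ℓ) (-(weight B z : ℤ)) z 1 := by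
  refine ⟨by simp [lower_one], one_mem_filt (by simp), fun _ => by simp, ?_⟩
  intro z' _
  refine ⟨1, fun _ _ => rfl, fun L _ => ?_⟩
  have e (a b c : Om μ) : a + b + c - a - c = b := by abel
  rw [lower_gen_mul, hℓ, dual_vec B h, one_smul, one_mul, ite_smul, one_smul, zero_smul, e]
  rcases even_or_odd B z' with h' | h'
  · have := weight_even B h
    have := weight_even B h'
    exact filt_mono (by omega) (lower_mem B (prod_mem_filt le_rfl) _)
  · have h0 : ℓ ∘ₗ LinearMap.mulLeft ℂ (vec B z').1 = 0 := by
      ext1 m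
      rw [vec_odd B h']
      change ℓ (0 * m) = 0
      rw [zero_mul, map_zero]
    rw [h0, lower_zero]
    exact Submodule.zero_mem _

lemma exists_lowering (z : Letter μ B.rank) : ∃ T : Om μ →ₗ[ℂ] Om μ,
    IsLowering ℂ (gen B) (weight B) (Odd B) (fun _ => True) T (-(weight B z : ℤ)) z 1 := by
  rcases even_or_odd B z with h | h
  · obtain ⟨ℓ, hℓ⟩ := LinearMap.exists_extend (p := (G μ).toSubmodule) (dual B z)
    exact ⟨lower ℓ, isLowering_even B h fun x => LinearMap.congr_fun hℓ x⟩
  · exact ⟨_, isLowering_odd B h⟩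

/-- The letters in the order `Ĵ`, `c`, and then `D`, `b` alternatingly. -/
def key : Letter μ B.rank → ℕ
  | zero z => z
  | plus α => B.rank + Fintype.equivFin (Pos μ) α
  | gh α => B.rank + Fintype.card (Pos μ) + Fintype.equivFin (Pos μ) α
  | minus α => B.rank + 2 * Fintype.card (Pos μ) + 2 * Fintype.equivFin (Pos μ) α
  | anti α => B.rank + 2 * Fintype.card (Pos μ) + 2 * Fintype.equivFin (Pos μ) α + 1

lemma key_injective : Function.Injective (key B) := by
  intro z z' h
  have hlt (α : Pos μ) : (Fintype.equivFin (Pos μ) α : ℕ) < Fintype.card (Pos μ) := Fin.is_lt _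
  have heq (α β : Pos μ)
      (h : (Fintype.equivFin (Pos μ) α : ℕ) = Fintype.equivFin (Pos μ) β) : α = β :=
    (Fintype.equivFin (Pos μ)).injective (Fin.ext h)
  cases z with
  | zero z =>
    have h1 := z.2
    cases z' with
    | zero z' => simp only [key] at h; rw [Fin.ext h]
    | plus β | gh β | minus β | anti β => simp only [key] at h; omega
  | plus α =>
    have h1 := hlt α
    cases z' with
    | zero z' => have h2 := z'.2; simp only [key] at h; omega
    | plus β => simp only [key] at h; rw [heq α β (by omega)]
    | gh β | minus β | anti β => simp only [key] at h; omega
  | gh α =>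
    have h1 := hlt α
    cases z' with
    | zero z' => have h2 := z'.2; simp only [key] at h; omega
    | gh β => simp only [key] at h; rw [heq α β (by omega)]
    | plus β | minus β | anti β => have h2 := hlt β; simp only [key] at h; omega
  | minus α =>
    have h1 := hlt α
    cases z' with
    | zero z' => have h2 := z'.2; simp only [key] at h; omega
    | minus β => simp only [key] at h; rw [heq α β (by omega)]
    | plus β | gh β | anti β => have h2 := hlt β; simp only [key] at h; omega
  | anti α =>
    have h1 := hlt α
    cases z' with
    | zero z' => have h2 := z'.2; simp only [key] at h; omega
    | anti β => simp only [key] at h; rw [heq α β (by omega)]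
    | plus β | gh β | minus β => have h2 := hlt β; simp only [key] at h; omega

instance : LinearOrder (Letter μ B.rank) := LinearOrder.lift' (key B) (key_injective B)

lemma le_iff_key {z z' : Letter μ B.rank} : z ≤ z' ↔ key B z ≤ key B z' := Iff.rfl

/-- The ordering of multisets of letters by `key`. -/
def ord : Ordering (Letter μ B.rank) where
  toList m := m.sort
  coe_toList m := m.sort_eq _

/-- The ordered monomials in the generators. -/
abbrev mono (m : Multiset (Letter μ B.rank)) : Om μ := word (ord B) (gen B) m

/-- The multisets of letters in which ghosts and antighosts occur at most once. -/
abbrev IsAdm (m : Multiset (Letter μ B.rank)) : Prop := Adm (Odd B) m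

lemma linearIndependent_mono :
    LinearIndependent ℂ fun m : {m : Multiset (Letter μ B.rank) // IsAdm B m} => mono B m.1 :=
  linearIndependent_word (almostComm B) (weight_pos B) (fun z => (exists_lowering B z).choose)
    fun z => (exists_lowering B z).choose_spec

lemma sum_mono_eq_zero (n : ℕ) (t : Finset (Multiset (Letter μ B.rank)))
    (a : Multiset (Letter μ B.rank) → ℂ) (ht : ∀ m ∈ t, IsAdm B m ∧ wt (weight B) m = n)
    (h : ∑ m ∈ t, a m • mono B m ∈ fil B ((n : ℤ) - 1)) : ∀ m ∈ t, a m = 0 :=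
  sum_word_eq_zero_of_mem_filt (almostComm B) (weight_pos B)
    (fun z => (exists_lowering B z).choose) (fun z => (exists_lowering B z).choose_spec) n t a ht h

lemma fil_le_span_mono (n : ℤ) :
    fil B n ≤ Submodule.span ℂ (mono B '' {m | IsAdm B m ∧ (wt (weight B) m : ℤ) ≤ n}) :=
  filt_le_span_word (almostComm B)
    (fun z h => by rw [odd_mul_self B h]; exact Submodule.zero_mem _) n

/-- The basis of `Ω` of ordered monomials. -/
def omBasis : Module.Basis {m : Multiset (Letter μ B.rank) // IsAdm B m} ℂ (Om μ) :=
  Module.Basis.mk (linearIndependent_mono B) (by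
    intro X _
    obtain ⟨n, hn⟩ := exists_mem_fil B X
    refine Submodule.span_mono ?_ (fil_le_span_mono B n hn)
    rintro _ ⟨m, hm, rfl⟩
    exact ⟨⟨m, hm.1⟩, rfl⟩)

lemma omBasis_apply (m) : omBasis B m = mono B m.1 := by
  rw [omBasis, Module.Basis.mk_apply]

end Letter

/-! Projections onto ghost numbers. -/

section ghostNumber

variable {μ : YoungDiagram}

/-- The operator whose adjoint action is the ghost number. -/
def ghostNumber (μ : YoungDiagram) : Om μ := ∑ α : Pos μ, c α * b α

lemma ghostNumber_gen (X : Om μ) (k : ℤ) (h : HasDeg X k) :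
    ghostNumber μ * X - X * ghostNumber μ = Int.castAddHom ℂ k • X := by
  rw [ghostNumber, Finset.sum_mul, Finset.mul_sum, ← Finset.sum_sub_distrib]
  cases h with
  | J x =>
    refine (Finset.sum_eq_zero fun α _ => ?_).trans (by simp)
    rw [← mul_assoc (J x), J_mul_c, mul_assoc (c α) (J x), J_mul_b, mul_assoc, sub_self]
  | c β =>
    have h2 (α : Pos μ) : c α * b α * c β - c β * (c α * b α) = if α = β then c α else 0 := by
      rw [mul_assoc, b_mul_c, mul_sub, ← mul_assoc (c α), ← mul_assoc (c β), c_mul_c β α]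
      split_ifs <;> simp
    simp [h2]
  | b β =>
    have h2 (α : Pos μ) : c α * b α * b β - b β * (c α * b α) = -if α = β then b α else 0 := by
      rw [← mul_assoc (b β), b_mul_c, sub_mul, mul_assoc (c α), mul_assoc (c α), b_mul_b β α]
      by_cases h : α = β
      · simp [h]
      · simp [h, Ne.symm h]
    simp [h2]

lemma ghostNumber_comm {X : Om μ} {k : ℤ} (h : X ∈ Odeg μ k) :
    ghostNumber μ * X - X * ghostNumber μ = (k : ℂ) • X := by
  have h1 := piece_le_eigenspace (ghostNumber μ) (Int.castAddHom ℂ) ghostNumber_gen k h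
  rwa [Module.End.mem_eigenspace_iff] at h1

lemma J_mem_Odeg (x : G μ) : J x ∈ Odeg μ 0 := gen_mem_piece (HasDeg.J x)

lemma c_mem_Odeg (α : Pos μ) : c α ∈ Odeg μ 1 := gen_mem_piece (HasDeg.c α)

lemma b_mem_Odeg (α : Pos μ) : b α ∈ Odeg μ (-1) := gen_mem_piece (HasDeg.b α)

lemma mul_mem_Odeg {i j k : ℤ} {X Y : Om μ} (hX : X ∈ Odeg μ i) (hY : Y ∈ Odeg μ j)
    (h : i + j = k) : X * Y ∈ Odeg μ k := h ▸ mul_mem_piece hX hY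

lemma bv_mem_Odeg (y : G μ) : bv y ∈ Odeg μ (-1) := by
  rw [bv_apply]
  exact Submodule.sum_mem _ fun γ _ => Submodule.smul_mem _ _ (b_mem_Odeg γ)

lemma quad_mem_Odeg (y : G μ) : quad y ∈ Odeg μ 0 := by
  rw [quad_apply]
  exact Submodule.sum_mem _ fun γ _ => mul_mem_Odeg (bv_mem_Odeg _) (c_mem_Odeg γ) (by norm_num)

lemma Jhat_mem_Odeg (x : G μ) : Jhat x ∈ Odeg μ 0 := by
  rw [Jhat_eq]
  exact Submodule.add_mem _ (J_mem_Odeg x) (quad_mem_Odeg x)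

lemma Q_mem_Odeg : Q0 μ + Q1 μ ∈ Odeg μ 1 := by
  refine Submodule.add_mem _ ?_ ?_
  · rw [Q0_eq]
    refine Submodule.sub_mem _ (Submodule.sum_mem _ fun α _ => ?_)
      (Submodule.smul_mem _ _ (Submodule.sum_mem _ fun α _ => Submodule.sum_mem _ fun β _ => ?_))
    · exact mul_mem_Odeg (J_mem_Odeg _) (c_mem_Odeg α) (by norm_num)
    · exact mul_mem_Odeg (bv_mem_Odeg _)
        (mul_mem_Odeg (c_mem_Odeg α) (c_mem_Odeg β) rfl) (by norm_num)
  · exact Submodule.neg_mem _ (Submodule.sum_mem _ fun α _ => Submodule.smul_mem _ _ (c_mem_Odeg α))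

lemma d_mem_Odeg {X : Om μ} {k : ℤ} (h : X ∈ Odeg μ k) : d μ X ∈ Odeg μ (k + 1) := by
  rw [d_apply_of_mem h]
  exact Submodule.sub_mem _ (mul_mem_Odeg Q_mem_Odeg h (add_comm _ _))
    (Submodule.smul_mem _ _ (mul_mem_Odeg h Q_mem_Odeg rfl))

end ghostNumber

/-! ### Ghost numbers of the ordered monomials. -/

namespace Letter

variable {μ : YoungDiagram} (B : AdaptedBasis μ)

/-- The ghost number of a letter. -/
def deg : Letter μ B.rank → ℤ
  | gh _ => 1
  | anti _ => -1
  | _ => 0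

/-- The ghost number of an ordered monomial. -/
def mdeg (m : Multiset (Letter μ B.rank)) : ℤ := (m.map (deg B)).sum

lemma gen_mem_Odeg (z : Letter μ B.rank) : gen B z ∈ Odeg μ (deg B z) := by
  cases z with
  | zero z => exact Jhat_mem_Odeg _
  | plus α => exact Jhat_mem_Odeg _
  | gh α => exact c_mem_Odeg α
  | minus α => exact Submodule.sub_mem _ (Jhat_mem_Odeg _) (Submodule.smul_mem _ _ one_mem_piece)
  | anti α => exact b_mem_Odeg α

lemma mono_mem_Odeg (m : Multiset (Letter μ B.rank)) : mono B m ∈ Odeg μ (mdeg B m) := by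
  have key : ∀ L : List (Letter μ B.rank),
      (L.map (gen B)).prod ∈ Odeg μ (L.map (deg B)).sum := by
    intro L
    induction L with
    | nil => exact one_mem_piece
    | cons z L ih =>
      simp only [List.map_cons, List.prod_cons, List.sum_cons]
      exact mul_mem_Odeg (gen_mem_Odeg B z) ih rfl
  have h := key ((ord B).toList m)
  have h2 : (((ord B).toList m).map (deg B)).sum = mdeg B m := by
    rw [mdeg]
    conv_rhs => rw [← (ord B).coe_toList m]
    simp
  rwa [h2] at h

/-- A coordinate functional is an eigenvector for the adjoint action of `ghostNumber`, with the
ghost number of its monomial as eigenvalue, so it vanishes on the other eigenspaces. -/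
lemma repr_eq_zero {X : Om μ} {k : ℤ} (h : X ∈ Odeg μ k)
    (m : {m : Multiset (Letter μ B.rank) // IsAdm B m}) (hm : mdeg B m.1 ≠ k) :
    (omBasis B).repr X m = 0 := by
  let A : Om μ →ₗ[ℂ] Om μ := LinearMap.mulLeft ℂ (ghostNumber μ) - LinearMap.mulRight ℂ (ghostNumber μ)
  have h1 : (omBasis B).coord m ∘ₗ A = (mdeg B m.1 : ℂ) • (omBasis B).coord m := by
    refine (omBasis B).ext fun m' => ?_
    have h2 : A (omBasis B m') = (mdeg B m'.1 : ℂ) • omBasis B m' := by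
      rw [omBasis_apply]
      exact ghostNumber_comm (mono_mem_Odeg B m'.1)
    rw [LinearMap.comp_apply, h2, map_smul, LinearMap.smul_apply, Module.Basis.coord_apply,
      Module.Basis.repr_self]
    by_cases h : m' = m
    · rw [h]
    · simp [Finsupp.single_eq_of_ne (Ne.symm h)]
  have h3 := LinearMap.congr_fun h1 X
  have h4 : A X = (k : ℂ) • X := ghostNumber_comm h
  rw [LinearMap.comp_apply, h4, map_smul, LinearMap.smul_apply, smul_eq_mul, smul_eq_mul,
    ← sub_eq_zero, ← sub_mul, mul_eq_zero, sub_eq_zero, Int.cast_inj] at h3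
  exact h3.resolve_left (Ne.symm hm)

/-- The projection onto the elements of ghost number `k`. -/
def degProj (k : ℤ) : Om μ →ₗ[ℂ] Om μ :=
  (omBasis B).constr ℂ fun m => if mdeg B m.1 = k then mono B m.1 else 0

lemma degProj_mono {m : Multiset (Letter μ B.rank)} (hm : IsAdm B m) (k : ℤ) :
    degProj B k (mono B m) = if mdeg B m = k then mono B m else 0 := by
  have := (omBasis B).constr_basis ℂ (fun m => if mdeg B m.1 = k then mono B m.1 else 0) ⟨m, hm⟩
  rwa [omBasis_apply] at this

lemma degProj_of_mem {X : Om μ} {k : ℤ} (h : X ∈ Odeg μ k) (j : ℤ) :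
    degProj B j X = if j = k then X else 0 := by
  have h1 := (omBasis B).linearCombination_repr X
  rw [Finsupp.linearCombination_apply, Finsupp.sum] at h1
  have h2 : ∀ m ∈ ((omBasis B).repr X).support, mdeg B m.1 = k := by
    intro m hm
    by_contra hne
    exact (Finsupp.mem_support_iff.1 hm) (repr_eq_zero B h m hne)
  conv_lhs => rw [← h1]
  rw [map_sum]
  split_ifs with hj
  · conv_rhs => rw [← h1]
    refine Finset.sum_congr rfl fun m hm => ?_
    rw [map_smul, omBasis_apply, degProj_mono B m.2, if_pos ((h2 m hm).trans hj.symm)]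
  · refine Finset.sum_eq_zero fun m hm => ?_
    rw [map_smul, omBasis_apply, degProj_mono B m.2, if_neg (by rw [h2 m hm]; exact Ne.symm hj),
      smul_zero]

lemma degProj_mem (k : ℤ) (X : Om μ) : degProj B k X ∈ Odeg μ k := by
  have h : X ∈ (Odeg μ k).comap (degProj B k) := by
    refine (?_ : (⊤ : Submodule ℂ (Om μ)) ≤ _) trivial
    rw [← (omBasis B).span_eq, Submodule.span_le]
    rintro _ ⟨m, rfl⟩
    rw [SetLike.mem_coe, Submodule.mem_comap, omBasis_apply, degProj_mono B m.2]
    split_ifs with h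
    · exact h ▸ mono_mem_Odeg B m.1
    · exact Submodule.zero_mem _
  exact h

/-- The contractions produce cochains without a definite ghost number; by this identity they can be
cut down to a single one. -/
lemma d_degProj (k : ℤ) (X : Om μ) : d μ (degProj B k X) = degProj B (k + 1) (d μ X) := by
  have h : d μ ∘ₗ degProj B k = degProj B (k + 1) ∘ₗ d μ := by
    refine (omBasis B).ext fun m => ?_
    rw [LinearMap.comp_apply, LinearMap.comp_apply, omBasis_apply, degProj_mono B m.2,
      degProj_of_mem B (d_mem_Odeg (mono_mem_Odeg B m.1))]
    by_cases hk : mdeg B m.1 = k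
    · rw [if_pos hk, if_pos (by rw [hk])]
    · rw [if_neg hk, if_neg (by omega), map_zero]
  exact LinearMap.congr_fun h X

end Letter

/-! Contraction of the pairs `D^α`, `b^α`. -/

section koszul

variable {μ : YoungDiagram}

/-- The products of elements of `P` with a power of `x` and possibly `y`. -/
def adjoinPair (P : Submodule ℂ (Om μ)) (x y : Om μ) : Submodule ℂ (Om μ) :=
  Submodule.span ℂ {X | ∃ u ∈ P, ∃ k : ℕ, X = u * x ^ k ∨ X = u * x ^ k * y}

/-- A contraction of `adjoinPair P x y` onto `P`, where `x = d y`. -/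
structure Contraction (P : Submodule ℂ (Om μ)) (x y : Om μ) where
  homotopy : Om μ →ₗ[ℂ] Om μ
  proj : Om μ →ₗ[ℂ] Om μ
  homotopy_base : ∀ u ∈ P, homotopy u = 0
  -- The parity enters because `d (u x^k y) = (d u) x^k y + (parity u) x^(k+1)`.
  homotopy_even : ∀ u ∈ P, ∀ k, homotopy (u * x ^ (k + 1)) = parity μ u * x ^ k * y
  homotopy_odd : ∀ u ∈ P, ∀ k, homotopy (u * x ^ k * y) = 0
  proj_base : ∀ u ∈ P, proj u = u
  proj_even : ∀ u ∈ P, ∀ k, proj (u * x ^ (k + 1)) = 0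
  proj_odd : ∀ u ∈ P, ∀ k, proj (u * x ^ k * y) = 0

variable {P : Submodule ℂ (Om μ)} {x y : Om μ}

lemma d_pow (hx : d μ x = 0) (k : ℕ) : d μ (x ^ k) = 0 := by
  induction k with
  | zero => rw [pow_zero, d_one]
  | succ k ih => rw [pow_succ, d_mul, ih, hx, zero_mul, mul_zero, add_zero]

/-- Only the order of the factors matters: `x` and `y` stand to the right of `P` and need not
commute with it or with each other. On `u x^(k+1)` the two terms containing `d u` cancel, as `d`
anticommutes with the parity. -/
lemma Contraction.spec (C : Contraction P x y) (hd : ∀ u ∈ P, d μ u ∈ P)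
    (hp : ∀ u ∈ P, parity μ u ∈ P) (hx : d μ x = 0) (hx' : parity μ x = x) (hy : d μ y = x)
    (X : Om μ) (hX : X ∈ adjoinPair P x y) :
    d μ X ∈ adjoinPair P x y ∧ C.proj X ∈ P ∧
      d μ (C.homotopy X) + C.homotopy (d μ X) = X - C.proj X ∧
      C.proj (d μ X) = d μ (C.proj X) := by
  induction hX using Submodule.span_induction with
  | zero => simp
  | add X Y _ _ h1 h2 =>
    obtain ⟨a1, a2, a3, a4⟩ := h1
    obtain ⟨b1, b2, b3, b4⟩ := h2
    refine ⟨?_, ?_, ?_, ?_⟩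
    · rw [map_add]; exact Submodule.add_mem _ a1 b1
    · rw [map_add]; exact Submodule.add_mem _ a2 b2
    · rw [map_add, map_add, map_add, map_add, map_add, add_sub_add_comm, ← a3, ← b3]
      abel
    · rw [map_add, map_add, map_add, map_add, a4, b4]
  | smul r X _ h1 =>
    obtain ⟨a1, a2, a3, a4⟩ := h1
    refine ⟨?_, ?_, ?_, ?_⟩
    · rw [map_smul]; exact Submodule.smul_mem _ _ a1
    · rw [map_smul]; exact Submodule.smul_mem _ _ a2
    · rw [map_smul, map_smul, map_smul, map_smul, map_smul, ← smul_add, a3, smul_sub]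
    · rw [map_smul, map_smul, map_smul, map_smul, a4]
  | mem X hX =>
    obtain ⟨u, hu, k, rfl | rfl⟩ := hX
    · have h1 : d μ (u * x ^ k) = d μ u * x ^ k := by
        rw [d_mul, d_pow hx, mul_zero, add_zero]
      rw [h1]
      refine ⟨Submodule.subset_span ⟨_, hd u hu, k, Or.inl rfl⟩, ?_⟩
      cases k with
      | zero =>
        rw [pow_zero, mul_one, mul_one, C.proj_base u hu, C.homotopy_base u hu,
          C.homotopy_base _ (hd u hu), C.proj_base _ (hd u hu)]
        exact ⟨hu, by simp, rfl⟩
      | succ k =>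
        rw [C.proj_even u hu, C.homotopy_even u hu, C.homotopy_even _ (hd u hu),
          C.proj_even _ (hd u hu), d_mul, d_mul, d_pow hx, hy, map_mul, map_pow, hx',
          parity_parity, parity_d, map_zero, pow_succ]
        refine ⟨Submodule.zero_mem _, ?_, rfl⟩
        noncomm_ring
    · have h1 : d μ (u * x ^ k * y) = d μ u * x ^ k * y + parity μ u * x ^ (k + 1) := by
        rw [d_mul, d_mul, d_pow hx, hy, map_mul, map_pow, hx', mul_zero, add_zero, pow_succ,
          mul_assoc (parity μ u)]
      rw [h1]
      refine ⟨Submodule.add_mem _ (Submodule.subset_span ⟨_, hd u hu, k, Or.inr rfl⟩)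
        (Submodule.subset_span ⟨_, hp u hu, k + 1, Or.inl rfl⟩), ?_⟩
      rw [C.proj_odd u hu, C.homotopy_odd u hu, map_add, C.homotopy_odd _ (hd u hu),
        C.homotopy_even _ (hp u hu), map_add, C.proj_odd _ (hd u hu), C.proj_even _ (hp u hu),
        parity_parity]
      refine ⟨Submodule.zero_mem _, ?_, ?_⟩ <;> simp

end koszul

/-! ### Peeling the pairs `D^α`, `b^α` off the ordered monomials. -/

namespace Letter

variable {μ : YoungDiagram} (B : AdaptedBasis μ)

/-- The least key of the letters `D^α`, `b^α` beyond the first `i` pairs. -/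
def bound (i : ℕ) : ℕ := B.rank + 2 * Fintype.card (Pos μ) + 2 * i

/-- The span of the ordered monomials in the letters below `bound i`. -/
def stage (i : ℕ) : Submodule ℂ (Om μ) :=
  Submodule.span ℂ (mono B '' {m | IsAdm B m ∧ ∀ z ∈ m, key B z < bound B i})

lemma mono_mem_stage {m : Multiset (Letter μ B.rank)} {i : ℕ} (h : IsAdm B m)
    (h' : ∀ z ∈ m, key B z < bound B i) : mono B m ∈ stage B i :=
  Submodule.subset_span ⟨m, ⟨h, h'⟩, rfl⟩

lemma sort_add {m m' : Multiset (Letter μ B.rank)} (h : ∀ z ∈ m, ∀ z' ∈ m', z ≤ z') :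
    (m + m').sort = m.sort ++ m'.sort := by
  refine List.Perm.eq_of_pairwise' (r := (· ≤ ·)) (Multiset.pairwise_sort _ _) ?_ ?_
  · rw [List.pairwise_append]
    refine ⟨Multiset.pairwise_sort _ _, Multiset.pairwise_sort _ _, fun z hz z' hz' => ?_⟩
    exact h z ((Multiset.mem_sort _).1 hz) z' ((Multiset.mem_sort _).1 hz')
  · rw [← Multiset.coe_eq_coe, ← Multiset.coe_add, Multiset.sort_eq, Multiset.sort_eq,
      Multiset.sort_eq]

lemma mono_add {m m' : Multiset (Letter μ B.rank)} (h : ∀ z ∈ m, ∀ z' ∈ m', z ≤ z') :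
    mono B (m + m') = mono B m * mono B m' := by
  change (((m + m').sort).map (gen B)).prod = _
  rw [sort_add B h, List.map_append, List.prod_append]
  rfl

lemma mono_replicate (k : ℕ) (z : Letter μ B.rank) :
    mono B (Multiset.replicate k z) = gen B z ^ k := by
  have h : (Multiset.replicate k z).sort = List.replicate k z := by
    refine List.eq_replicate_iff.2 ⟨by simp, fun v hv => ?_⟩
    exact Multiset.eq_of_mem_replicate ((Multiset.mem_sort _).1 hv)
  change ((Multiset.replicate k z).sort.map (gen B)).prod = _
  rw [h, List.map_replicate, List.prod_replicate]

lemma adm_iff [DecidableEq (Letter μ B.rank)] {m : Multiset (Letter μ B.rank)} :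
    IsAdm B m ↔ ∀ z, Odd B z → m.count z ≤ 1 := by
  refine forall₂_congr fun z _ => ?_
  rw [← Multiset.le_count_iff_replicate_le]
  omega

section pair

variable (α : Pos μ)

/-- The position of `α` in the enumeration of the positive indices. -/
def idx : ℕ := Fintype.equivFin (Pos μ) α

lemma key_minus : key B (minus α) = bound B (idx α) := rfl

lemma key_anti : key B (anti α) = bound B (idx α) + 1 := rfl

lemma bound_succ (i : ℕ) : bound B (i + 1) = bound B i + 2 := by rw [bound, bound]; ring

-- Between `bound B (idx α)` and `bound B (idx α + 1)` there are just two keys, those of `minus α`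
-- and `anti α`.
open Classical in
lemma split_multiset {m : Multiset (Letter μ B.rank)}
    (h : ∀ z ∈ m, key B z < bound B (idx α + 1)) :
    m = m.filter (fun z => key B z < bound B (idx α)) + Multiset.replicate (m.count (minus α)) (minus α) +
      Multiset.replicate (m.count (anti α)) (anti α) := by
  refine Multiset.ext.2 fun z => ?_
  rw [Multiset.count_add, Multiset.count_add, Multiset.count_filter, Multiset.count_replicate,
    Multiset.count_replicate]
  by_cases hz : z ∈ m
  · have h1 := h z hz
    rw [bound_succ] at h1
    by_cases h2 : z = minus α
    · subst h2; simp [key_minus]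
    · by_cases h3 : z = anti α
      · subst h3; simp [key_anti]
      · have h4 : key B z ≠ bound B (idx α) := fun h => h2 (key_injective B h)
        have h5 : key B z ≠ bound B (idx α) + 1 := fun h => h3 (key_injective B h)
        rw [if_pos (by omega), if_neg (Ne.symm h2), if_neg (Ne.symm h3), add_zero,
          add_zero]
  · have h1 : m.count z = 0 := Multiset.count_eq_zero_of_notMem hz
    rw [h1]
    by_cases h2 : z = minus α
    · subst h2; simp [h1]
    · by_cases h3 : z = anti α
      · subst h3; simp [h1]
      · simp [Ne.symm h2, Ne.symm h3]

lemma mono_pair {m : Multiset (Letter μ B.rank)} (h : ∀ z ∈ m, key B z < bound B (idx α))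
    (k e : ℕ) : mono B (m + Multiset.replicate k (minus α) + Multiset.replicate e (anti α)) =
      mono B m * D α ^ k * b α ^ e := by
  rw [mono_add, mono_add, mono_replicate, mono_replicate]
  · rfl
  · intro z hz z' hz'
    rw [Multiset.eq_of_mem_replicate hz', le_iff_key, key_minus]
    exact (h z hz).le
  · intro z hz z' hz'
    rw [Multiset.eq_of_mem_replicate hz', le_iff_key, key_anti]
    rcases Multiset.mem_add.1 hz with hz | hz
    · exact (h z hz).le.trans (Nat.le_succ _)
    · rw [Multiset.eq_of_mem_replicate hz, key_minus]
      exact Nat.le_succ _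

lemma adm_pair {m : Multiset (Letter μ B.rank)} (h : ∀ z ∈ m, key B z < bound B (idx α))
    (hm : IsAdm B m) (k e : ℕ) (he : e ≤ 1) :
    IsAdm B (m + Multiset.replicate k (minus α) + Multiset.replicate e (anti α)) := by
  classical
  rw [adm_iff] at hm ⊢
  intro z hz
  rw [Multiset.count_add, Multiset.count_add, Multiset.count_replicate, Multiset.count_replicate]
  rw [if_neg (by rintro rfl; cases hz)]
  split_ifs with h1
  · subst h1
    rw [Multiset.count_eq_zero_of_notMem fun h2 => by
      have := h _ h2
      rw [key_anti] at this
      omega]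
    omega
  · simpa using hm z hz

lemma pair_lt {m : Multiset (Letter μ B.rank)} (h : ∀ z ∈ m, key B z < bound B (idx α))
    (k e : ℕ) : ∀ z ∈ m + Multiset.replicate k (minus α) + Multiset.replicate e (anti α),
      key B z < bound B (idx α + 1) := by
  intro z hz
  rw [bound_succ]
  rcases Multiset.mem_add.1 hz with hz | hz
  · rcases Multiset.mem_add.1 hz with hz | hz
    · have := h z hz
      omega
    · rw [Multiset.eq_of_mem_replicate hz, key_minus]
      omega
  · rw [Multiset.eq_of_mem_replicate hz, key_anti]
    omega

/-- The new letters `D^α`, `b^α` have the two largest keys, so they stand at the right end of a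
sorted monomial, in this order, and `b^α` occurs at most once because it is odd. -/
lemma stage_succ : stage B (idx α + 1) = adjoinPair (stage B (idx α)) (D α) (b α) := by
  classical
  refine le_antisymm (Submodule.span_le.2 ?_) (Submodule.span_le.2 ?_)
  · rintro _ ⟨m, ⟨hm, hm'⟩, rfl⟩
    have h1 : ∀ z ∈ m.filter (fun z => key B z < bound B (idx α)), key B z < bound B (idx α) :=
      fun z hz => (Multiset.mem_filter.1 hz).2
    have h2 : mono B (m.filter (fun z => key B z < bound B (idx α))) ∈ stage B (idx α) :=
      mono_mem_stage B (fun z hz h => hm z hz (h.trans (Multiset.filter_le _ _))) h1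
    rw [split_multiset B α hm', mono_pair B α h1]
    have h3 := (adm_iff B).1 hm (anti α) (by constructor)
    rcases Nat.le_one_iff_eq_zero_or_eq_one.1 h3 with h4 | h4
    · rw [h4, pow_zero, mul_one]
      exact Submodule.subset_span ⟨_, h2, _, Or.inl rfl⟩
    · rw [h4, pow_one]
      exact Submodule.subset_span ⟨_, h2, _, Or.inr rfl⟩
  · rintro _ ⟨u, hu, k, rfl | rfl⟩
    · induction hu using Submodule.span_induction with
      | zero => simp
      | add u v _ _ h1 h2 => rw [add_mul]; exact Submodule.add_mem _ h1 h2
      | smul r u _ h1 => rw [smul_mul_assoc]; exact Submodule.smul_mem _ _ h1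
      | mem u hu =>
        obtain ⟨m, ⟨hm, hm'⟩, rfl⟩ := hu
        have h1 := mono_pair B α hm' k 0
        rw [pow_zero, mul_one] at h1
        rw [← h1]
        exact mono_mem_stage B (adm_pair B α hm' hm k 0 (by norm_num)) (pair_lt B α hm' k 0)
    · induction hu using Submodule.span_induction with
      | zero => simp
      | add u v _ _ h1 h2 => rw [add_mul, add_mul]; exact Submodule.add_mem _ h1 h2
      | smul r u _ h1 =>
        rw [smul_mul_assoc, smul_mul_assoc]; exact Submodule.smul_mem _ _ h1
      | mem u hu =>
        obtain ⟨m, ⟨hm, hm'⟩, rfl⟩ := hu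
        have h1 := mono_pair B α hm' k 1
        rw [pow_one] at h1
        rw [← h1]
        exact mono_mem_stage B (adm_pair B α hm' hm k 1 le_rfl) (pair_lt B α hm' k 1)

lemma linear_ext_stage {i : ℕ} {f g : Om μ →ₗ[ℂ] Om μ}
    (h : ∀ m, IsAdm B m → (∀ z ∈ m, key B z < bound B i) → f (mono B m) = g (mono B m))
    {u : Om μ} (hu : u ∈ stage B i) : f u = g u := by
  refine LinearMap.eqOn_span (s := mono B '' {m | IsAdm B m ∧ ∀ z ∈ m, key B z < bound B i}) ?_ hu
  rintro _ ⟨m, ⟨hm, hm'⟩, rfl⟩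
  exact h m hm hm'

open Classical in
/-- The contraction of the pair `D^α`, `b^α`. -/
def contraction : Contraction (stage B (idx α)) (D α) (b α) := by
  -- Both maps are prescribed on the monomial basis. Their values on monomials with letters beyond
  -- the pair of `α` are immaterial.
  let f : {m : Multiset (Letter μ B.rank) // IsAdm B m} → Om μ := fun m =>
    if 0 < m.1.count (minus α) ∧ m.1.count (anti α) = 0 then
      parity μ (mono B (m.1.filter fun z => key B z < bound B (idx α))) *
        D α ^ (m.1.count (minus α) - 1) * b α else 0
  let f' : {m : Multiset (Letter μ B.rank) // IsAdm B m} → Om μ := fun m =>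
    if m.1.count (minus α) = 0 ∧ m.1.count (anti α) = 0 then mono B m.1 else 0
  have hf (m) (hm : IsAdm B m) : (omBasis B).constr ℂ f (mono B m) = f ⟨m, hm⟩ := by
    have := (omBasis B).constr_basis ℂ f ⟨m, hm⟩
    rwa [omBasis_apply] at this
  have hf' (m) (hm : IsAdm B m) : (omBasis B).constr ℂ f' (mono B m) = f' ⟨m, hm⟩ := by
    have := (omBasis B).constr_basis ℂ f' ⟨m, hm⟩
    rwa [omBasis_apply] at this
  have hc {m : Multiset (Letter μ B.rank)} (h : ∀ z ∈ m, key B z < bound B (idx α)) :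
      m.count (minus α) = 0 ∧ m.count (anti α) = 0 := by
    refine ⟨Multiset.count_eq_zero_of_notMem fun h2 => ?_,
      Multiset.count_eq_zero_of_notMem fun h2 => ?_⟩
    · have := h _ h2
      rw [key_minus] at this
      omega
    · have := h _ h2
      rw [key_anti] at this
      omega
  have hcp {m : Multiset (Letter μ B.rank)} (h : ∀ z ∈ m, key B z < bound B (idx α)) (k e : ℕ) :
      (m + Multiset.replicate k (minus α) + Multiset.replicate e (anti α)).count (minus α) = k ∧
      (m + Multiset.replicate k (minus α) + Multiset.replicate e (anti α)).count (anti α) = e ∧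
      (m + Multiset.replicate k (minus α) + Multiset.replicate e (anti α)).filter
        (fun z => key B z < bound B (idx α)) = m := by
    refine ⟨?_, ?_, ?_⟩
    · simp [Multiset.count_replicate, (hc h).1]
    · simp [Multiset.count_replicate, (hc h).2]
    · rw [Multiset.filter_add, Multiset.filter_add, Multiset.filter_eq_self.2 h,
        Multiset.filter_eq_nil.2, Multiset.filter_eq_nil.2, add_zero, add_zero]
      · intro z hz
        rw [Multiset.eq_of_mem_replicate hz, key_anti]
        omega
      · intro z hz
        rw [Multiset.eq_of_mem_replicate hz, key_minus]
        omega
  refine ⟨(omBasis B).constr ℂ f, (omBasis B).constr ℂ f', fun u hu => ?_, fun u hu k => ?_,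
    fun u hu k => ?_, fun u hu => ?_, fun u hu k => ?_, fun u hu k => ?_⟩
  · refine linear_ext_stage B (g := 0) (fun m hm hm' => ?_) hu
    rw [hf m hm, LinearMap.zero_apply]
    exact if_neg fun h => h.1.ne' (hc hm').1
  · refine linear_ext_stage B (f := (omBasis B).constr ℂ f ∘ₗ LinearMap.mulRight ℂ (D α ^ (k + 1)))
      (g := LinearMap.mulRight ℂ (b α) ∘ₗ LinearMap.mulRight ℂ (D α ^ k) ∘ₗ (parity μ).toLinearMap)
      (fun m hm hm' => ?_) hu
    have h1 := mono_pair B α hm' (k + 1) 0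
    rw [pow_zero, mul_one] at h1
    simp only [LinearMap.comp_apply, LinearMap.mulRight_apply, AlgHom.toLinearMap_apply]
    rw [← h1, hf _ (adm_pair B α hm' hm _ _ (by norm_num))]
    obtain ⟨e1, e2, e3⟩ := hcp hm' (k + 1) 0
    simp only [f, e1, e2, e3]
    simp
  · refine linear_ext_stage B (f := (omBasis B).constr ℂ f ∘ₗ LinearMap.mulRight ℂ (b α) ∘ₗ
      LinearMap.mulRight ℂ (D α ^ k)) (g := 0) (fun m hm hm' => ?_) hu
    have h1 := mono_pair B α hm' k 1
    rw [pow_one] at h1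
    simp only [LinearMap.comp_apply, LinearMap.mulRight_apply, LinearMap.zero_apply]
    rw [← h1, hf _ (adm_pair B α hm' hm _ _ le_rfl)]
    obtain ⟨e1, e2, e3⟩ := hcp hm' k 1
    simp only [f, e1, e2, e3]
    simp
  · refine linear_ext_stage B (g := LinearMap.id) (fun m hm hm' => ?_) hu
    rw [hf' m hm, LinearMap.id_apply]
    exact if_pos (hc hm')
  · refine linear_ext_stage B (f := (omBasis B).constr ℂ f' ∘ₗ LinearMap.mulRight ℂ (D α ^ (k + 1)))
      (g := 0) (fun m hm hm' => ?_) hu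
    have h1 := mono_pair B α hm' (k + 1) 0
    rw [pow_zero, mul_one] at h1
    simp only [LinearMap.comp_apply, LinearMap.mulRight_apply, LinearMap.zero_apply]
    rw [← h1, hf' _ (adm_pair B α hm' hm _ _ (by norm_num))]
    obtain ⟨e1, e2, e3⟩ := hcp hm' (k + 1) 0
    simp only [f', e1, e2]
    simp
  · refine linear_ext_stage B (f := (omBasis B).constr ℂ f' ∘ₗ LinearMap.mulRight ℂ (b α) ∘ₗ
      LinearMap.mulRight ℂ (D α ^ k)) (g := 0) (fun m hm hm' => ?_) hu
    have h1 := mono_pair B α hm' k 1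
    rw [pow_one] at h1
    simp only [LinearMap.comp_apply, LinearMap.mulRight_apply, LinearMap.zero_apply]
    rw [← h1, hf' _ (adm_pair B α hm' hm _ _ le_rfl)]
    obtain ⟨e1, e2, e3⟩ := hcp hm' k 1
    simp only [f', e1, e2]
    simp

end pair

lemma parity_mem_stage {i : ℕ} {u : Om μ} (hu : u ∈ stage B i) : parity μ u ∈ stage B i := by
  induction hu using Submodule.span_induction with
  | zero => simp
  | add u v _ _ h1 h2 => rw [map_add]; exact Submodule.add_mem _ h1 h2
  | smul r u _ h1 => rw [map_smul]; exact Submodule.smul_mem _ _ h1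
  | mem u hu =>
    obtain ⟨m, ⟨hm, hm'⟩, rfl⟩ := hu
    rw [parity_apply_of_mem (mono_mem_Odeg B m)]
    exact Submodule.smul_mem _ _ (mono_mem_stage B hm hm')

lemma parity_D (α : Pos μ) : parity μ (D α) = D α := by
  rw [D, map_sub, parity_Jhat, map_smul, map_one]

lemma stage_card : stage B (Fintype.card (Pos μ)) = ⊤ := by
  rw [eq_top_iff, ← (omBasis B).span_eq]
  refine Submodule.span_mono ?_
  rintro _ ⟨m, rfl⟩
  refine ⟨m.1, ⟨m.2, fun z _ => ?_⟩, (omBasis_apply B m).symm⟩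
  have hlt (α : Pos μ) : (Fintype.equivFin (Pos μ) α : ℕ) < Fintype.card (Pos μ) := Fin.is_lt _
  cases z with
  | zero z => have := z.2; simp only [key, bound]; omega
  | plus α | gh α | minus α | anti α => have := hlt α; simp only [key, bound]; omega

lemma stage_mono {i j : ℕ} (h : i ≤ j) : stage B i ≤ stage B j := by
  refine Submodule.span_mono (Set.image_mono ?_)
  rintro m ⟨h1, h2⟩
  exact ⟨h1, fun z hz => (h2 z hz).trans_le (by rw [bound, bound]; omega)⟩

/-- Every `D^α`, `b^α` pair can be contracted. -/
lemma stage_quasi_iso (h0 : ∀ u ∈ stage B 0, d μ u ∈ stage B 0) (i : ℕ)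
    (hi : i ≤ Fintype.card (Pos μ)) :
    (∀ u ∈ stage B i, d μ u ∈ stage B i) ∧
    (∀ X ∈ stage B i, d μ X = 0 → ∃ x ∈ stage B 0, d μ x = 0 ∧ ∃ Y, X = x + d μ Y) ∧
    (∀ X ∈ stage B 0, ∀ Y ∈ stage B i, d μ Y = X → ∃ Y' ∈ stage B 0, d μ Y' = X) := by
  induction i with
  | zero =>
    exact ⟨h0, fun X hX hd => ⟨X, hX, hd, 0, by simp⟩, fun X _ Y hY h => ⟨Y, hY, h⟩⟩
  | succ i ih =>
    obtain ⟨ih1, ih2, ih3⟩ := ih (by omega)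
    obtain ⟨α, rfl⟩ : ∃ α : Pos μ, idx α = i :=
      ⟨(Fintype.equivFin (Pos μ)).symm ⟨i, hi⟩, by simp [idx]⟩
    have key := (contraction B α).spec ih1 (fun u hu => parity_mem_stage B hu) (d_D α)
      (parity_D α) (d_b α)
    rw [← stage_succ] at key
    refine ⟨fun u hu => (key u hu).1, fun X hX hdX => ?_, fun X hX Y hY h => ?_⟩
    -- The homotopy applied to the cocycle `X` is a primitive of `X - proj X`, and `proj X` is a
    -- cocycle one stage lower.
    · obtain ⟨-, k2, k3, k4⟩ := key X hX
      rw [hdX, map_zero, add_zero] at k3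
      rw [hdX, map_zero] at k4
      obtain ⟨x, hx, hd, Y, hY⟩ := ih2 _ k2 k4.symm
      refine ⟨x, hx, hd, Y + (contraction B α).homotopy X, ?_⟩
      rw [map_add, k3, ← add_assoc, ← hY]
      abel
    -- The projection commutes with `d` and fixes the lower stages, so it carries the primitive of
    -- `X` one stage down.
    · obtain ⟨-, k2, -, k4⟩ := key Y hY
      refine ih3 X hX _ k2 ?_
      rw [← k4, h]
      exact (contraction B α).proj_base X (stage_mono B (Nat.zero_le _) hX)

end Letter

/-! The reduced algebra and the enveloping algebra of `g_0 ⊕ g_+`. -/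

namespace Letter

variable {μ : YoungDiagram} (B : AdaptedBasis μ)

section restrict

variable (q : Letter μ B.rank → Prop)

/-- The ordering of the letters with a given property. -/
def subOrd : Ordering {z : Letter μ B.rank // q z} where
  toList m := m.sort
  coe_toList m := m.sort_eq _

lemma map_sort_val (m : Multiset {z : Letter μ B.rank // q z}) :
    m.sort.map Subtype.val = (m.map Subtype.val).sort :=
  Multiset.map_sort _ _ _ _ fun _ _ _ _ => Iff.rfl

lemma word_subOrd (m : Multiset {z : Letter μ B.rank // q z}) :
    word (subOrd B q) (fun z => gen B z.1) m = mono B (m.map Subtype.val) := by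
  change ((m.sort).map fun z => gen B z.1).prod = (((m.map Subtype.val).sort).map (gen B)).prod
  rw [← map_sort_val, List.map_map]
  rfl

lemma adm_map_val {m : Multiset {z : Letter μ B.rank // q z}} (h : Adm (fun z => Odd B z.1) m) :
    IsAdm B (m.map Subtype.val) := by
  intro z hz h2
  have h3 : z ∈ m.map Subtype.val := Multiset.mem_of_le h2 (by simp)
  obtain ⟨z', -, rfl⟩ := Multiset.mem_map.1 h3
  refine h z' hz ?_
  rwa [← Multiset.map_replicate, Multiset.map_le_map_iff Subtype.val_injective] at h2

end restrict

/-- The letters that generate the reduced algebra. -/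
def Red (z : Letter μ B.rank) : Prop := key B z < bound B 0

/-- The letters that belong to a basis of `g_0 ⊕ g_+`. -/
inductive Par : Letter μ B.rank → Prop
  | zero (z) : Par (zero z)
  | plus (α : Pos μ) : Par (plus α)

lemma Par.even {z : Letter μ B.rank} (h : Par B z) : Even B z := by
  cases h <;> constructor

lemma Par.vec_mem {z : Letter μ B.rank} (h : Par B z) : vec B z ∈ gNonneg μ := by
  cases h with
  | zero z => exact grade_zero_le (B.basis z).2
  | plus α => exact tLow_mem α

lemma Par.gen_eq {z : Letter μ B.rank} (h : Par B z) : gen B z = Jhat (vec B z) := by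
  cases h <;> rfl

lemma idx_lt (α : Pos μ) : (Fintype.equivFin (Pos μ) α : ℕ) < Fintype.card (Pos μ) := Fin.is_lt _

lemma red_iff {z : Letter μ B.rank} : Red B z ↔ Par B z ∨ ∃ α, z = gh α := by
  cases z with
  | zero z =>
    have := z.2
    exact ⟨fun _ => Or.inl (Par.zero z), fun _ => by simp only [Red, key, bound]; omega⟩
  | plus α =>
    have := idx_lt α
    exact ⟨fun _ => Or.inl (Par.plus α), fun _ => by simp only [Red, key, bound]; omega⟩
  | gh α =>
    have := idx_lt α
    exact ⟨fun _ => Or.inr ⟨α, rfl⟩, fun _ => by simp only [Red, key, bound]; omega⟩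
  | minus α =>
    refine ⟨fun h => by simp only [Red, key, bound] at h; omega, ?_⟩
    rintro (h | ⟨_, h⟩) <;> cases h
  | anti α =>
    refine ⟨fun h => by simp only [Red, key, bound] at h; omega, ?_⟩
    rintro (h | ⟨_, h⟩) <;> cases h

/-- The generators of the reduced algebra. -/
abbrev redGen (z : {z : Letter μ B.rank // Red B z}) : Om μ := gen B z.1

/-- The weights of the generators of the reduced algebra. -/
abbrev redWeight (z : {z : Letter μ B.rank // Red B z}) : ℕ := weight B z.1

lemma gen_mem_red {z : Letter μ B.rank} (h : Red B z) {n : ℤ} (hn : (weight B z : ℤ) ≤ n) :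
    gen B z ∈ filt ℂ (redGen B) (redWeight B) n :=
  gen_mem_filt (g := redGen B) (w := redWeight B) (z := ⟨z, h⟩) hn

lemma Jhat_mem_red {x : G μ} (hx : x ∈ gNonneg μ) {n : ℤ} (h : 4 ≤ n) :
    Jhat x ∈ filt ℂ (redGen B) (redWeight B) n := by
  rw [Jhat_eq_sum B]
  refine Submodule.add_mem _ (Submodule.add_mem _ ?_ ?_) ?_
  · exact Submodule.sum_mem _ fun z _ => Submodule.smul_mem _ _
      (gen_mem_red B ((red_iff B).2 (Or.inl (Par.zero z)))
        (by have := (weight_even B (Even.zero z)).2; omega))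
  · exact Submodule.sum_mem _ fun γ _ => Submodule.smul_mem _ _
      (gen_mem_red B ((red_iff B).2 (Or.inl (Par.plus γ)))
        (by have := (weight_even B (Even.plus γ)).2; omega))
  · simp only [upCoeff_eq_zero hx, zero_smul, Finset.sum_const_zero]
    exact Submodule.zero_mem _

lemma c_mem_red (α : Pos μ) {n : ℤ} (h : 1 ≤ n) : c α ∈ filt ℂ (redGen B) (redWeight B) n :=
  gen_mem_red B ((red_iff B).2 (Or.inr ⟨α, rfl⟩)) h

lemma par_gh_commutator {z : Letter μ B.rank} (h : Par B z) (α : Pos μ) {n : ℤ} (hn : 1 ≤ n) :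
    gen B z * gen B (gh α) - gen B (gh α) * gen B z ∈ filt ℂ (redGen B) (redWeight B) n := by
  rw [h.gen_eq]
  change Jhat _ * c α - c α * Jhat _ ∈ _
  rw [Jhat_c]
  exact Submodule.neg_mem _ (Submodule.sum_mem _ fun γ _ => Submodule.smul_mem _ _
    (c_mem_red B γ hn))

lemma almostComm_red : AlmostComm ℂ (redGen B) (redWeight B) := by
  rintro ⟨z, hz⟩ ⟨z', hz'⟩
  rcases (red_iff B).1 hz with h | ⟨α, rfl⟩ <;> rcases (red_iff B).1 hz' with h' | ⟨β, rfl⟩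
  · refine ⟨1, one_ne_zero, ?_⟩
    rw [one_smul, redGen, redGen, h.gen_eq, h'.gen_eq, ← Jhat_lie h.vec_mem h'.vec_mem]
    refine Jhat_mem_red B ((gNonneg μ).lie_mem h.vec_mem h'.vec_mem) ?_
    have := weight_even B h.even
    have := weight_even B h'.even
    simp only [redWeight]
    omega
  · refine ⟨1, one_ne_zero, ?_⟩
    rw [one_smul]
    refine par_gh_commutator B h β ?_
    have := weight_even B h.even
    simp only [redWeight]
    omega
  · refine ⟨1, one_ne_zero, ?_⟩
    rw [one_smul, ← neg_sub (gen B z' * gen B (gh α))]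
    refine Submodule.neg_mem _ (par_gh_commutator B h' α ?_)
    have := weight_even B h'.even
    simp only [redWeight]
    omega
  · refine ⟨-1, by norm_num, ?_⟩
    have : gen B (gh α) * gen B (gh β) = -(gen B (gh β) * gen B (gh α)) := c_mul_c α β
    simp [redGen, this]

/-- Sorting never leaves the reduced letters: `g_0 ⊕ g_+` is a subalgebra on which `Ĵ` respects
brackets, and the commutator of `Ĵ(x)` with a ghost `c_α` is a combination of ghosts `c_γ`. The
spanning argument thus works inside the filtration by reduced letters alone. -/
lemma Ored_le_stage : (Ored μ).toSubmodule ≤ stage B 0 := by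
  have h1 : Ored μ ≤ filtAlg ℂ (redGen B) (redWeight B) := by
    refine Algebra.adjoin_le ?_
    rintro _ (⟨k, hk, x, hx, rfl⟩ | ⟨α, rfl⟩)
    · exact ⟨4, Jhat_mem_red B (grade_le_gNonneg hk hx) (by norm_num)⟩
    · exact ⟨1, c_mem_red B α (by norm_num)⟩
  intro X hX
  obtain ⟨n, hn⟩ := h1 hX
  refine (filt_le_span_word (o := subOrd B (Red B)) (odd := fun z => Odd B z.1) (almostComm_red B)
    (fun z h => ?_) n).trans (Submodule.span_le.2 ?_) hn
  · have : redGen B z * redGen B z = 0 := odd_mul_self B h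
    rw [this]
    exact Submodule.zero_mem _
  · rintro _ ⟨m, hm, rfl⟩
    have hw : word (subOrd B (Red B)) (redGen B) m = mono B (m.map Subtype.val) :=
      word_subOrd B _ m
    rw [SetLike.mem_coe, hw]
    refine mono_mem_stage B (adm_map_val B _ hm.1) fun z hz => ?_
    obtain ⟨z', -, rfl⟩ := Multiset.mem_map.1 hz
    exact z'.2

lemma Jhat_mem_Ored {x : G μ} (hx : x ∈ gNonneg μ) : Jhat x ∈ Ored μ := by
  rw [← sum_gradeProj x, map_sum]
  refine Subalgebra.sum_mem _ fun m _ => ?_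
  by_cases hm : 0 ≤ m
  · exact Algebra.subset_adjoin (Or.inl ⟨m, hm, _, gradeProj_mem m x, rfl⟩)
  · have h : gradeProj m x = 0 := by
      refine Subtype.ext (Matrix.ext fun a e => ?_)
      change (if _ then x.1 a e else 0) = (0 : ℂ)
      split_ifs with h
      · exact hx a e (by omega)
      · rfl
    rw [h, map_zero]
    exact Subalgebra.zero_mem _

lemma c_mem_Ored (α : Pos μ) : c α ∈ Ored μ := Algebra.subset_adjoin (Or.inr ⟨α, rfl⟩)

lemma stage_zero : stage B 0 = (Ored μ).toSubmodule := by
  refine le_antisymm (Submodule.span_le.2 ?_) (Ored_le_stage B)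
  rintro _ ⟨m, ⟨-, hm⟩, rfl⟩
  refine Subalgebra.list_prod_mem _ fun X hX => ?_
  obtain ⟨z, hz, rfl⟩ := List.mem_map.1 hX
  rw [← Multiset.mem_coe, (ord B).coe_toList] at hz
  rcases (red_iff B).1 (hm z hz) with h | ⟨α, rfl⟩
  · rw [h.gen_eq]
    exact Jhat_mem_Ored h.vec_mem
  · exact c_mem_Ored α

end Letter

/-! ### The differential on `Ω_red`, and the map from `U(g_0 ⊕ g_+)`. -/

section reduced

variable {μ : YoungDiagram}

lemma parity_mem_Ored {X : Om μ} (hX : X ∈ Ored μ) : parity μ X ∈ Ored μ := by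
  obtain ⟨B⟩ := AdaptedBasis.nonempty μ
  rw [← Subalgebra.mem_toSubmodule, ← Letter.stage_zero B] at hX ⊢
  exact Letter.parity_mem_stage B hX

lemma d_mem_Ored {X : Om μ} (hX : X ∈ Ored μ) : d μ X ∈ Ored μ := by
  induction hX using Algebra.adjoin_induction with
  | mem X hX =>
    rcases hX with ⟨k, hk, x, hx, rfl⟩ | ⟨α, rfl⟩
    · rw [d_eq, d0_Jhat, d1_Jhat]
      refine Subalgebra.add_mem _ (Subalgebra.sum_mem _ fun α _ => ?_)
        (Subalgebra.neg_mem _ (Subalgebra.sum_mem _ fun α _ => ?_))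
      · exact Subalgebra.mul_mem _ (Letter.Jhat_mem_Ored (prP_mem _)) (Letter.c_mem_Ored α)
      · exact Subalgebra.smul_mem _ (Letter.c_mem_Ored α) _
    · rw [d_eq, d0_c, d1_c, add_zero]
      exact Subalgebra.neg_mem _ (Subalgebra.smul_mem _ (Subalgebra.sum_mem _ fun β _ =>
        Subalgebra.sum_mem _ fun γ _ => Subalgebra.smul_mem _
          (Subalgebra.mul_mem _ (Letter.c_mem_Ored β) (Letter.c_mem_Ored γ)) _) _)
  | algebraMap r =>
    rw [Algebra.algebraMap_eq_smul_one, map_smul, d_one, smul_zero]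
    exact Subalgebra.zero_mem _
  | add X Y _ _ h1 h2 => rw [map_add]; exact Subalgebra.add_mem _ h1 h2
  | mul X Y hX hY h1 h2 =>
    rw [d_mul]
    exact Subalgebra.add_mem _ (Subalgebra.mul_mem _ h1 hY)
      (Subalgebra.mul_mem _ (parity_mem_Ored hX) h2)

/-- The enveloping algebra of `g_0 ⊕ g_+`. -/
abbrev Up (μ : YoungDiagram) : Type := UniversalEnvelopingAlgebra ℂ (gNonneg μ)

/-- `Ĵ` as a Lie algebra homomorphism on `g_0 ⊕ g_+`. -/
def JhatLie (μ : YoungDiagram) : gNonneg μ →ₗ⁅ℂ⁆ Om μ where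
  toLinearMap := Jhat ∘ₗ (gNonneg μ).toSubmodule.subtype
  map_lie' := by
    intro x y
    exact Jhat_lie x.2 y.2

/-- The extension of `Ĵ` to the enveloping algebra of `g_0 ⊕ g_+`. -/
def JP (μ : YoungDiagram) : Up μ →ₐ[ℂ] Om μ := UniversalEnvelopingAlgebra.lift ℂ (JhatLie μ)

lemma JP_ι (x : gNonneg μ) : JP μ (UniversalEnvelopingAlgebra.ι ℂ x) = Jhat x.1 :=
  UniversalEnvelopingAlgebra.lift_ι_apply ℂ (JhatLie μ) x

/-- An induction principle for the enveloping algebra. -/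
lemma enveloping_subalgebra_eq_top {L : Type*} [LieRing L] [LieAlgebra ℂ L]
    (S : Subalgebra ℂ (UniversalEnvelopingAlgebra ℂ L))
    (h : ∀ x, UniversalEnvelopingAlgebra.ι ℂ x ∈ S) : S = ⊤ := by
  let f : L →ₗ⁅ℂ⁆ S :=
    { ((UniversalEnvelopingAlgebra.ι ℂ : L →ₗ⁅ℂ⁆ UniversalEnvelopingAlgebra ℂ L).toLinearMap).codRestrict
        (Subalgebra.toSubmodule S) h with
      map_lie' := by
        intro x y
        exact Subtype.ext ((UniversalEnvelopingAlgebra.ι ℂ).map_lie x y) }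
  have h : S.val.comp (UniversalEnvelopingAlgebra.lift ℂ f) =
      AlgHom.id ℂ (UniversalEnvelopingAlgebra ℂ L) := by
    refine UniversalEnvelopingAlgebra.hom_ext (R := ℂ) (L := L) ?_
    ext x
    change (UniversalEnvelopingAlgebra.lift ℂ f (UniversalEnvelopingAlgebra.ι ℂ x)).1 = _
    rw [UniversalEnvelopingAlgebra.lift_ι_apply]
    rfl
  refine eq_top_iff.2 fun u _ => ?_
  have := congrArg (fun g => g u) h
  change (UniversalEnvelopingAlgebra.lift ℂ f u).1 = u at this
  rw [← this]
  exact Subtype.property _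

end reduced

/-! ### Ordered monomials in `U(g_0 ⊕ g_+)`. -/

namespace Letter

variable {μ : YoungDiagram} (B : AdaptedBasis μ)

/-- The generators of the enveloping algebra of `g_0 ⊕ g_+`. -/
def parGen (z : {z : Letter μ B.rank // Par B z}) : Up μ :=
  UniversalEnvelopingAlgebra.ι ℂ ⟨vec B z.1, z.2.vec_mem⟩

lemma JP_parGen (z : {z : Letter μ B.rank // Par B z}) : JP μ (parGen B z) = gen B z.1 := by
  rw [parGen, JP_ι, z.2.gen_eq]

lemma ι_mem_filt (x : gNonneg μ) :
    (UniversalEnvelopingAlgebra.ι ℂ x : Up μ) ∈ filt ℂ (parGen B) (fun _ => 1) 1 := by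
  have h1 : x = ∑ z, B.basis.repr (prZ x.1) z •
        (⟨vec B (zero z), (Par.zero z).vec_mem⟩ : gNonneg μ) +
      ∑ γ : Pos μ, lowFun γ x.1 • (⟨vec B (plus γ), (Par.plus γ).vec_mem⟩ : gNonneg μ) := by
    refine Subtype.ext ?_
    have h2 : (prZ x.1).1 = ∑ z, B.basis.repr (prZ x.1) z • (B.basis z).1 := by
      have h3 := congrArg (gZero μ).toSubmodule.subtype (B.basis.sum_repr (prZ x.1))
      rw [map_sum] at h3
      exact h3.symm
    have h4 := decompose_g x.1
    simp only [upCoeff_eq_zero x.2, zero_smul, Finset.sum_const_zero, add_zero] at h4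
    refine h4.trans ?_
    rw [h2]
    refine Eq.trans ?_ (map_add (gNonneg μ).toSubmodule.subtype _ _).symm
    rw [map_sum, map_sum]
    rfl
  rw [h1, map_add, map_sum, map_sum]
  refine Submodule.add_mem _ (Submodule.sum_mem _ fun z _ => ?_) (Submodule.sum_mem _ fun γ _ => ?_)
  · rw [map_smul]
    exact Submodule.smul_mem _ _ (gen_mem_filt (g := parGen B) (w := fun _ => 1)
      (z := ⟨zero z, Par.zero z⟩) (by norm_num))
  · rw [map_smul]
    exact Submodule.smul_mem _ _ (gen_mem_filt (g := parGen B) (w := fun _ => 1)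
      (z := ⟨plus γ, Par.plus γ⟩) (by norm_num))

/-- The ordered monomials in the enveloping algebra of `g_0 ⊕ g_+`. -/
abbrev parMono (m : Multiset {z : Letter μ B.rank // Par B z}) : Up μ :=
  word (subOrd B (Par B)) (parGen B) m

lemma JP_parMono (m : Multiset {z : Letter μ B.rank // Par B z}) :
    JP μ (parMono B m) = mono B (m.map Subtype.val) := by
  rw [← word_subOrd, parMono, word, map_list_prod, List.map_map, word]
  refine congrArg (fun f => (List.map f _).prod) (funext fun z => ?_)
  exact JP_parGen B z

lemma isAdm_par (m : Multiset {z : Letter μ B.rank // Par B z}) : IsAdm B (m.map Subtype.val) :=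
  adm_map_val B _ fun z h => absurd h (not_odd_of_even B z.2.even)

/-- Here all letters get weight `1`: a bracket of two letters is linear in the letters, so it is one
unit lighter than their product. -/
lemma span_parMono : Submodule.span ℂ (Set.range (parMono B)) = ⊤ := by
  have h1 : filtAlg ℂ (parGen B) (fun _ => 1) = ⊤ :=
    enveloping_subalgebra_eq_top _ fun x => ⟨1, ι_mem_filt B x⟩
  refine eq_top_iff.2 fun u _ => ?_
  have h2 : u ∈ filtAlg ℂ (parGen B) (fun _ => 1) := h1 ▸ Algebra.mem_top
  obtain ⟨n, hn⟩ := h2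
  refine Submodule.span_mono (Set.image_subset_range _ _)
    (filt_le_span_word (o := subOrd B (Par B)) (odd := fun _ => False) (fun z z' => ?_)
      (fun z h => h.elim) n hn)
  refine ⟨1, one_ne_zero, ?_⟩
  have h3 := ι_mem_filt B ⁅(⟨vec B z.1, z.2.vec_mem⟩ : gNonneg μ), ⟨vec B z'.1, z'.2.vec_mem⟩⁆
  rw [LieHom.map_lie, LieRing.of_associative_ring_bracket] at h3
  rw [one_smul]
  exact h3

lemma linearIndependent_JP_parMono : LinearIndependent ℂ fun m => JP μ (parMono B m) := by
  have h := (linearIndependent_mono B).comp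
    (fun m : Multiset {z : Letter μ B.rank // Par B z} => ⟨m.map Subtype.val, isAdm_par B m⟩) (by
      intro m m' h
      exact Multiset.map_injective Subtype.val_injective (congrArg Subtype.val h))
  convert h using 1
  exact funext fun m => JP_parMono B m

lemma mono_mem_range {m : Multiset (Letter μ B.rank)} (h : ∀ z ∈ m, Par B z) :
    mono B m ∈ (JP μ).range := by
  refine Subalgebra.list_prod_mem _ fun X hX => ?_
  obtain ⟨z, hz, rfl⟩ := List.mem_map.1 hX
  rw [← Multiset.mem_coe, (ord B).coe_toList] at hz
  exact ⟨_, JP_parGen B ⟨z, h z hz⟩⟩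

end Letter

/-! ### Cohomology of degree `0` computed in `Ω_red`. -/

section reduced

variable {μ : YoungDiagram}

/-- The ordered monomials span `U(g_0 ⊕ g_+)`, and their images are distinct members of the monomial
basis of `Ω`. -/
lemma JP_injective : Function.Injective (JP μ) := by
  obtain ⟨B⟩ := AdaptedBasis.nonempty μ
  rw [injective_iff_map_eq_zero]
  intro u hu
  have h1 : u ∈ Submodule.span ℂ (Set.range (Letter.parMono B)) := by
    rw [Letter.span_parMono]; trivial
  obtain ⟨a, rfl⟩ := Finsupp.mem_span_range_iff_exists_finsupp.1 h1
  have h2 := linearIndependent_iff.1 (Letter.linearIndependent_JP_parMono B) a (by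
    rw [Finsupp.linearCombination_apply, ← hu, map_finsuppSum]
    simp only [map_smul])
  rw [h2, Finsupp.sum_zero_index]

lemma JP_mem_Odeg (u : Up μ) : JP μ u ∈ Odeg μ 0 := by
  let S : Subalgebra ℂ (Up μ) :=
    { carrier := {u | JP μ u ∈ Odeg μ 0}
      mul_mem' := fun {u v} hu hv => by
        change JP μ (u * v) ∈ Odeg μ 0
        rw [map_mul]
        exact mul_mem_Odeg hu hv rfl
      add_mem' := fun {u v} hu hv => by
        change JP μ (u + v) ∈ Odeg μ 0
        rw [map_add]
        exact Submodule.add_mem _ hu hv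
      algebraMap_mem' := fun r => by
        change JP μ (algebraMap ℂ (Up μ) r) ∈ Odeg μ 0
        rw [Algebra.algebraMap_eq_smul_one, map_smul, map_one]
        exact Submodule.smul_mem _ _ one_mem_piece }
  have h : S = ⊤ := enveloping_subalgebra_eq_top S fun x => by
    change JP μ (UniversalEnvelopingAlgebra.ι ℂ x) ∈ Odeg μ 0
    rw [JP_ι]
    exact Jhat_mem_Odeg _
  have : u ∈ S := h ▸ Algebra.mem_top
  exact this

lemma JP_mem_Ored (u : Up μ) : JP μ u ∈ Ored μ := by
  have h : (Ored μ).comap (JP μ) = ⊤ := enveloping_subalgebra_eq_top _ fun x => by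
    rw [Subalgebra.mem_comap, JP_ι]
    exact Letter.Jhat_mem_Ored x.2
  have : u ∈ (Ored μ).comap (JP μ) := h ▸ Algebra.mem_top
  exact this

/-- Reduced letters have ghost number `0` or `1`. Hence degree `-1` is empty, and a monomial of
degree `0` contains no `c_α`, which leaves only products of `Ĵ(x)` with `x ∈ g_0 ⊕ g_+`. -/
lemma degProj_stage_zero (B : AdaptedBasis μ) {X : Om μ} (hX : X ∈ Letter.stage B 0) :
    (∃ u, JP μ u = Letter.degProj B 0 X) ∧ Letter.degProj B (-1) X = 0 := by
  induction hX using Submodule.span_induction with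
  | zero => exact ⟨⟨0, by simp⟩, by simp⟩
  | add X Y _ _ h1 h2 =>
    obtain ⟨⟨u, hu⟩, h1⟩ := h1
    obtain ⟨⟨v, hv⟩, h2⟩ := h2
    exact ⟨⟨u + v, by simp [hu, hv]⟩, by simp [h1, h2]⟩
  | smul r X _ h1 =>
    obtain ⟨⟨u, hu⟩, h1⟩ := h1
    exact ⟨⟨r • u, by simp [hu]⟩, by simp [h1]⟩
  | mem X hX =>
    obtain ⟨m, ⟨hm, hm'⟩, rfl⟩ := hX
    rw [Letter.degProj_mono B hm, Letter.degProj_mono B hm]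
    have h1 : ∀ i ∈ m.map (Letter.deg B), 0 ≤ i := by
      intro i hi
      obtain ⟨z, hz, rfl⟩ := Multiset.mem_map.1 hi
      rcases (Letter.red_iff B).1 (hm' z hz) with h | ⟨α, rfl⟩
      · cases h <;> exact le_rfl
      · exact zero_le_one
    have h2 : 0 ≤ Letter.mdeg B m := Multiset.sum_nonneg h1
    refine ⟨?_, if_neg (by omega)⟩
    split_ifs with h0
    · refine Letter.mono_mem_range B fun z hz => ?_
      rcases (Letter.red_iff B).1 (hm' z hz) with h | ⟨α, rfl⟩
      · exact h
      · have h3 := Multiset.single_le_sum h1 _ (Multiset.mem_map_of_mem _ hz)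
        rw [← Letter.mdeg, h0] at h3
        exact absurd h3 (by simp [Letter.deg])
    · exact ⟨0, map_zero _⟩

lemma exists_JP_eq {X : Om μ} (hX : X ∈ Ored μ) (h0 : X ∈ Odeg μ 0) : ∃ u, JP μ u = X := by
  obtain ⟨B⟩ := AdaptedBasis.nonempty μ
  obtain ⟨⟨u, hu⟩, -⟩ := degProj_stage_zero B (X := X) (by rw [Letter.stage_zero]; exact hX)
  rw [Letter.degProj_of_mem B h0, if_pos rfl] at hu
  exact ⟨u, hu⟩

/-- Every cocycle is cohomologous to one in the reduced algebra. -/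
lemma exists_reduced_representative {X : Om μ} (hX : X ∈ Odeg μ 0) (hd : d μ X = 0) :
    ∃ x ∈ Ored μ, x ∈ Odeg μ 0 ∧ d μ x = 0 ∧ ∃ Y ∈ Odeg μ (-1), d μ Y = X - x := by
  obtain ⟨B⟩ := AdaptedBasis.nonempty μ
  obtain ⟨-, h1, -⟩ := Letter.stage_quasi_iso B (fun u hu => by
    rw [Letter.stage_zero] at hu ⊢; exact d_mem_Ored hu) _ le_rfl
  obtain ⟨x, hx, hdx, Y, hY⟩ := h1 X (by rw [Letter.stage_card]; trivial) hd
  obtain ⟨⟨u, hu⟩, -⟩ := degProj_stage_zero B hx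
  -- The contractions do not keep track of ghost numbers, so the representative and the primitive
  -- are projected to degrees `0` and `-1`.
  refine ⟨JP μ u, JP_mem_Ored u, JP_mem_Odeg u, by rw [hu, Letter.d_degProj, hdx, map_zero],
    Letter.degProj B (-1) Y, Letter.degProj_mem B _ _, ?_⟩
  have h2 := Letter.degProj_of_mem B hX 0
  rw [if_pos rfl] at h2
  rw [hu, Letter.d_degProj, ← h2, ← map_sub, hY]
  simp

/-- Reduced cochains of degree `0` that are coboundaries vanish. -/
lemma eq_zero_of_coboundary {X Y : Om μ} (hX : X ∈ Ored μ) (h0 : X ∈ Odeg μ 0)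
    (hY : d μ Y = X) : X = 0 := by
  obtain ⟨B⟩ := AdaptedBasis.nonempty μ
  obtain ⟨-, -, h1⟩ := Letter.stage_quasi_iso B (fun u hu => by
    rw [Letter.stage_zero] at hu ⊢; exact d_mem_Ored hu) _ le_rfl
  obtain ⟨Y', hY', h2⟩ := h1 X (by rw [Letter.stage_zero]; exact hX) Y
    (by rw [Letter.stage_card]; trivial) hY
  -- Only the part of degree `-1` of the primitive can bound `X`, and for a reduced primitive this
  -- part is zero.
  have h3 := (degProj_stage_zero B hY').2
  have h4 := Letter.d_degProj B (-1) Y'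
  rw [h3, map_zero, h2, Letter.degProj_of_mem B h0] at h4
  simpa using h4.symm

end reduced

/-! The projection onto the component of bidegree `(0, 0)`. -/

section bidegree

variable {μ : YoungDiagram}

lemma lie_mem_grade {k l : ℤ} {x y : G μ} (hx : x ∈ grade μ k) (hy : y ∈ grade μ l) :
    ⁅x, y⁆ ∈ grade μ (k + l) := by
  rw [mem_grade_iff] at hx hy ⊢
  intro a e h
  have h1 (f : Box μ) : x.1 a f * y.1 f e = 0 := by
    by_cases h2 : (f.col : ℤ) - a.col = k
    · rw [hy f e (by omega), mul_zero]
    · rw [hx a f h2, zero_mul]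
  have h2 (f : Box μ) : y.1 a f * x.1 f e = 0 := by
    by_cases h2 : (f.col : ℤ) - a.col = l
    · rw [hx f e (by omega), mul_zero]
    · rw [hy a f h2, zero_mul]
  rw [lie_entry, Finset.sum_eq_zero fun f _ => h1 f, Finset.sum_eq_zero fun f _ => h2 f, sub_zero]

lemma tUp_mem_grade (α : Pos μ) : tUp α ∈ grade μ (-α.deg) := by
  rw [mem_grade_iff]
  intro a e h
  rw [tUp_apply, if_neg]
  rintro ⟨rfl, rfl⟩
  simp [Pos.deg] at h

lemma mul_mem_Obideg {p q r : ℤ × ℤ} {X Y : Om μ} (hX : X ∈ Obideg μ p) (hY : Y ∈ Obideg μ q)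
    (h : p + q = r) : X * Y ∈ Obideg μ r := h ▸ mul_mem_piece hX hY

/-- A nonzero structure constant forces `deg γ = deg β - k`, and the shifts by one in the bidegrees
of `b^γ` and `c_β` cancel. -/
lemma Jhat_mem_Obideg {k : ℤ} {x : G μ} (hx : x ∈ grade μ k) : Jhat x ∈ Obideg μ (-k, k) := by
  refine Submodule.add_mem _ ?_ (Submodule.sum_mem _ fun β _ => Submodule.sum_mem _ fun γ _ => ?_)
  · have := gen_mem_piece (HasBideg.J (-k) x (by rwa [neg_neg]))
    rwa [neg_neg] at this
  · by_cases h : γ.deg = β.deg - k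
    · refine Submodule.smul_mem _ _ (mul_mem_Obideg (gen_mem_piece (HasBideg.b γ))
        (gen_mem_piece (HasBideg.c β)) (Prod.ext ?_ ?_))
      · change γ.deg - 1 + (1 - β.deg) = -k
        omega
      · change -γ.deg + β.deg = k
        omega
    · have h1 : upCoeff ⁅x, tUp β⁆ γ = 0 :=
        mem_grade_iff.1 (lie_mem_grade hx (tUp_mem_grade β)) _ _ (by
          simp only [Pos.deg] at h ⊢; omega)
      rw [h1, zero_smul]
      exact Submodule.zero_mem _

lemma Obideg_le_Odeg (p : ℤ × ℤ) : Obideg μ p ≤ Odeg μ (p.1 + p.2) := by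
  refine Submodule.span_le.2 ?_
  rintro _ ⟨L, hL, rfl, rfl⟩
  rw [SetLike.mem_coe]
  induction L with
  | nil => exact one_mem_piece
  | cons p L ih =>
    have h1 : p.1 ∈ Odeg μ (p.2.1 + p.2.2) := by
      have h2 := hL p (by simp)
      revert h2
      obtain ⟨X, i, j⟩ := p
      intro h2
      cases h2 with
      | J _ x hx =>
        change J x ∈ Odeg μ (i + -i)
        rw [add_neg_cancel]
        exact J_mem_Odeg x
      | c α =>
        change c α ∈ Odeg μ (1 - α.deg + α.deg)
        rw [sub_add_cancel]
        exact c_mem_Odeg α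
      | b α =>
        change b α ∈ Odeg μ (α.deg - 1 + -α.deg)
        rw [show α.deg - 1 + -α.deg = -1 by ring]
        exact b_mem_Odeg α
    simp only [List.map_cons, List.prod_cons, List.sum_cons]
    exact mul_mem_Odeg h1 (ih fun q hq => hL q (by simp [hq])) (by
      rw [Prod.fst_add, Prod.snd_add]; ring)

lemma comp00_add (X Y : Om μ) : comp00 (X + Y) = comp00 X + comp00 Y := by
  simp [comp00, DirectSum.decompose_add]

lemma comp00_smul (r : ℂ) (X : Om μ) : comp00 (r • X) = r • comp00 X := by
  rw [comp00, DirectSum.decompose_smul]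
  rfl

lemma comp00_zero : comp00 (0 : Om μ) = 0 := by
  simp [comp00]

lemma comp00_of_mem {X : Om μ} (h : X ∈ Obideg μ (0, 0)) : comp00 X = X :=
  DirectSum.decompose_of_mem_same _ h

lemma comp00_of_mem_ne {p : ℤ × ℤ} {X : Om μ} (h : X ∈ Obideg μ p) (hp : p ≠ (0, 0)) :
    comp00 X = 0 :=
  DirectSum.decompose_of_mem_ne _ h hp

end bidegree

/-! The projection of `g_0 ⊕ g_+` onto `g_0`. -/

section projection

variable {μ : YoungDiagram}

/-- The projection of `g_0 ⊕ g_+` onto `g_0`. -/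
def nonnegToZero (μ : YoungDiagram) : gNonneg μ →ₗ⁅ℂ⁆ gZero μ where
  toLinearMap := prZ ∘ₗ (gNonneg μ).toSubmodule.subtype
  map_lie' := by
    intro x y
    refine Subtype.ext (Subtype.ext (Matrix.ext fun a e => ?_))
    change (prZ ⁅x.1, y.1⁆).1.1 a e = (⁅(prZ x.1).1, (prZ y.1).1⁆ : G μ).1 a e
    rw [prZ_entry, lie_entry, lie_entry]
    simp only [prZ_entry]
    -- For two boxes in the same column, an intermediate box in another column makes one of the two
    -- factors an entry of negative degree, hence zero.
    have key (x y : gNonneg μ) (h : e.col = a.col) (f : Box μ) :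
        x.1.1 a f * y.1.1 f e = (if f.col = a.col then x.1.1 a f else 0) *
          if e.col = f.col then y.1.1 f e else 0 := by
      rcases lt_trichotomy f.col a.col with h1 | h1 | h1
      · rw [x.2 a f h1, if_neg h1.ne, zero_mul, zero_mul]
      · rw [if_pos h1, if_pos (h.trans h1.symm)]
      · rw [y.2 f e (by omega), if_neg h1.ne', mul_zero, zero_mul]
    have key' (x y : gNonneg μ) (h : e.col ≠ a.col) (f : Box μ) :
        ((if f.col = a.col then x.1.1 a f else 0) *
          if e.col = f.col then y.1.1 f e else 0) = 0 := by
      by_cases h1 : f.col = a.col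
      · rw [if_neg (c := e.col = f.col) (fun h2 => h (h2.trans h1)), mul_zero]
      · rw [if_neg h1, zero_mul]
    by_cases h : e.col = a.col
    · rw [if_pos h, Finset.sum_congr rfl fun f _ => key x y h f,
        Finset.sum_congr rfl fun f _ => key y x h f]
    · rw [if_neg h, Finset.sum_eq_zero fun f _ => key' x y h f,
        Finset.sum_eq_zero fun f _ => key' y x h f, sub_zero]

/-- The inclusion of `g_0` into `g_0 ⊕ g_+`. -/
def zeroToNonneg (μ : YoungDiagram) : gZero μ →ₗ⁅ℂ⁆ gNonneg μ where
  toFun x := ⟨x.1, grade_zero_le x.2⟩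
  map_add' _ _ := rfl
  map_smul' _ _ := rfl
  map_lie' := rfl

/-- The projection of `U (g_0 ⊕ g_+)` onto `U g_0`. -/
def projU (μ : YoungDiagram) : Up μ →ₐ[ℂ] UniversalEnvelopingAlgebra ℂ (gZero μ) :=
  UniversalEnvelopingAlgebra.lift ℂ ((UniversalEnvelopingAlgebra.ι ℂ).comp (nonnegToZero μ))

/-- The inclusion of `U g_0` into `U (g_0 ⊕ g_+)`. -/
def inclU (μ : YoungDiagram) : UniversalEnvelopingAlgebra ℂ (gZero μ) →ₐ[ℂ] Up μ :=
  UniversalEnvelopingAlgebra.lift ℂ ((UniversalEnvelopingAlgebra.ι ℂ).comp (zeroToNonneg μ))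

lemma projU_ι (x : gNonneg μ) :
    projU μ (UniversalEnvelopingAlgebra.ι ℂ x) = UniversalEnvelopingAlgebra.ι ℂ (prZ x.1) :=
  UniversalEnvelopingAlgebra.lift_ι_apply ℂ _ x

lemma inclU_ι (x : gZero μ) : inclU μ (UniversalEnvelopingAlgebra.ι ℂ x) =
    UniversalEnvelopingAlgebra.ι ℂ (⟨x.1, grade_zero_le x.2⟩ : gNonneg μ) :=
  UniversalEnvelopingAlgebra.lift_ι_apply ℂ _ x

lemma projU_inclU (u : UniversalEnvelopingAlgebra ℂ (gZero μ)) : projU μ (inclU μ u) = u := by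
  have h : (projU μ).comp (inclU μ) = AlgHom.id ℂ _ := by
    refine UniversalEnvelopingAlgebra.hom_ext (R := ℂ) (L := gZero μ) ?_
    ext1 x
    change projU μ (inclU μ (UniversalEnvelopingAlgebra.ι ℂ x)) = UniversalEnvelopingAlgebra.ι ℂ x
    rw [inclU_ι, projU_ι, prZ_of_mem]
  exact DFunLike.congr_fun h u

/-- The embedding of `U g_0` into `Ω`. -/
def JZ (μ : YoungDiagram) : UniversalEnvelopingAlgebra ℂ (gZero μ) →ₐ[ℂ] Om μ :=
  (JP μ).comp (inclU μ)

lemma JZ_apply (u : UniversalEnvelopingAlgebra ℂ (gZero μ)) : JZ μ u = JP μ (inclU μ u) := rfl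

lemma JZ_ι (x : gZero μ) : JZ μ (UniversalEnvelopingAlgebra.ι ℂ x) = Jhat x.1 := by
  rw [JZ_apply, inclU_ι, JP_ι]

lemma JZ_injective : Function.Injective (JZ μ) :=
  JP_injective.comp (Function.LeftInverse.injective projU_inclU)

lemma d0_JZ (u : UniversalEnvelopingAlgebra ℂ (gZero μ)) : d0 μ (JZ μ u) = 0 := by
  let S : Subalgebra ℂ (UniversalEnvelopingAlgebra ℂ (gZero μ)) :=
    { carrier := {u | d0 μ (JZ μ u) = 0}
      mul_mem' := fun {u v} hu hv => by
        change d0 μ (JZ μ (u * v)) = 0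
        rw [map_mul, d0_mul, show d0 μ (JZ μ u) = 0 from hu, show d0 μ (JZ μ v) = 0 from hv,
          zero_mul, mul_zero, add_zero]
      add_mem' := fun {u v} hu hv => by
        change d0 μ (JZ μ (u + v)) = 0
        rw [map_add, map_add, show d0 μ (JZ μ u) = 0 from hu, show d0 μ (JZ μ v) = 0 from hv,
          add_zero]
      algebraMap_mem' := fun r => by
        change d0 μ (JZ μ (algebraMap ℂ _ r)) = 0
        rw [Algebra.algebraMap_eq_smul_one, map_smul, map_one, map_smul, d0, gradedComm_one,
          smul_zero] }
  have h : S = ⊤ := enveloping_subalgebra_eq_top S fun x => by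
    change d0 μ (JZ μ (UniversalEnvelopingAlgebra.ι ℂ x)) = 0
    rw [JZ_ι, d0_Jhat_of_mem_gZero x.2]
  have : u ∈ S := h ▸ Algebra.mem_top
  exact this

end projection

/-! ### The component of bidegree `(0, 0)` of an ordered monomial. -/

namespace Letter

variable {μ : YoungDiagram} (B : AdaptedBasis μ)

/-- The degree of a letter with respect to `ad δ`. -/
def height : Letter μ B.rank → ℤ
  | plus α => α.deg
  | _ => 0

lemma height_nonneg (z : Letter μ B.rank) : 0 ≤ height B z := by
  cases z with
  | plus α => have := α.2; simp only [height, Pos.deg]; omega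
  | _ => exact le_rfl

lemma mono_mem_Obideg (m : Multiset (Letter μ B.rank)) (hm : ∀ z ∈ m, Par B z) :
    mono B m ∈ Obideg μ (-(m.map (height B)).sum, (m.map (height B)).sum) := by
  have key : ∀ L : List (Letter μ B.rank), (∀ z ∈ L, Par B z) →
      (L.map (gen B)).prod ∈ Obideg μ (-(L.map (height B)).sum, (L.map (height B)).sum) := by
    intro L hL
    induction L with
    | nil => exact one_mem_piece
    | cons z L ih =>
      have h1 : gen B z ∈ Obideg μ (-height B z, height B z) := by
        rw [(hL z (by simp)).gen_eq]
        cases hL z (by simp) with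
        | zero z => exact Jhat_mem_Obideg (B.basis z).2
        | plus α => exact Jhat_mem_Obideg (tLow_mem_grade α)
      simp only [List.map_cons, List.prod_cons, List.sum_cons]
      refine mul_mem_Obideg h1 (ih fun z hz => hL z (by simp [hz])) (Prod.ext ?_ rfl)
      rw [Prod.fst_add]
      ring
  have h := key ((ord B).toList m) fun z hz => hm z (by
    rwa [← Multiset.mem_coe, (ord B).coe_toList] at hz)
  have h2 : (((ord B).toList m).map (height B)).sum = (m.map (height B)).sum := by
    conv_rhs => rw [← (ord B).coe_toList m]
    simp
  rwa [h2] at h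

lemma JZ_projU_of_zero {m : Multiset {z : Letter μ B.rank // Par B z}}
    (h : ∀ z ∈ m, ∃ i, z.1 = zero i) : JZ μ (projU μ (parMono B m)) = JP μ (parMono B m) := by
  rw [JZ_apply]
  refine congrArg (JP μ) ?_
  rw [parMono, word, map_list_prod, map_list_prod, List.map_map, List.map_map]
  refine congrArg List.prod (List.map_congr_left fun z hz => ?_)
  rw [← Multiset.mem_coe, (subOrd B (Par B)).coe_toList] at hz
  obtain ⟨i, hi⟩ := h z hz
  obtain ⟨z, hz'⟩ := z
  obtain rfl : z = zero i := hi
  change inclU μ (projU μ (parGen B _)) = parGen B _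
  rw [parGen, projU_ι, inclU_ι]
  have h1 : (prZ (vec B (zero i))).1 = vec B (zero i) :=
    congrArg Subtype.val (prZ_of_mem (B.basis i))
  refine congrArg _ (Subtype.ext ?_)
  exact h1

lemma projU_eq_zero {m : Multiset {z : Letter μ B.rank // Par B z}} {α : Pos μ}
    (h : (⟨plus α, Par.plus α⟩ : {z : Letter μ B.rank // Par B z}) ∈ m) :
    projU μ (parMono B m) = 0 := by
  have h1 : projU μ (parGen B ⟨plus α, Par.plus α⟩) = 0 := by
    rw [parGen, projU_ι]
    change UniversalEnvelopingAlgebra.ι ℂ (prZ (tLow α)) = 0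
    rw [prZ_tLow, map_zero]
  rw [← (subOrd B (Par B)).coe_toList m, Multiset.mem_coe] at h
  obtain ⟨L, M, hLM⟩ := List.append_of_mem h
  rw [parMono, word, hLM, List.map_append, List.prod_append, List.map_cons, List.prod_cons,
    map_mul, map_mul, h1, zero_mul, mul_zero]

lemma zero_or_plus (m : Multiset {z : Letter μ B.rank // Par B z}) :
    (∀ z ∈ m, ∃ i, z.1 = zero i) ∨
      ∃ α, (⟨plus α, Par.plus α⟩ : {z : Letter μ B.rank // Par B z}) ∈ m := by
  by_cases h : ∃ α, (⟨plus α, Par.plus α⟩ : {z : Letter μ B.rank // Par B z}) ∈ m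
  · exact Or.inr h
  · refine Or.inl ?_
    rintro ⟨z, hz⟩ hm
    cases hz with
    | zero i => exact ⟨i, rfl⟩
    | plus α => exact absurd ⟨α, hm⟩ h

/-- The monomial has bidegree `(-h, h)` with `h` its total height. Heights are nonnegative, and
positive for the letters `plus α`, so `h = 0` exactly when no such letter occurs; these are also the
monomials that `projU` does not kill. -/
lemma comp00_JP_parMono (m : Multiset {z : Letter μ B.rank // Par B z}) :
    comp00 (JP μ (parMono B m)) = JZ μ (projU μ (parMono B m)) := by
  have h0 : JP μ (parMono B m) ∈ Obideg μ (-((m.map fun z => height B z.1).sum),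
      (m.map fun z => height B z.1).sum) := by
    have h1 := mono_mem_Obideg B (m.map Subtype.val) (by
      intro z hz
      obtain ⟨z', -, rfl⟩ := Multiset.mem_map.1 hz
      exact z'.2)
    rw [← JP_parMono, Multiset.map_map] at h1
    exact h1
  rcases zero_or_plus B m with h | ⟨α, h⟩
  · rw [JZ_projU_of_zero B h]
    have h3 : (m.map fun z => height B z.1).sum = 0 := by
      refine Multiset.sum_eq_zero fun i hi => ?_
      obtain ⟨z, hz, rfl⟩ := Multiset.mem_map.1 hi
      obtain ⟨i, hi⟩ := h z hz
      rw [hi]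
      rfl
    rw [h3] at h0
    exact comp00_of_mem (by simpa using h0)
  · rw [projU_eq_zero B h, map_zero]
    refine comp00_of_mem_ne h0 fun h3 => ?_
    have h4 : height B (plus α) ≤ (m.map fun z => height B z.1).sum :=
      Multiset.single_le_sum (fun i hi => by
        obtain ⟨z, -, rfl⟩ := Multiset.mem_map.1 hi
        exact height_nonneg B _) _ (Multiset.mem_map_of_mem (fun z => height B z.1) h)
    rw [(Prod.mk.inj h3).2] at h4
    have := α.2
    simp only [height, Pos.deg] at h4
    omega

end Letter

/-- The projection of `U (g_0 ⊕ g_+)` onto `U g_0` takes the component of bidegree `(0, 0)`. -/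
lemma comp00_JP {μ : YoungDiagram} (u : Up μ) : comp00 (JP μ u) = JZ μ (projU μ u) := by
  obtain ⟨B⟩ := AdaptedBasis.nonempty μ
  have h : u ∈ Submodule.span ℂ (Set.range (Letter.parMono B)) := by
    rw [Letter.span_parMono]; trivial
  induction h using Submodule.span_induction with
  | mem u h =>
    obtain ⟨m, rfl⟩ := h
    exact Letter.comp00_JP_parMono B m
  | zero => simp only [map_zero, comp00_zero]
  | add u v _ _ h1 h2 => simp only [map_add, comp00_add, h1, h2]
  | smul r u _ h => simp only [map_smul, comp00_smul, h]

/-! Injectivity of the Miura transformation. -/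

namespace Letter

variable {μ : YoungDiagram} (B : AdaptedBasis μ)

lemma gradedComm_prod_mem {q : Om μ} {s : ℤ} {ok : Letter μ B.rank → Prop}
    (h : ∀ z, ok z → gradedComm q (gen B z) ∈ fil B (weight B z + s))
    (L : List (Letter μ B.rank)) (hL : ∀ z ∈ L, ok z) :
    gradedComm q ((L.map (gen B)).prod) ∈ fil B (wt (weight B) (L : Multiset _) + s) := by
  induction L with
  | nil => simp [gradedComm_one]
  | cons z L ih =>
    obtain ⟨ε, hε⟩ := parity_gen B z
    rw [List.map_cons, List.prod_cons, gradedComm_mul, wt_coe_cons, hε, smul_mul_assoc]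
    push_cast
    exact Submodule.add_mem _
      (mul_mem_filt (h z (hL z (by simp))) (prod_mem_filt le_rfl) (by omega))
      (Submodule.smul_mem _ _ (mul_mem_filt (gen_mem_filt le_rfl)
        (ih fun z hz => hL z (by simp [hz])) (by omega)))

lemma gradedComm_mem {q : Om μ} {s : ℤ}
    (h : ∀ z, gradedComm q (gen B z) ∈ fil B (weight B z + s)) {n : ℤ} {X : Om μ}
    (hX : X ∈ fil B n) : gradedComm q X ∈ fil B (n + s) := by
  induction hX using Submodule.span_induction with
  | mem X hX =>
    obtain ⟨L, hL, rfl⟩ := hX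
    exact filt_mono (by omega)
      (gradedComm_prod_mem B (ok := fun _ => True) (fun z _ => h z) L fun _ _ => trivial)
  | zero => simp
  | add X Y _ _ h1 h2 => rw [map_add]; exact Submodule.add_mem _ h1 h2
  | smul r X _ h1 => rw [map_smul]; exact Submodule.smul_mem _ _ h1

lemma d_Jhat_mem {n : ℤ} (h : 5 ≤ n) (x : G μ) : d μ (Jhat x) ∈ fil B n := by
  rw [d_eq, d0_Jhat, d1_Jhat]
  exact Submodule.add_mem _ (Submodule.sum_mem _ fun α _ => mul_mem_filt (Jhat_mem B le_rfl _)
    (c_mem B le_rfl α) h) (Submodule.neg_mem _ (Submodule.sum_mem _ fun α _ =>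
      Submodule.smul_mem _ _ (c_mem B (by omega) α)))

/-- The critical cases are a `Ĵ` of weight `3`, which becomes a `Ĵ` of weight up to `4` times a
ghost, and `b^α` of weight `1`, which becomes `D^α` of weight `3`. -/
lemma d_gen_mem (z : Letter μ B.rank) : d μ (gen B z) ∈ fil B (weight B z + 2) := by
  cases z with
  | zero z =>
    have := weight_even B (Even.zero z)
    exact d_Jhat_mem B (by omega) _
  | plus α =>
    have := weight_even B (Even.plus α)
    exact d_Jhat_mem B (by omega) _
  | gh α =>
    change d μ (c α) ∈ fil B 3
    rw [d_eq, d0_c, d1_c, add_zero]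
    exact Submodule.neg_mem _ (Submodule.smul_mem _ _ (Submodule.sum_mem _ fun β _ =>
      Submodule.sum_mem _ fun γ _ => Submodule.smul_mem _ _
        (mul_mem_filt (c_mem B le_rfl β) (c_mem B le_rfl γ) (by norm_num))))
  | minus α =>
    change d μ (D α) ∈ _
    rw [d_D]
    exact Submodule.zero_mem _
  | anti α =>
    change d μ (b α) ∈ fil B 3
    rw [d_b]
    have h : gen B (minus α) ∈ fil B 3 := gen_mem_filt (by simp [weight])
    exact h

lemma gradedComm_b_even (β : Pos μ) {z : Letter μ B.rank} (h : Even B z) :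
    gradedComm (b β) (gen B z) ∈ fil B 1 := by
  rw [gradedComm_apply, parity_even B h]
  have h1 : gen B z * b β - b β * gen B z ∈ fil B 1 := by
    have h2 := even_odd_commutator_mem B (z' := anti β) h (Odd.anti β)
    exact h2
  have h2 := Submodule.neg_mem _ h1
  rwa [neg_sub] at h2

lemma gradedComm_b_c (α β : Pos μ) :
    gradedComm (b β) (c α) = (if β = α then 1 else 0 : ℂ) • 1 := by
  rw [gradedComm_apply, parity_c, neg_mul, sub_neg_eq_add, b_mul_c_add]

lemma gradedComm_b_gen (β : Pos μ) (z : Letter μ B.rank) :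
    gradedComm (b β) (gen B z) ∈ fil B (weight B z + -1) := by
  rcases even_or_odd B z with h | h
  · have := weight_even B h
    exact filt_mono (by omega) (gradedComm_b_even B β h)
  · rw [weight_odd B h]
    cases h with
    | gh α =>
      change gradedComm (b β) (c α) ∈ _
      rw [gradedComm_b_c]
      exact Submodule.smul_mem _ _ (one_mem_filt (by norm_num))
    | anti α =>
      change gradedComm (b β) (b α) ∈ _
      rw [gradedComm_apply, parity_b, neg_mul, sub_neg_eq_add, b_mul_b β α, neg_add_cancel]
      exact Submodule.zero_mem _

/-- Without ghosts in the product there is no `c_β` for `b^β` to delete. Some `Ĵ` is then traded for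
a single antighost, so the weight falls by `2` and not only by `1`. -/
lemma gradedComm_b_prod (β : Pos μ) {L : List (Letter μ B.rank)} (hL : ∀ z ∈ L, Par B z) :
    gradedComm (b β) ((L.map (gen B)).prod) ∈ fil B (wt (weight B) (L : Multiset _) + -2) :=
  gradedComm_prod_mem B (fun z hz => by
    have := weight_even B hz.even
    exact filt_mono (by omega) (gradedComm_b_even B β hz.even)) L hL

/-- The operator `[b^β, d ·]`. -/
def bd (β : Pos μ) : Om μ →ₗ[ℂ] Om μ := gradedComm (b β) ∘ₗ d μ

lemma bd_apply (β : Pos μ) (X : Om μ) : bd β X = gradedComm (b β) (d μ X) := rfl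

lemma bd_mem (β : Pos μ) {n : ℤ} {X : Om μ} (hX : X ∈ fil B n) : bd β X ∈ fil B (n + 1) := by
  have h : d μ X ∈ fil B (n + 2) := gradedComm_mem B (d_gen_mem B) hX
  exact filt_mono (by omega) (gradedComm_mem B (gradedComm_b_gen B β) h)

/-- The antighost `b^β` extracts the coefficient of `c_β` from `d_0 Ĵ(x)`. What remains are its
commutators with the coefficients, of the form `b c`, and the scalar from `d_1`. -/
lemma bd_Jhat (β : Pos μ) (x : G μ) : bd β (Jhat x) - Jhat (prP ⁅tUp β, x⁆) ∈ fil B 2 := by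
  have h1 (α : Pos μ) (y : G μ) : gradedComm (b β) (Jhat y * c α) =
      -bv ⁅y, prM (tUp β)⁆ * c α + if β = α then Jhat y else 0 := by
    rw [gradedComm_mul, gradedComm_b_c, gradedComm_apply, parity_Jhat, ← neg_sub, Jhat_b]
    split_ifs <;> simp
  rw [bd_apply, d_eq, d0_Jhat, d1_Jhat, map_add, map_neg, map_sum, map_sum]
  simp only [h1, Finset.sum_add_distrib, Finset.sum_ite_eq, Finset.mem_univ, if_true, map_smul,
    gradedComm_b_c]
  rw [add_right_comm, add_sub_cancel_right]
  refine Submodule.add_mem _ (Submodule.sum_mem _ fun α _ => ?_)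
    (Submodule.neg_mem _ (Submodule.sum_mem _ fun α _ => ?_))
  · exact mul_mem_filt (Submodule.neg_mem _ (bv_mem B le_rfl _)) (c_mem B le_rfl α) (by norm_num)
  · exact Submodule.smul_mem _ _ (Submodule.smul_mem _ _ (one_mem_filt (by norm_num)))

lemma psi_prP (x : G μ) : psi (prP x) = psi x := by
  rw [prP_apply, map_sub, prM_apply, map_sum, Finset.sum_eq_zero, sub_zero]
  intro γ _
  rw [map_smul, ← psi_prZ, prZ_tUp]
  exact (congrArg _ (map_zero psi)).trans (smul_zero _)

open Classical in
lemma psi_lie_vec (β : Pos μ) {z : Letter μ B.rank} (h : Par B z) :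
    psi (⁅tUp β, vec B z⁆ : G μ) = if z = plus β then (β.1.2.col : ℂ) - β.1.1.col else 0 := by
  cases h with
  | zero z =>
    rw [if_neg (by simp)]
    refine psi_eq_zero fun a => ?_
    have h1 : (⁅tUp β, vec B (zero z)⁆ : G μ) ∈ grade μ (-β.deg + 0) :=
      lie_mem_grade (tUp_mem_grade β) (B.basis z).2
    have := β.2
    exact mem_grade_iff.1 h1 a a (by simp only [Pos.deg]; omega)
  | plus α =>
    rw [vec, psi_lie]
    simp only [plus.injEq, eq_comm (a := α)]

/-- Besides the two derivation terms there are the mixed terms `d z · [b^β, L]` and `[b^β, z] · d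
L`. They exceed the weight of `L` by at most `5 - 2` and `1 + 2`, so by no more than the weight of
`z`, whereas the leading term exceeds it by one more than that. Modulo weight `3` the image of `z`
is the special letter times `psi [t^β, z]`, which is nonzero only for `z = plus β`. -/
lemma isLowering_bd {i : Fin B.rank} (hi : B.Special i) (β : Pos μ) :
    IsLowering ℂ (gen B) (weight B) (Odd B) (Par B) (bd β) 1 (plus β)
      (((β.1.2.col : ℂ) - β.1.1.col) • gen B (zero i)) := by
  have hw : weight B (zero i) = 4 := by simp [weight, hi]
  refine ⟨?_, ?_, fun _ => ?_, fun z hz => ⟨1, fun _ _ => rfl, fun L hL => ?_⟩⟩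
  · rw [bd_apply, d_one, map_zero]
    exact Submodule.zero_mem _
  · exact Submodule.smul_mem _ _ (gen_mem_filt (by rw [hw]; exact le_rfl))
  · rw [smul_mul_assoc, mul_smul_comm, ← smul_sub]
    exact Submodule.smul_mem _ _ (filt_mono (by simp [weight]) (Jhat_commutator_mem B _ _))
  · have hev := weight_even B hz.even
    have hP := prod_mem_filt (K := ℂ) (g := gen B) (w := weight B) (L := L) le_rfl
    have h1 : bd β (gen B z * (L.map (gen B)).prod) = bd β (gen B z) * (L.map (gen B)).prod -
        d μ (gen B z) * gradedComm (b β) (L.map (gen B)).prod +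
        gradedComm (b β) (gen B z) * d μ (L.map (gen B)).prod +
        gen B z * bd β (L.map (gen B)).prod := by
      simp only [bd_apply, d_mul, map_add, gradedComm_mul, parity_d, parity_even B hz.even]
      noncomm_ring
    have h2 : bd β (gen B z) - (open Classical in
        if z = plus β then ((β.1.2.col : ℂ) - β.1.1.col) • gen B (zero i) else 0) ∈ fil B 3 := by
      have h3 := Jhat_sub_mem B hi (prP ⁅tUp β, vec B z⁆)
      rw [psi_prP, psi_lie_vec B β hz, ite_smul, zero_smul] at h3
      have h4 := Submodule.add_mem _ (filt_mono (by norm_num) (bd_Jhat B β (vec B z))) h3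
      rwa [sub_add_sub_cancel, ← hz.gen_eq] at h4
    have h3 : d μ (L.map (gen B)).prod ∈ fil B (wt (weight B) (L : Multiset _) + 2) :=
      gradedComm_mem B (d_gen_mem B) hP
    have h4 : d μ (gen B z) ∈ fil B 5 := by
      rw [hz.gen_eq]
      exact d_Jhat_mem B le_rfl _
    have h5 : bd β (gen B z * (L.map (gen B)).prod) - (open Classical in if z = plus β then
        ((β.1.2.col : ℂ) - β.1.1.col) • gen B (zero i) * (L.map (gen B)).prod else 0) -
        (1 : ℂ) • (gen B z * bd β (L.map (gen B)).prod) =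
        (bd β (gen B z) - (open Classical in if z = plus β then
          ((β.1.2.col : ℂ) - β.1.1.col) • gen B (zero i) else 0)) * (L.map (gen B)).prod -
        d μ (gen B z) * gradedComm (b β) (L.map (gen B)).prod +
        gradedComm (b β) (gen B z) * d μ (L.map (gen B)).prod := by
      rw [h1, one_smul, sub_mul, ite_mul, zero_mul]
      abel
    have h6 : bd β (gen B z * (L.map (gen B)).prod) - (open Classical in if z = plus β then
        ((β.1.2.col : ℂ) - β.1.1.col) • gen B (zero i) * (L.map (gen B)).prod else 0) -
        (1 : ℂ) • (gen B z * bd β (L.map (gen B)).prod) ∈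
        fil B ((wt (weight B) (L : Multiset _) : ℤ) + weight B z + 1 - 1) := by
      rw [h5]
      refine Submodule.add_mem _ (Submodule.sub_mem _ ?_ ?_) ?_
      · exact mul_mem_filt h2 hP (by omega)
      · exact mul_mem_filt h4 (gradedComm_b_prod B β hL) (by omega)
      · exact mul_mem_filt (gradedComm_b_even B β hz.even) h3 (by omega)
    convert h6

lemma isAdm_of_par {m : Multiset (Letter μ B.rank)} (h : ∀ z ∈ m, Par B z) : IsAdm B m :=
  fun z hz h2 => not_odd_of_even B (h z (Multiset.mem_of_le h2 (by simp))).even hz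

/-- The coefficient is nonzero because it is made of the multiplicity of `plus β`, the difference of
the two columns, and nonzero scalars from reordering. The new monomial weighs `wt m + 1`, so the
error is indeed lower. -/
lemma bd_mono {i : Fin B.rank} (hi : B.Special i) (β : Pos μ) {m : Multiset (Letter μ B.rank)}
    (hm : ∀ z ∈ m, Par B z) (hβ : plus β ∈ m) : ∃ e : ℂ, e ≠ 0 ∧
      bd β (mono B m) - e • mono B (zero i ::ₘ m.erase (plus β)) ∈ fil B (wt (weight B) m) := by
  obtain ⟨ε, L, h1, -, h2⟩ := (isLowering_bd B hi β).word (o := ord B) (Par.plus β) (almostComm B)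
    (fun n X hX => bd_mem B β hX) hm (isAdm_of_par B hm)
  obtain ⟨hε, hL'⟩ := h1 hβ
  have hL : (L : Multiset (Letter μ B.rank)) = m.erase (plus β) := by convert hL'
  obtain ⟨ε', hε', h3⟩ := (almostComm B).word (o := ord B) (L := zero i :: L)
    (m := zero i ::ₘ m.erase (plus β)) (by rw [← Multiset.cons_coe, hL])
  have hw : (wt (weight B) (zero i ::ₘ m.erase (plus β)) : ℤ) = wt (weight B) m + 1 := by
    conv_rhs => rw [← Multiset.cons_erase hβ]
    rw [wt_cons, wt_cons]
    have : weight B (zero i) = 4 := by simp [weight, hi]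
    rw [this]
    push_cast
    simp [weight]
    ring
  rw [hw, add_sub_cancel_right] at h3
  rw [add_sub_cancel_right] at h2
  have hκ : (β.1.2.col : ℂ) - β.1.1.col ≠ 0 := by
    rw [sub_ne_zero, Ne, Nat.cast_inj]
    exact β.2.ne'
  refine ⟨ε * ((β.1.2.col : ℂ) - β.1.1.col) * ε', mul_ne_zero (mul_ne_zero hε hκ) hε', ?_⟩
  have h4 := Submodule.add_mem _ h2
    (Submodule.smul_mem _ (ε * ((β.1.2.col : ℂ) - β.1.1.col)) h3)
  refine (congrArg (· ∈ fil B _) ?_).mp h4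
  rw [List.map_cons, List.prod_cons, smul_mul_assoc, smul_sub, smul_smul, smul_smul,
    sub_add_sub_cancel]

lemma coeff_eq_zero {ι : Type*} (n : ℕ) (t : Finset ι) (f : ι → Multiset (Letter μ B.rank))
    (hf : Set.InjOn f t) (e : ι → ℂ) (ht : ∀ i ∈ t, IsAdm B (f i) ∧ wt (weight B) (f i) = n)
    (h : ∑ i ∈ t, e i • mono B (f i) ∈ fil B ((n : ℤ) - 1)) : ∀ i ∈ t, e i = 0 := by
  classical
  intro i0 hi0
  have : Nonempty ι := ⟨i0⟩
  have hinv : ∀ i ∈ t, e (Function.invFunOn f t (f i)) = e i := fun i hi => by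
    rw [hf.leftInvOn_invFunOn hi]
  have h1 := sum_mono_eq_zero B n (t.image f) (fun m => e (Function.invFunOn f t m))
    (by
      intro m hm
      obtain ⟨i, hi, rfl⟩ := Finset.mem_image.1 hm
      exact ht i hi)
    (by
      rw [Finset.sum_image hf, Finset.sum_congr rfl fun i hi => by rw [hinv i hi]]
      exact h) _ (Finset.mem_image_of_mem f hi0)
  rwa [hinv i0 hi0] at h1

lemma par_map_val (m : Multiset {z : Letter μ B.rank // Par B z}) :
    ∀ z ∈ m.map Subtype.val, Par B z := by
  intro z hz
  obtain ⟨z', -, rfl⟩ := Multiset.mem_map.1 hz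
  exact z'.2

/-- The terms of highest weight of a reduced cocycle of degree `0` belong to `U g_0`. -/
lemma not_plus_mem {a : Multiset {z : Letter μ B.rank // Par B z} →₀ ℂ}
    (hd : d μ (a.sum fun m r => r • mono B (m.map Subtype.val)) = 0) {m : Multiset _}
    (hm : m ∈ a.support) (hmax : ∀ m' ∈ a.support,
      wt (weight B) (m'.map Subtype.val) ≤ wt (weight B) (m.map Subtype.val)) (β : Pos μ) :
    (⟨plus β, Par.plus β⟩ : {z : Letter μ B.rank // Par B z}) ∉ m := by
  classical
  intro hβ
  obtain ⟨i, hi⟩ := B.exists_special ⟨β⟩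
  set N := wt (weight B) (m.map Subtype.val) with hN
  have hmem {m' : Multiset {z : Letter μ B.rank // Par B z}}
      (h : (⟨plus β, Par.plus β⟩ : {z : Letter μ B.rank // Par B z}) ∈ m') :
      plus β ∈ m'.map Subtype.val := Multiset.mem_map_of_mem Subtype.val h
  -- These are the monomials whose images can have a term of weight `N + 1`.
  let t := a.support.filter fun m' => wt (weight B) (m'.map Subtype.val) = N ∧
    (⟨plus β, Par.plus β⟩ : {z : Letter μ B.rank // Par B z}) ∈ m'
  let f (m' : Multiset {z : Letter μ B.rank // Par B z}) : Multiset (Letter μ B.rank) :=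
    zero i ::ₘ (m'.map Subtype.val).erase (plus β)
  have h1 (m' : Multiset {z : Letter μ B.rank // Par B z}) (hm' : m' ∈ a.support) :
      ∃ e : ℂ, (m' ∈ t → e ≠ 0) ∧ (if m' ∈ t then e • mono B (f m') else 0) -
        bd β (mono B (m'.map Subtype.val)) ∈ fil B N := by
    by_cases ht : m' ∈ t
    · obtain ⟨-, h2, h3⟩ := Finset.mem_filter.1 ht
      obtain ⟨e, he, h4⟩ := bd_mono B hi β (par_map_val B m') (hmem h3)
      refine ⟨e, fun _ => he, ?_⟩
      rw [if_pos ht, ← h2, ← neg_sub]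
      exact Submodule.neg_mem _ h4
    -- A lighter monomial is sent to weight at most `N`, and a monomial of weight `N` without `plus
    -- β` has no leading term.
    · refine ⟨1, fun h => absurd h ht, ?_⟩
      rw [if_neg ht, zero_sub]
      refine Submodule.neg_mem _ ?_
      rcases (hmax m' hm').lt_or_eq with h2 | h2
      · exact bd_mem B β (n := (N : ℤ) - 1) (word_mem_filt (by omega)) |> filt_mono (by omega)
      · obtain ⟨ε, L, -, h3, h4⟩ := (isLowering_bd B hi β).word (o := ord B) (Par.plus β)
          (almostComm B) (fun n X hX => bd_mem B β hX) (par_map_val B m')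
          (isAdm_of_par B (par_map_val B m'))
        rw [h3 fun h => ht (Finset.mem_filter.2 ⟨hm', h2, ?_⟩), zero_smul, sub_zero, h2] at h4
        · exact filt_mono (by omega) h4
        · obtain ⟨⟨z, hz⟩, h5, h6⟩ := Multiset.mem_map.1 h
          obtain rfl : z = plus β := h6
          exact h5
  choose! e he hmemN using h1
  -- As `d` kills the cocycle, the terms of weight `N + 1` must add up to an element of weight at
  -- most `N`.
  have h2 : ∑ m' ∈ t, (a m' * e m') • mono B (f m') ∈ fil B (((N + 1 : ℕ) : ℤ) - 1) := by
    have h3 := Submodule.sum_mem _ fun m' hm' => Submodule.smul_mem _ (a m') (hmemN m' hm')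
    have h4 : ∑ m' ∈ a.support, a m' • bd β (mono B (m'.map Subtype.val)) = 0 := by
      have := congrArg (gradedComm (b β)) hd
      rw [map_zero, ← bd_apply, Finsupp.sum, map_sum] at this
      simpa only [map_smul] using this
    simp only [smul_sub, Finset.sum_sub_distrib, h4, sub_zero, smul_ite, smul_zero,
      smul_smul] at h3
    rw [← Finset.sum_filter, Finset.filter_mem_eq_inter,
      Finset.inter_eq_right.2 (Finset.filter_subset _ _)] at h3
    exact filt_mono (by push_cast; omega) h3
  have hmt : m ∈ t := Finset.mem_filter.2 ⟨hm, rfl, hβ⟩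
  refine mul_ne_zero (Finsupp.mem_support_iff.1 hm) (he m hm hmt)
    (coeff_eq_zero B (N + 1) t f ?_ _ ?_ h2 m hmt)
  · intro m1 h1 m2 h2 h
    have h3 := (Multiset.cons_inj_right _).1 h
    refine Multiset.map_injective Subtype.val_injective ?_
    rw [← Multiset.cons_erase (hmem (Finset.mem_filter.1 h1).2.2), h3,
      Multiset.cons_erase (hmem (Finset.mem_filter.1 h2).2.2)]
  · intro m' hm'
    obtain ⟨-, h3, h4⟩ := Finset.mem_filter.1 hm'
    refine ⟨isAdm_of_par B fun z hz => ?_, ?_⟩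
    · rcases Multiset.mem_cons.1 hz with rfl | hz
      · exact Par.zero i
      · exact par_map_val B m' z (Multiset.mem_of_mem_erase hz)
    · rw [← h3, ← Multiset.cons_erase (hmem h4)]
      change wt _ (zero i ::ₘ (m'.map Subtype.val).erase (plus β)) = _
      rw [wt_cons, wt_cons]
      simp [weight, hi]
      ring

end Letter

/-- A reduced cocycle of degree `0` is determined by its component of bidegree `(0, 0)`. -/
lemma eq_zero_of_projU_eq_zero {μ : YoungDiagram} {u : Up μ} (hd : d μ (JP μ u) = 0)
    (hu : projU μ u = 0) : u = 0 := by
  obtain ⟨B⟩ := AdaptedBasis.nonempty μ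
  have h : u ∈ Submodule.span ℂ (Set.range (Letter.parMono B)) := by
    rw [Letter.span_parMono]; trivial
  obtain ⟨a, rfl⟩ := Finsupp.mem_span_range_iff_exists_finsupp.1 h
  by_cases ha : a = 0
  · rw [ha, Finsupp.sum_zero_index]
  exfalso
  -- A monomial of maximal weight contains no letter `plus β`, so it survives under `projU`, and its
  -- coefficient has to vanish there.
  obtain ⟨m, hm, hmax⟩ := Finset.exists_max_image a.support
    (fun m => wt (Letter.weight B) (m.map Subtype.val)) (Finsupp.support_nonempty_iff.2 ha)
  have h1 := Letter.not_plus_mem B (a := a) (by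
    rw [map_finsuppSum] at hd
    simpa only [map_smul, Letter.JP_parMono] using hd) hm hmax
  classical
  let P (m : Multiset {z : Letter μ B.rank // Letter.Par B z}) : Prop :=
    ∀ z ∈ m, ∃ i, z.1 = Letter.zero i
  have h2 : ∀ m, JZ μ (projU μ (Letter.parMono B m)) =
      if P m then JP μ (Letter.parMono B m) else 0 := by
    intro m
    split_ifs with h
    · exact Letter.JZ_projU_of_zero B h
    · obtain ⟨α, hα⟩ := (Letter.zero_or_plus B m).resolve_left h
      rw [Letter.projU_eq_zero B hα, map_zero]
  have h3 := congrArg (JZ μ) hu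
  rw [map_zero, map_finsuppSum, map_finsuppSum] at h3
  simp only [map_smul, h2] at h3
  have h4 := linearIndependent_iff'.1 (Letter.linearIndependent_JP_parMono B) (a.support.filter P) a
    ((Finset.sum_filter _ _).trans ((Finset.sum_congr rfl fun m _ => by
      change _ = a m • (if P m then JP μ (Letter.parMono B m) else 0)
      rw [smul_ite, smul_zero]).trans h3))
    m (Finset.mem_filter.2 ⟨hm, (Letter.zero_or_plus B m).resolve_right fun ⟨α, hα⟩ => h1 α hα⟩)
  exact Finsupp.mem_support_iff.1 hm h4

/-! The Miura transformation. -/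

section miura

variable {μ : YoungDiagram}

/-- The elements of `U (g_0 ⊕ g_+)` that give cocycles. -/
def cocyclesU (μ : YoungDiagram) : Subalgebra ℂ (Up μ) where
  carrier := {u | d μ (JP μ u) = 0}
  mul_mem' := fun {u v} hu hv => by
    change d μ (JP μ (u * v)) = 0
    rw [map_mul, d_mul, show d μ (JP μ u) = 0 from hu, show d μ (JP μ v) = 0 from hv, zero_mul,
      mul_zero, add_zero]
  add_mem' := fun {u v} hu hv => by
    change d μ (JP μ (u + v)) = 0
    rw [map_add, map_add, show d μ (JP μ u) = 0 from hu, show d μ (JP μ v) = 0 from hv, add_zero]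
  algebraMap_mem' r := by
    change d μ (JP μ (algebraMap ℂ _ r)) = 0
    rw [Algebra.algebraMap_eq_smul_one, map_smul, map_one, map_smul, d_one, smul_zero]

/-- The map that sends an element of `U (g_0 ⊕ g_+)` to the corresponding cocycle. -/
def toCocycles (μ : YoungDiagram) : cocyclesU μ →ₐ[ℂ] cocycles μ :=
  ((JP μ).comp (cocyclesU μ).val).codRestrict (cocycles μ) fun u => ⟨JP_mem_Odeg u.1, u.2⟩

lemma coe_toCocycles (u : cocyclesU μ) : (toCocycles μ u).1 = JP μ u.1 := rfl

lemma exists_toCocycles_eq {X : cocycles μ} (hX : X.1 ∈ Ored μ) : ∃ u, toCocycles μ u = X := by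
  obtain ⟨u, hu⟩ := exists_JP_eq hX X.2.1
  exact ⟨⟨u, by change d μ (JP μ u) = 0; rw [hu]; exact X.2.2⟩, Subtype.ext hu⟩

lemma exists_reduced_cls (w : W μ) : ∃ X : cocycles μ, X.1 ∈ Ored μ ∧ cls X = w := by
  obtain ⟨X, rfl⟩ := Ideal.Quotient.mk_surjective w
  obtain ⟨x, hx, hx0, hd, Y, hY, h⟩ := exists_reduced_representative X.2.1 X.2.2
  refine ⟨⟨x, hx0, hd⟩, hx, (Ideal.Quotient.eq.2 ?_).symm⟩
  exact ⟨Y, hY, h⟩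

lemma eq_of_cls_eq {X X' : cocycles μ} (hX : X.1 ∈ Ored μ) (hX' : X'.1 ∈ Ored μ)
    (h : cls X = cls X') : X = X' := by
  obtain ⟨Y, -, hY⟩ := Ideal.Quotient.eq.1 h
  exact Subtype.ext (sub_eq_zero.1 (eq_zero_of_coboundary (Subalgebra.sub_mem _ hX hX')
    (Submodule.sub_mem _ X.2.1 X'.2.1) hY))

/-- The reduced cocycles are the image of a subalgebra of `U(g_0 ⊕ g_+)`, so this is an isomorphism
of algebras. Its inverse followed by `projU` is then multiplicative. -/
lemma bijective_cls_toCocycles : Function.Bijective (cls.comp (toCocycles μ)) := by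
  constructor
  · intro u v h
    have h1 := eq_of_cls_eq (JP_mem_Ored u.1) (JP_mem_Ored v.1) h
    exact Subtype.ext (JP_injective (congrArg Subtype.val h1))
  · intro w
    obtain ⟨X, hX, rfl⟩ := exists_reduced_cls w
    obtain ⟨u, rfl⟩ := exists_toCocycles_eq hX
    exact ⟨u, rfl⟩

/-- The quantum Miura transformation. -/
def miura (μ : YoungDiagram) : W μ →ₐ[ℂ] UniversalEnvelopingAlgebra ℂ (gZero μ) :=
  ((projU μ).comp (cocyclesU μ).val).comp
    (AlgEquiv.ofBijective (cls.comp (toCocycles μ)) bijective_cls_toCocycles).symm.toAlgHom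

lemma miura_cls_toCocycles (u : cocyclesU μ) : miura μ (cls (toCocycles μ u)) = projU μ u.1 := by
  have h : (AlgEquiv.ofBijective (cls.comp (toCocycles μ)) bijective_cls_toCocycles).symm
      (cls (toCocycles μ u)) = u :=
    (AlgEquiv.ofBijective (cls.comp (toCocycles μ)) bijective_cls_toCocycles).symm_apply_apply u
  exact congrArg (fun v : cocyclesU μ => projU μ v.1) h

lemma JZ_miura {X : cocycles μ} (hX : X.1 ∈ Ored μ) : JZ μ (miura μ (cls X)) = comp00 X.1 := by
  obtain ⟨u, rfl⟩ := exists_toCocycles_eq hX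
  rw [miura_cls_toCocycles, coe_toCocycles, comp00_JP]

lemma miura_injective : Function.Injective (miura μ) := by
  refine (injective_iff_map_eq_zero _).2 fun w hw => ?_
  obtain ⟨u, rfl⟩ := bijective_cls_toCocycles.2 w
  have h1 : projU μ u.1 = 0 := (miura_cls_toCocycles u).symm.trans hw
  have h2 : u = 0 := Subtype.ext (eq_zero_of_projU_eq_zero u.2 h1)
  rw [h2, map_zero]

end miura

/-! ### Cocycles from tic-tac-toe sequences. -/

section ticTacToe

variable {μ : YoungDiagram}

lemma chiFun_eq_trace (y : G μ) : chiFun y = (tPlus μ * y.1).trace := by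
  classical
  let f (p : Box μ × Box μ) : ℂ := tPlus μ p.1 p.2 * y.1 p.2 p.1
  have h1 : (tPlus μ * y.1).trace = ∑ p, f p := by
    rw [Fintype.sum_prod_type]
    rfl
  have h2 : ∑ p, f p = ∑ p ∈ Finset.univ.filter (fun p : Box μ × Box μ => p.1.col < p.2.col), f p := by
    refine (Finset.sum_filter_of_ne fun p _ hp => ?_).symm
    by_contra h
    refine hp ?_
    change (if _ then (1 : ℂ) else 0) * _ = 0
    rw [if_neg (by omega), zero_mul]
  rw [h1, h2, chiFun_apply, Finset.sum_subtype _ (p := fun p : Box μ × Box μ => p.1.col < p.2.col)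
    (by simp)]
  rfl

/-- Invariance of the trace form: `χ([x, t^β]) = Tr([t_+, x] t^β)`. -/
lemma d1_Jhat_eq_zero {x : G μ} (h : tPlus μ * x.1 - x.1 * tPlus μ = 0) : d1 μ (Jhat x) = 0 := by
  rw [d1_Jhat, Finset.sum_eq_zero, neg_zero]
  intro β _
  have h1 : (tPlus μ * (x.1 * (tUp β).1 - (tUp β).1 * x.1)).trace =
      ((tPlus μ * x.1 - x.1 * tPlus μ) * (tUp β).1).trace := by
    rw [mul_sub, sub_mul, Matrix.trace_sub, Matrix.trace_sub, ← mul_assoc, ← mul_assoc,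
      Matrix.trace_mul_comm (tPlus μ * (tUp β).1), ← mul_assoc]
  rw [chiFun_eq_trace, LieAlgebra.SpecialLinear.sl_bracket, h1, h, zero_mul, Matrix.trace_zero,
    zero_smul]

namespace IsTicTacToe

variable {p : ℕ} {x : G μ} {φ : ℕ → Om μ}

lemma comp00_last (h : IsTicTacToe p x φ) : comp00 (φ p) = φ p :=
  comp00_of_mem (by simpa using h.bideg p le_rfl)

lemma mem_Odeg (h : IsTicTacToe p x φ) {l : ℕ} (hl : l ≤ p) : φ l ∈ Odeg μ 0 := by
  have h1 := Obideg_le_Odeg _ (h.bideg l hl)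
  have h2 : ((l : ℤ) - p) + (p - l) = 0 := by ring
  rwa [h2] at h1

/-- The last term is reduced and of bidegree `(0, 0)`, so it coincides with its own `(0, 0)`
component and belongs to the copy of `U(g_0)`, which `d_0` kills. -/
lemma d0_last (h : IsTicTacToe p x φ) : d0 μ (φ p) = 0 := by
  obtain ⟨u, hu⟩ := exists_JP_eq (h.red p le_rfl) (h.mem_Odeg le_rfl)
  rw [← h.comp00_last, ← hu, comp00_JP, d0_JZ]

/-- The sum telescopes: `d_1` of each new term cancels `d_0` of the preceding one, and `φ_0` has no
`d_1` because `x` commutes with `t_+`. -/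
lemma d_sum (h : IsTicTacToe p x φ) (k : ℕ) (hk : k ≤ p) :
    d μ (∑ l ∈ Finset.range (k + 1), (-1 : ℂ) ^ l • φ l) = (-1 : ℂ) ^ k • d0 μ (φ k) := by
  induction k with
  | zero =>
    rw [zero_add, Finset.sum_range_one, pow_zero, one_smul, one_smul, d_eq, h.start,
      d1_Jhat_eq_zero h.highest, add_zero]
  | succ k ih =>
    rw [Finset.sum_range_succ, map_add, ih (by omega), h.step k (by omega), map_smul, d_eq, smul_add,
      pow_succ]
    simp

lemma comp00_sum (h : IsTicTacToe p x φ) :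
    comp00 (ticTacToeSum p φ) = (-1 : ℂ) ^ p • φ p := by
  have h1 : ∀ k ≤ p, comp00 (∑ l ∈ Finset.range k, (-1 : ℂ) ^ l • φ l) = 0 := by
    intro k hk
    induction k with
    | zero => exact comp00_zero
    | succ k ih =>
      rw [Finset.sum_range_succ, comp00_add, ih (by omega), comp00_smul,
        comp00_of_mem_ne (h.bideg k (by omega)) (fun h2 => by
          have := (Prod.mk.inj h2).1
          omega), smul_zero, add_zero]
  rw [ticTacToeSum, Finset.sum_range_succ, comp00_add, h1 p le_rfl, zero_add, comp00_smul,
    h.comp00_last]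

lemma sum_mem_Ored (h : IsTicTacToe p x φ) : ticTacToeSum p φ ∈ Ored μ :=
  Subalgebra.sum_mem _ fun l hl => Subalgebra.smul_mem _
    (h.red l (by have := Finset.mem_range.1 hl; omega)) _

lemma sum_mem_cocycles (h : IsTicTacToe p x φ) : ticTacToeSum p φ ∈ cocycles μ :=
  ⟨Submodule.sum_mem _ fun l hl => Submodule.smul_mem _ _
    (h.mem_Odeg (by have := Finset.mem_range.1 hl; omega)), by
    rw [ticTacToeSum, h.d_sum p le_rfl, h.d0_last, smul_zero]⟩

end IsTicTacToe

end ticTacToe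

end FiniteW

end

theorem mainTheorem9 (μ : YoungDiagram) :
    -- every class in `H^0(Ω; d)` has exactly one representative in `Ω_red`
    (∀ w : FiniteW.W μ, ∃! X : FiniteW.cocycles μ, X.1 ∈ FiniteW.Ored μ ∧ FiniteW.cls X = w) ∧
    ∃ (j : UniversalEnvelopingAlgebra ℂ (FiniteW.gZero μ) →ₐ[ℂ] FiniteW.Om μ)
      (Φ : FiniteW.W μ →ₐ[ℂ] UniversalEnvelopingAlgebra ℂ (FiniteW.gZero μ)),
      -- `U g_0` is the subalgebra generated by the `Ĵ^a` with `t_a ∈ g_0`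
      (∀ x : FiniteW.gZero μ, j (UniversalEnvelopingAlgebra.ι ℂ x) = FiniteW.Jhat x.1) ∧
      Function.Injective j ∧
      -- `Φ` is the map `W ↦ W^{0,0}`
      (∀ X : FiniteW.cocycles μ, X.1 ∈ FiniteW.Ored μ →
        j (Φ (FiniteW.cls X)) = FiniteW.comp00 X.1) ∧
      Function.Injective Φ ∧
      -- in particular it maps the class of `W(φ) = ∑ (-1)^l φ_l` to `W(φ)^{0,0} = (-1)^p φ_p`
      (∀ (p : ℕ) (x : FiniteW.G μ) (φ : ℕ → FiniteW.Om μ), FiniteW.IsTicTacToe p x φ →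
        ∃ X : FiniteW.cocycles μ, X.1 = FiniteW.ticTacToeSum p φ ∧
          j (Φ (FiniteW.cls X)) = FiniteW.comp00 (FiniteW.ticTacToeSum p φ) ∧
          FiniteW.comp00 (FiniteW.ticTacToeSum p φ) = (-1 : ℂ) ^ p • φ p) ∧
      -- every `g_0`-module is a module of the quantum finite `W` algebra
      ∀ (M : Type*) [AddCommGroup M] [Module ℂ M] [LieRingModule (FiniteW.gZero μ) M]
        [LieModule ℂ (FiniteW.gZero μ) M],
        ∃ ρ : FiniteW.W μ →ₐ[ℂ] Module.End ℂ M,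
          ∀ (X : FiniteW.cocycles μ) (u : UniversalEnvelopingAlgebra ℂ (FiniteW.gZero μ)),
            X.1 ∈ FiniteW.Ored μ → j u = FiniteW.comp00 X.1 →
            ρ (FiniteW.cls X) =
              UniversalEnvelopingAlgebra.lift ℂ (LieModule.toEnd ℂ (FiniteW.gZero μ) M) u := by
  refine ⟨fun w => ?_, FiniteW.JZ μ, FiniteW.miura μ, FiniteW.JZ_ι, FiniteW.JZ_injective,
    fun X => FiniteW.JZ_miura, FiniteW.miura_injective, fun p x φ h => ?_, ?_⟩
  · obtain ⟨X, hX, hw⟩ := FiniteW.exists_reduced_cls w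
    exact ⟨X, ⟨hX, hw⟩, fun X' h => FiniteW.eq_of_cls_eq h.1 hX (h.2.trans hw.symm)⟩
  · exact ⟨⟨_, h.sum_mem_cocycles⟩, rfl, FiniteW.JZ_miura h.sum_mem_Ored, h.comp00_sum⟩
  · intro M _ _ _ _
    refine ⟨(UniversalEnvelopingAlgebra.lift ℂ (LieModule.toEnd ℂ (FiniteW.gZero μ) M)).comp
      (FiniteW.miura μ), fun X u hX hu => ?_⟩
    -- The embedding of `U(g_0)` is injective, so `u` must be the Miura image of the class.
    rw [FiniteW.JZ_injective (hu.trans (FiniteW.JZ_miura hX).symm)]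
    rfl
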